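/- Let $0<\alpha<1$, $T>0$, $K(x)=|x|^{-1-\alpha}$ on $\mathbb R^2$, $(a,b)^\perp=(-b,a)$, $\nabla^\perp=(-\partial_{x_2},\partial_{x_1})$, and consider the equation $$\partial_t\theta+u\cdot\nabla\theta=0,\qquad u=\nabla^\perp (K*\theta).\tag{1}$$ A weak solution of (1) on $(0,T)$ is a function $\theta\in L^2((0,T)\times\mathbb R^2)$ with $u\in L^2((0,T)\times\mathbb R^2;\mathbb R^2)$ and $\int_0^T\!\int_{\mathbb R^2}(\theta\,\partial_t\phi+\theta\,u\cdot\nabla\phi)\,dx\,dt=0$ for all $\phi\in C_c^\infty((0,T)\times\mathbb R^2)$. An almost-sharp front is a family $\theta_\delta$ ($\delta>0$ small) of weak solutions of (1) on $(0,T)$, each of class $C^2$ in $x$, such that, uniformly for $t\in(0,T)$ and small $\delta$, $\|\theta_\delta(\cdot,t)\|_{L^\infty}\lesssim 1$ and $\|\nabla\theta_\delta(\cdot,t)\|_{L^\infty}\lesssim 1/\delta$, and which possesses a compatible curve. A compatible curve is a family $z=z_\delta(s,t)$, $s\in\mathbb T=\mathbb R/\mathbb Z$, $t\in(0,T)$,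 $\delta$ small, for which there is a constant $C$ independent of $\delta$ such that for every small $\delta$: * $z$ is $C^1$ in $(s,t)$, $\partial_s^2z$ is continuous in $(s,t)$, and for each $t$ the map $z(\cdot,t)$ is a $C^2$, injective, counter-clockwise parameterisation, of constant positive speed in $s$, of the boundary of a bounded simply connected open set $A(t)$; * for some $0<C^z<C$ (which may depend on $\delta$) and all $t\in(0,T)$, with $A_{\rm mid}(t)=\{x:\operatorname{dist}(x,\partial A(t))\le C^z\delta\}$, one has $|A_{\rm mid}(t)|\le C\delta$, $\theta_\delta(x,t)=1$ for $x\in A(t)\setminus A_{\rm mid}(t)$, and $\theta_\delta(x,t)=0$ for $x\notin A(t)\cup A_{\rm mid}(t)$. **Theorem.** Let $\theta=(\theta_\delta)$ be an almost-sharp front and $z=(z_\delta)$ any compatible curve for it. Then, for every $\alpha'>\alpha$, $z$ satisfies the sharp-front equation in the weak sense up to $O(\delta^{1-\alpha'})$ errors: $$\partial_t z\cdot N=-\Big(\int_{\mathbb T}K(z-z_*)\,(\partial_s z_*-\partial_s z)\,ds_*\Big)\cdot N+O(\delta^{1-\alpha'}),\qquad N=(\partial_s z)^\perp ,$$ where $z=z(s,t)$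 and $z_*=z(s_*,t)$. That is, for all small $\delta$ the integral over $s_*$ converges absolutely for all $s$ and all $t\in(0,T)$, and for every $\phi\in C_c^\infty((0,T)\times\mathbb R^2)$ the following integral converges absolutely for all small $\delta$ and satisfies, as $\delta\to0^+$, $$\int_0^T\!\!\int_{\mathbb T}\phi(t,z)\Big(\partial_t z+\int_{\mathbb T}K(z-z_*)(\partial_s z_*-\partial_s z)\,ds_*\Big)\cdot N\,ds\,dt=O(\delta^{1-\alpha'}),$$ with an implicit constant that may depend on $\phi$, $\alpha'$, and the families $\theta$ and $z$, but not on $\delta$. -/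

import Mathlib

open MeasureTheory Set Filter Topology Asymptotics
open scoped ContDiff Gradient

/-- The Euclidean plane. -/
abbrev Plane : Type := EuclideanSpace ℝ (Fin 2)

/-- Counter-clockwise rotation by ninety degrees, `(a, b) ↦ (-b, a)`. -/
def perp (v : Plane) : Plane := !₂[-v 1, v 0]

noncomputable section

/-- The kernel `K(x) = |x|^(-1-α)`. -/
def kernel (α : ℝ) (x : Plane) : ℝ := ‖x‖ ^ (-1 - α)

/-- `Λ^(-1+α) f = K * f`. -/
def rieszPotential (α : ℝ) (f : Plane → ℝ) (x : Plane) : ℝ :=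
  ∫ y, kernel α (x - y) * f y

/-- The velocity `u = ∇^⊥ Λ^(-1+α) f` generated by the scalar `f`. -/
def velocity (α : ℝ) (f : Plane → ℝ) (x : Plane) : Plane :=
  perp (∇ (rieszPotential α f) x)

/-- Lebesgue measure on the slab `(0,T) × ℝ²`. -/
def slabMeasure (T : ℝ) : Measure (ℝ × Plane) :=
  (volume.restrict (Ioo 0 T)).prod volume

/-- Test functions `φ ∈ C_c^∞((0,T) × ℝ²)`, time being the first variable. -/
structure IsTestFunction (T : ℝ) (φ : ℝ × Plane → ℝ) : Prop where
  smooth : ContDiff ℝ ∞ φ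
  compact : HasCompactSupport φ
  support : tsupport φ ⊆ Ioo 0 T ×ˢ univ

/-- Weak solutions on `(0,T)` of `∂ₜθ + u·∇θ = 0`, `u = ∇^⊥ Λ^(-1+α) θ`
(`θ t x` is the value at time `t` and position `x`). -/
structure IsWeakSolution (α T : ℝ) (θ : ℝ → Plane → ℝ) : Prop where
  memLp : MemLp (fun p : ℝ × Plane => θ p.1 p.2) 2 (slabMeasure T)
  velocity_memLp : MemLp (fun p : ℝ × Plane => velocity α (θ p.1) p.2) 2 (slabMeasure T)
  weak_eq : ∀ φ : ℝ × Plane → ℝ, IsTestFunction T φ →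
    ∫ p, (θ p.1 p.2 * deriv (fun τ => φ (τ, p.2)) p.1
      + θ p.1 p.2 * inner ℝ (velocity α (θ p.1) p.2) (∇ (fun y => φ (p.1, y)) p.2))
      ∂(slabMeasure T) = 0

/-- `z` (a function of period `1`) is a uniform speed, counter-clockwise parameterisation of a
simple closed `C²` curve, and `A` is the bounded simply connected region that it bounds. The
orientation is expressed by the fact that `(∂ₛz)^⊥` points into `A`. -/
structure IsBoundaryCurve (z : ℝ → Plane) (A : Set Plane) : Prop where
  contDiff : ContDiff ℝ 2 z
  periodic : Function.Periodic z 1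
  injOn : InjOn z (Ico 0 1)
  uniform_speed : ∃ L : ℝ, 0 < L ∧ ∀ s, ‖deriv z s‖ = L
  isOpen : IsOpen A
  isBounded : Bornology.IsBounded A
  simplyConnected : IsSimplyConnected A
  frontier_eq : frontier A = range z
  counterclockwise : ∀ s, ∀ᶠ ε in 𝓝[>] (0 : ℝ), z s + ε • perp (deriv z s) ∈ A

/-- The closed `r`-neighbourhood of the boundary of `A`. -/
def midRegion (A : Set Plane) (r : ℝ) : Set Plane :=
  {x | Metric.infDist x (frontier A) ≤ r}

/-- The part of `A` at distance more than `r` from the boundary of `A`. -/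
def innerRegion (A : Set Plane) (r : ℝ) : Set Plane :=
  {x | x ∈ A ∧ r < Metric.infDist x (frontier A)}

/-- The part of the plane outside the two preceding regions. -/
def outerRegion (A : Set Plane) (r : ℝ) : Set Plane :=
  (innerRegion A r ∪ midRegion A r)ᶜ

/-- The evolving curve `z t s` is compatible with `θ t x` at scale `δ`, with constants `Cz < C`:
the scalar is `1` inside and `0` outside the neighbourhood of width `Cz * δ` of the curve,
and this neighbourhood has area at most `C * δ`. -/
structure IsCompatibleCurveAt (C δ T : ℝ) (θ : ℝ → Plane → ℝ) (z : ℝ → ℝ → Plane) : Prop where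
  contDiffOn : ContDiffOn ℝ 1 (fun p : ℝ × ℝ => z p.1 p.2) (Ioo 0 T ×ˢ univ)
  continuousOn_deriv_two :
    ContinuousOn (fun p : ℝ × ℝ => deriv (deriv (z p.1)) p.2) (Ioo 0 T ×ˢ univ)
  exists_region : ∃ Cz : ℝ, 0 < Cz ∧ Cz < C ∧ ∃ A : ℝ → Set Plane, ∀ t ∈ Ioo 0 T,
    IsBoundaryCurve (z t) (A t) ∧
    (∀ x ∈ innerRegion (A t) (Cz * δ), θ t x = 1) ∧
    (∀ x ∈ outerRegion (A t) (Cz * δ), θ t x = 0) ∧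
    volume (midRegion (A t) (Cz * δ)) ≤ ENNReal.ofReal (C * δ)

/-- The family `z δ t s` is a compatible curve for the family `θ δ t x`, the constant `C` being
independent of `δ`. -/
def IsCompatibleCurve (T : ℝ) (θ : ℝ → ℝ → Plane → ℝ) (z : ℝ → ℝ → ℝ → Plane) : Prop :=
  ∃ C : ℝ, ∀ᶠ δ in 𝓝[>] (0 : ℝ), IsCompatibleCurveAt C δ T (θ δ) (z δ)

/-- Almost-sharp fronts: families `θ δ` (for small `δ > 0`) of bounded solutions on `(0,T)`, of
class `C²` in space, with gradient `O(1/δ)`, which possess a compatible curve. -/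
structure IsAlmostSharpFront (α T : ℝ) (θ : ℝ → ℝ → Plane → ℝ) : Prop where
  solution : ∀ᶠ δ in 𝓝[>] (0 : ℝ), IsWeakSolution α T (θ δ)
  contDiff : ∀ᶠ δ in 𝓝[>] (0 : ℝ), ∀ t ∈ Ioo 0 T, ContDiff ℝ 2 (θ δ t)
  bounded : ∃ C : ℝ, ∀ᶠ δ in 𝓝[>] (0 : ℝ), ∀ t ∈ Ioo 0 T, ∀ x, |θ δ t x| ≤ C
  growth : ∃ C : ℝ, ∀ᶠ δ in 𝓝[>] (0 : ℝ), ∀ t ∈ Ioo 0 T, ∀ x, ‖∇ (θ δ t) x‖ ≤ C / δ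
  exists_curve : ∃ z : ℝ → ℝ → ℝ → Plane, IsCompatibleCurve T θ z

/-- The integrand `K(z - z⋆) (∂ₛz⋆ - ∂ₛz)` of `𝓘(z)`, at the parameters `s` and `s⋆ = r`. -/
def frontIntegrand (α : ℝ) (z : ℝ → Plane) (s r : ℝ) : Plane :=
  kernel α (z s - z r) • (deriv z r - deriv z s)

/-- `𝓘(z)(s) = ∫ K(z - z⋆) (∂ₛz⋆ - ∂ₛz) ds⋆` over one period. -/
def frontIntegral (α : ℝ) (z : ℝ → Plane) (s : ℝ) : Plane :=
  ∫ r in Ioc 0 1, frontIntegrand α z s r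

/-- The residual `∂ₜz · N + 𝓘(z) · N`, `N = (∂ₛz)^⊥`, of the sharp-front equation
`∂ₜz · N = -𝓘(z) · N`, for the evolving curve `z t s`. -/
def frontResidual (α : ℝ) (z : ℝ → ℝ → Plane) (t s : ℝ) : ℝ :=
  inner ℝ (deriv (fun τ => z τ s) t + frontIntegral α (z t) s) (perp (deriv (z t) s))

end

/-!
The integral of the residual against a test function is in fact `O(δ)`, which is stronger than
`O(δ ^ (1 - α'))` for `α' > 0`. The reason is that the indicator of `A(t)` satisfies the weak
formulation of the equation exactly when its boundary solves the sharp-front equation, that `θ`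
differs from this indicator only on a set of area `O(δ)`, and that the weak formulation is stable
in `L¹` on bounded sets of `L^∞`.

*Stability.* The velocity is not controlled by the size of `θ`, since `∇K` is not locally
integrable. In the nonlinear term `∫∫ θ(x) θ(y) ∇^⊥K(x - y) · ∇φ(x) dx dy`, however, `∇K` is odd, so
that exchanging `x` and `y` replaces `∇φ(x)` by half of `∇φ(x) - ∇φ(y)`. The kernel is then bounded
by a multiple of the integrable function `min(|v|, 1) |v|^(-2-α)` of `v = x - y`. To keep all
integrals absolutely convergent this is done for the smooth kernels
`K_ε(v) = (|v|² + ε²)^(-(1+α)/2)`, with a bound independent of `ε`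
(`regInteraction_eq_symm`, `abs_regInteraction_sub_le`). As `ε → 0` the regularised term tends to
the nonlinear term of the weak formulation when the scalar is `C¹` with compact support
(`tendsto_regInteraction_smooth`).

*The indicator.* Tubular coordinates around the curve show that the region lies on one side of
it (`disjoint_tube_right`) and give Green's formula (`green`) under the hypotheses at hand. Applied
in both variables, it turns the regularised nonlinear term of the indicator into
`∮∮ φ(z) K_ε(z - z⋆) ∂ₛz⋆ · N` (`regInteraction_indicator`). Since `∂ₛz · N = 0`, one may subtract
`∂ₛz` from `∂ₛz⋆`; the integrand is then `O(|s - s⋆|^(-α))` by the chord-arc bound, and dominated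
convergence yields the tested sharp-front integral (`tendsto_regInteraction_indicator`).

*The time derivative.* The identity `∫∫_{A(t)} ∂ₜφ = ∫∮ φ ∂ₜz · N` is reduced by Green's formula to
an identity between integrals over the parameter domain; it expresses that the Jacobian determinant
of two functions on the cylinder, one of which vanishes near the ends, integrates to zero
(`integral_region_time_deriv`).

Subtracting the weak formulation for `θ` from the identity for the indicator at each time
(`abs_weak_terms_sub_le`) and integrating in time bounds the tested residual by a multiple of the
area of the transition region (`abs_integral_residual_le`).
-/

/-! ### Rotation of the plane -/

@[simp] lemma perp_apply_zero (v : Plane) : perp v 0 = -v 1 := rfl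

@[simp] lemma perp_apply_one (v : Plane) : perp v 1 = v 0 := rfl

lemma inner_plane (v w : Plane) : inner ℝ v w = v 0 * w 0 + v 1 * w 1 := by
  simp [PiLp.inner_apply, Fin.sum_univ_two, mul_comm]

/-- The rotation `perp` as a continuous linear map. -/
noncomputable def perpCLM : Plane →L[ℝ] Plane :=
  LinearMap.toContinuousLinearMap
    { toFun := perp
      map_add' := fun v w => by ext i; fin_cases i <;> simp [add_comm]
      map_smul' := fun c v => by ext i; fin_cases i <;> simp }

@[simp] lemma perpCLM_apply (v : Plane) : perpCLM v = perp v := rfl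

lemma perp_sub (v w : Plane) : perp (v - w) = perp v - perp w := perpCLM.map_sub v w

lemma continuous_perp : Continuous perp := perpCLM.continuous

@[simp] lemma inner_perp_perp (v w : Plane) : inner ℝ (perp v) (perp w) = inner ℝ v w := by
  simp only [inner_plane, perp_apply_zero, perp_apply_one]; ring

lemma inner_perp_left (v w : Plane) : inner ℝ (perp v) w = -inner ℝ v (perp w) := by
  simp only [inner_plane, perp_apply_zero, perp_apply_one]; ring

@[simp] lemma inner_self_perp (v : Plane) : inner ℝ v (perp v) = 0 := by
  simp only [inner_plane, perp_apply_zero, perp_apply_one]; ring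

@[simp] lemma norm_perp (v : Plane) : ‖perp v‖ = ‖v‖ := by
  rw [← sq_eq_sq₀ (norm_nonneg _) (norm_nonneg _), ← real_inner_self_eq_norm_sq,
    ← real_inner_self_eq_norm_sq, inner_perp_perp]

/-! ### The regularised kernel -/

/-- The smooth kernel `(|v|² + ε²)^(-(1+α)/2)`, which increases to `|v|^(-1-α)` as `ε → 0`. -/
noncomputable def regKernel (α ε : ℝ) (v : Plane) : ℝ := (‖v‖ ^ 2 + ε ^ 2) ^ (-(1 + α) / 2)

/-- The gradient of `regKernel`. -/
noncomputable def regKernelGrad (α ε : ℝ) (v : Plane) : Plane :=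
  (-(1 + α) * (‖v‖ ^ 2 + ε ^ 2) ^ (-(3 + α) / 2)) • v

section regKernel

variable {α ε : ℝ}

lemma regKernel_base_pos (hε : 0 < ε) (v : Plane) : 0 < ‖v‖ ^ 2 + ε ^ 2 := by positivity

lemma contDiff_regKernel (hε : 0 < ε) : ContDiff ℝ ∞ (regKernel α ε) := by
  unfold regKernel
  refine ContDiff.rpow_const_of_ne ?_ fun v => (regKernel_base_pos (ε := ε) hε v).ne'
  exact (contDiff_norm_sq (E := Plane) ℝ).add contDiff_const

lemma continuous_regKernelGrad (hε : 0 < ε) : Continuous (regKernelGrad α ε) := by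
  unfold regKernelGrad
  have h : Continuous fun v : Plane => (‖v‖ ^ 2 + ε ^ 2) ^ (-(3 + α) / 2) :=
    Continuous.rpow_const (by fun_prop) fun v => Or.inl (regKernel_base_pos hε v).ne'
  exact (continuous_const.mul h).smul continuous_id

lemma hasFDerivAt_regKernel (hε : 0 < ε) (v : Plane) :
    HasFDerivAt (regKernel α ε) (innerSL ℝ (regKernelGrad α ε v)) v := by
  have h1 : HasFDerivAt (fun v : Plane => ‖v‖ ^ 2 + ε ^ 2) (2 • innerSL ℝ v) v :=
    ((hasStrictFDerivAt_norm_sq v).hasFDerivAt).add_const _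
  have h2 := h1.rpow_const (p := -(1 + α) / 2) (Or.inl (regKernel_base_pos hε v).ne')
  refine h2.congr_fderiv ?_
  ext w
  have e : (-(1 + α) / 2 - 1) = -(3 + α) / 2 := by ring
  simp only [regKernelGrad, e, smul_apply, innerSL_apply_apply, smul_eq_mul,
    inner_smul_left, nsmul_eq_mul, RCLike.conj_to_real]
  push_cast
  ring

lemma regKernelGrad_neg (v : Plane) : regKernelGrad α ε (-v) = -regKernelGrad α ε v := by
  simp [regKernelGrad]

lemma regKernel_nonneg (v : Plane) : 0 ≤ regKernel α ε v := by
  unfold regKernel; positivity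

lemma kernel_nonneg (v : Plane) : 0 ≤ kernel α v := by
  unfold kernel; positivity

lemma measurable_kernel : Measurable (kernel α) := by
  unfold kernel; fun_prop

lemma kernel_eq_sq_rpow (v : Plane) : kernel α v = (‖v‖ ^ 2) ^ (-(1 + α) / 2) := by
  rw [kernel, ← Real.rpow_natCast, ← Real.rpow_mul (norm_nonneg v)]
  congr 1; push_cast; ring

lemma regKernel_le_kernel (hα : 0 < α) {v : Plane} (hv : v ≠ 0) :
    regKernel α ε v ≤ kernel α v := by
  have : 0 < ‖v‖ := norm_pos_iff.2 hv
  rw [kernel_eq_sq_rpow, regKernel]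
  exact Real.rpow_le_rpow_of_nonpos (by positivity) (by nlinarith) (by linarith)

lemma tendsto_regKernel {v : Plane} (hv : v ≠ 0) :
    Tendsto (fun ε => regKernel α ε v) (𝓝[>] 0) (𝓝 (kernel α v)) := by
  have : 0 < ‖v‖ := norm_pos_iff.2 hv
  have h : ContinuousAt (fun ε : ℝ => (‖v‖ ^ 2 + ε ^ 2) ^ (-(1 + α) / 2)) 0 := by
    refine ContinuousAt.rpow_const (by fun_prop) (Or.inl ?_)
    positivity
  have := h.tendsto
  simp only [ne_eq, OfNat.ofNat_ne_zero, not_false_eq_true, zero_pow, add_zero] at this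
  rw [kernel_eq_sq_rpow]
  exact this.mono_left nhdsWithin_le_nhds

lemma norm_regKernelGrad_le (hα : 0 < α) (v : Plane) :
    ‖regKernelGrad α ε v‖ ≤ (1 + α) * ‖v‖ ^ (-2 - α) := by
  rcases eq_or_ne v 0 with rfl | hv
  · simp only [regKernelGrad, smul_zero, norm_zero]; positivity
  have hv' : 0 < ‖v‖ := norm_pos_iff.2 hv
  have h1 : (‖v‖ ^ 2 + ε ^ 2) ^ (-(3 + α) / 2) ≤ (‖v‖ ^ 2) ^ (-(3 + α) / 2) :=
    Real.rpow_le_rpow_of_nonpos (by positivity) (by nlinarith) (by linarith)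
  have h2 : (‖v‖ ^ 2) ^ (-(3 + α) / 2) * ‖v‖ = ‖v‖ ^ (-2 - α) := by
    rw [← Real.rpow_natCast, ← Real.rpow_mul hv'.le]
    nth_rewrite 2 [← Real.rpow_one ‖v‖]
    rw [← Real.rpow_add hv']
    congr 1; push_cast; ring
  rw [regKernelGrad, norm_smul, Real.norm_eq_abs, abs_mul, abs_neg, abs_of_pos (by linarith),
    abs_of_nonneg (by positivity), ← h2, mul_assoc]
  gcongr

/-- For fixed `ε` the gradient of the regularised kernel is bounded. -/
lemma exists_bound_regKernelGrad (hα : 0 < α) (hε : 0 < ε) :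
    ∃ C, ∀ v, ‖regKernelGrad α ε v‖ ≤ C := by
  obtain ⟨C, hC⟩ := (isCompact_closedBall (0 : Plane) 1).exists_bound_of_continuousOn
    (continuous_regKernelGrad (α := α) hε).continuousOn
  refine ⟨max C (1 + α), fun v => ?_⟩
  rcases le_total ‖v‖ 1 with h | h
  · exact (hC v (by simpa using h)).trans (le_max_left _ _)
  · refine (norm_regKernelGrad_le hα v).trans (le_trans ?_ (le_max_right _ _))
    have : ‖v‖ ^ (-2 - α) ≤ 1 := Real.rpow_le_one_of_one_le_of_nonpos h (by linarith)
    nlinarith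

end regKernel

/-! ### The symmetrised interaction -/

/-- The integrable majorant `min(|v|, 1) |v|^(-2-α)` of the symmetrised interaction kernel. -/
noncomputable def majorant (α : ℝ) (v : Plane) : ℝ := min ‖v‖ 1 * ‖v‖ ^ (-2 - α)

lemma majorant_nonneg (α : ℝ) (v : Plane) : 0 ≤ majorant α v := by
  unfold majorant; positivity

lemma majorant_neg (α : ℝ) (v : Plane) : majorant α (-v) = majorant α v := by
  simp [majorant]

lemma integrable_majorant {α : ℝ} (hα₀ : 0 < α) (hα₁ : α < 1) :
    Integrable (majorant α) := by
  have key : IntegrableOn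
      (fun y : ℝ => y ^ (Module.finrank ℝ Plane - 1) • (min y 1 * y ^ (-2 - α))) (Ioi 0) := by
    rw [← Ioc_union_Ioi_eq_Ioi zero_le_one]
    refine IntegrableOn.union ?_ ?_
    · have h : IntegrableOn (fun y : ℝ => y ^ (-α)) (Ioc 0 1) := by
        rw [← intervalIntegrable_iff_integrableOn_Ioc_of_le zero_le_one]
        exact intervalIntegral.intervalIntegrable_rpow' (by linarith)
      refine h.congr_fun (fun y hy => ?_) measurableSet_Ioc
      have hy0 : 0 < y := hy.1
      simp only [finrank_euclideanSpace, Fintype.card_fin, Nat.add_one_sub_one, pow_one,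
        smul_eq_mul, min_eq_left hy.2]
      rw [← mul_assoc, ← pow_two, ← Real.rpow_natCast, ← Real.rpow_add hy0]
      congr 1; push_cast; ring
    · have h : IntegrableOn (fun y : ℝ => y ^ (-1 - α)) (Ioi 1) :=
        integrableOn_Ioi_rpow_of_lt (by linarith) one_pos
      refine h.congr_fun (fun y hy => ?_) measurableSet_Ioi
      have hy0 : 0 < y := zero_lt_one.trans hy
      simp only [finrank_euclideanSpace, Fintype.card_fin, Nat.add_one_sub_one, pow_one,
        smul_eq_mul, min_eq_right (mem_Ioi.1 hy).le, one_mul]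
      nth_rewrite 2 [← Real.rpow_one y]
      rw [← Real.rpow_add hy0]
      congr 1; ring
  exact (integrable_fun_norm_addHaar (volume : Measure Plane)
    (f := fun y : ℝ => min y 1 * y ^ (-2 - α))).2 key

/-- The regularised nonlinear term `∫∫ f(x) f(y) ∇^⊥K_ε(x - y) · ∇Φ(x) dx dy`. -/
noncomputable def regInteraction (α ε : ℝ) (Φ f : Plane → ℝ) : ℝ :=
  -∫ p : Plane × Plane, f p.1 * f p.2 * inner ℝ (regKernelGrad α ε (p.1 - p.2)) (perp (∇ Φ p.1))

section interaction

variable {α ε : ℝ} {Φ : Plane → ℝ}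

lemma integrable_regInteraction (hα : 0 < α) (hε : 0 < ε) {B : ℝ} (hΦ : Continuous (∇ Φ))
    (hB : ∀ x, ‖∇ Φ x‖ ≤ B) {f : Plane → ℝ} (hf : Integrable f) :
    Integrable (fun p : Plane × Plane =>
      f p.1 * f p.2 * inner ℝ (regKernelGrad α ε (p.1 - p.2)) (perp (∇ Φ p.1))) := by
  obtain ⟨C, hC⟩ := exists_bound_regKernelGrad hα hε
  have h := hf.mul_prod hf
  refine h.mul_bdd (c := C * B) ?_ (.of_forall fun p => ?_)
  · refine Continuous.aestronglyMeasurable ?_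
    exact ((continuous_regKernelGrad hε).comp (by fun_prop)).inner
      (continuous_perp.comp (hΦ.comp continuous_fst))
  · refine (norm_inner_le_norm _ _).trans ?_
    rw [norm_perp]
    exact mul_le_mul (hC _) (hB _) (norm_nonneg _) ((norm_nonneg _).trans (hC 0))

/-- Exchanging the variables shows that only the increment of `∇Φ` matters, which compensates one
power of the singularity of `∇K`. -/
lemma regInteraction_eq_symm (hα : 0 < α) (hε : 0 < ε) {B : ℝ} (hΦ : Continuous (∇ Φ))
    (hB : ∀ x, ‖∇ Φ x‖ ≤ B) {f : Plane → ℝ} (hf : Integrable f) :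
    regInteraction α ε Φ f = -(1 / 2) * ∫ p : Plane × Plane, f p.1 * f p.2 *
      inner ℝ (regKernelGrad α ε (p.1 - p.2)) (perp (∇ Φ p.1 - ∇ Φ p.2)) := by
  have hi := integrable_regInteraction hα hε hΦ hB hf
  have hsw := integral_prod_swap (μ := (volume : Measure Plane)) (ν := (volume : Measure Plane))
    (fun p : Plane × Plane =>
      f p.1 * f p.2 * inner ℝ (regKernelGrad α ε (p.1 - p.2)) (perp (∇ Φ p.1)))
  have hi' := hi.swap
  have : ∫ p : Plane × Plane, f p.1 * f p.2 *
      inner ℝ (regKernelGrad α ε (p.1 - p.2)) (perp (∇ Φ p.1 - ∇ Φ p.2)) =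
      (∫ p : Plane × Plane,
        f p.1 * f p.2 * inner ℝ (regKernelGrad α ε (p.1 - p.2)) (perp (∇ Φ p.1))) +
      ∫ p : Plane × Plane,
        f p.1 * f p.2 * inner ℝ (regKernelGrad α ε (p.1 - p.2)) (perp (∇ Φ p.1)) := by
    rw [← Measure.volume_eq_prod] at hsw hi'
    refine Eq.trans ?_ ((integral_add hi hi').trans (congrArg _ hsw))
    congr 1
    ext p
    simp only [Function.comp]
    simp only [Prod.fst_swap, Prod.snd_swap]
    rw [← neg_sub p.1 p.2, regKernelGrad_neg, perp_sub, inner_sub_right, inner_neg_left]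
    ring
  rw [this, regInteraction]
  ring

/-- Stability of the interaction in `L¹`, uniformly in `ε`. -/
lemma abs_regInteraction_sub_le (hα₀ : 0 < α) (hα₁ : α < 1) (hε : 0 < ε) {B c M : ℝ}
    (hΦ : Continuous (∇ Φ)) (hB : ∀ x, ‖∇ Φ x‖ ≤ B)
    (hc : ∀ x y, ‖∇ Φ x - ∇ Φ y‖ ≤ c * min ‖x - y‖ 1)
    {f g : Plane → ℝ} (hf : Integrable f) (hg : Integrable g) (hfM : ∀ x, |f x| ≤ M)
    (hgM : ∀ x, |g x| ≤ M) :
    |regInteraction α ε Φ f - regInteraction α ε Φ g| ≤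
      (1 + α) * c * M * (∫ v, majorant α v) * ∫ x, |f x - g x| := by
  have hM : 0 ≤ M := (abs_nonneg _).trans (hfM 0)
  have hc0 : 0 ≤ c := by
    have := (norm_nonneg _).trans (hc 0 (EuclideanSpace.single 0 1))
    simpa using this
  set k : Plane × Plane → ℝ := fun p =>
    inner ℝ (regKernelGrad α ε (p.1 - p.2)) (perp (∇ Φ p.1 - ∇ Φ p.2)) with hk
  have hkb : ∀ p, |k p| ≤ (1 + α) * c * majorant α (p.1 - p.2) := by
    intro p
    refine (abs_real_inner_le_norm _ _).trans ?_
    rw [norm_perp]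
    calc _ ≤ ((1 + α) * ‖p.1 - p.2‖ ^ (-2 - α)) * (c * min ‖p.1 - p.2‖ 1) :=
          mul_le_mul (norm_regKernelGrad_le hα₀ _) (hc _ _) (norm_nonneg _) (by positivity)
      _ = _ := by rw [majorant]; ring
  have hkc : Continuous k :=
    ((continuous_regKernelGrad hε).comp (by fun_prop)).inner (continuous_perp.comp
      ((hΦ.comp continuous_fst).sub (hΦ.comp continuous_snd)))
  obtain ⟨C, hC⟩ := exists_bound_regKernelGrad hα₀ hε
  have hkC : ∀ p, ‖k p‖ ≤ C * (B + B) := by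
    intro p
    refine (norm_inner_le_norm _ _).trans ?_
    rw [norm_perp]
    exact mul_le_mul (hC _) ((norm_sub_le _ _).trans (add_le_add (hB _) (hB _)))
      (norm_nonneg _) ((norm_nonneg _).trans (hC 0))
  have hif : Integrable (fun p : Plane × Plane => f p.1 * f p.2 * k p) :=
    (hf.mul_prod hf).mul_bdd hkc.aestronglyMeasurable (.of_forall hkC)
  have hig : Integrable (fun p : Plane × Plane => g p.1 * g p.2 * k p) :=
    (hg.mul_prod hg).mul_bdd hkc.aestronglyMeasurable (.of_forall hkC)
  have hd : Integrable (fun x => |f x - g x|) := (hf.sub hg).abs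
  have hm := integrable_majorant hα₀ hα₁
  have i1 : Integrable (fun p : Plane × Plane => |f p.1 - g p.1| * majorant α (p.1 - p.2)) := by
    have := (hd.convolution_integrand (ContinuousLinearMap.mul ℝ ℝ) hm).swap
    refine this.congr (.of_forall fun p => ?_)
    simp only [Function.comp, Prod.fst_swap, Prod.snd_swap, ContinuousLinearMap.mul_apply']
    rw [← majorant_neg, neg_sub]
  have i2 : Integrable (fun p : Plane × Plane => |f p.2 - g p.2| * majorant α (p.1 - p.2)) :=
    hd.convolution_integrand (ContinuousLinearMap.mul ℝ ℝ) hm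
  have e1 : ∫ p : Plane × Plane, |f p.1 - g p.1| * majorant α (p.1 - p.2) =
      (∫ v, majorant α v) * ∫ x, |f x - g x| := by
    rw [Measure.volume_eq_prod, integral_prod _ i1]
    simp_rw [integral_const_mul]
    simp_rw [integral_sub_left_eq_self (majorant α)]
    rw [integral_mul_const, mul_comm]
  have e2 : ∫ p : Plane × Plane, |f p.2 - g p.2| * majorant α (p.1 - p.2) =
      (∫ v, majorant α v) * ∫ x, |f x - g x| := by
    rw [Measure.volume_eq_prod, integral_prod_symm _ i2]
    simp_rw [integral_const_mul]
    simp_rw [integral_sub_right_eq_self (majorant α)]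
    rw [integral_mul_const, mul_comm]
  rw [regInteraction_eq_symm hα₀ hε hΦ hB hf, regInteraction_eq_symm hα₀ hε hΦ hB hg,
    ← mul_sub, ← integral_sub hif hig, abs_mul]
  have hle : |∫ p : Plane × Plane, (f p.1 * f p.2 * k p - g p.1 * g p.2 * k p)| ≤
      ∫ p : Plane × Plane, ((1 + α) * c * M) * (|f p.1 - g p.1| * majorant α (p.1 - p.2) +
        |f p.2 - g p.2| * majorant α (p.1 - p.2)) := by
    refine (abs_integral_le_integral_abs).trans ?_
    refine integral_mono (hif.sub hig).abs ((i1.add i2).const_mul _) fun p => ?_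
    have e : f p.1 * f p.2 * k p - g p.1 * g p.2 * k p =
        ((f p.1 - g p.1) * f p.2 + g p.1 * (f p.2 - g p.2)) * k p := by ring
    simp only [e, abs_mul]
    have h1 : |(f p.1 - g p.1) * f p.2 + g p.1 * (f p.2 - g p.2)| ≤
        M * (|f p.1 - g p.1| + |f p.2 - g p.2|) := by
      refine (abs_add_le _ _).trans ?_
      rw [abs_mul, abs_mul]
      nlinarith [hfM p.2, hgM p.1, abs_nonneg (f p.1 - g p.1), abs_nonneg (f p.2 - g p.2)]
    calc _ ≤ (M * (|f p.1 - g p.1| + |f p.2 - g p.2|)) *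
          ((1 + α) * c * majorant α (p.1 - p.2)) :=
          mul_le_mul h1 (hkb p) (abs_nonneg _) (by positivity)
      _ = _ := by ring
  rw [integral_const_mul, integral_add i1 i2, e1, e2] at hle
  rw [show |(-(1 / 2) : ℝ)| = 1 / 2 by norm_num]
  linarith

end interaction

/-! ### The nonlinear term of a smooth compactly supported scalar -/

section smooth

variable {α : ℝ} {f : Plane → ℝ}

lemma locallyIntegrable_kernel (hα₁ : α < 1) : LocallyIntegrable (kernel α) := by
  refine locallyIntegrable_of_norm_le_rpow (C := 1) (α := 1 + α) (by simp) ?_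
    (.of_forall fun x => ?_) measurable_kernel.aestronglyMeasurable
  · simp only [finrank_euclideanSpace, Fintype.card_fin]; push_cast; linarith
  · rw [Real.norm_of_nonneg (kernel_nonneg x), kernel, one_mul]
    exact le_of_eq (by congr 1; ring)

/-- The components of the velocity: `∇K` is not locally integrable, so the derivative in
`∇^⊥ (K * f)` has to fall on `f`. -/
lemma inner_velocity (hα₁ : α < 1) (hf : ContDiff ℝ 1 f) (hfc : HasCompactSupport f) (x w : Plane) :
    inner ℝ (velocity α f x) w = -∫ y, kernel α y * fderiv ℝ f (x - y) (perp w) := by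
  have h := hfc.hasFDerivAt_convolution_right (ContinuousLinearMap.mul ℝ ℝ)
    (locallyIntegrable_kernel hα₁) hf x
  have e : convolution (kernel α) f (ContinuousLinearMap.mul ℝ ℝ) volume = rieszPotential α f := by
    ext x; rw [convolution_eq_swap]; rfl
  rw [e] at h
  have hex := (hfc.fderiv ℝ).convolutionExists_right ((ContinuousLinearMap.mul ℝ ℝ).precompR Plane)
    (locallyIntegrable_kernel hα₁) (hf.continuous_fderiv one_ne_zero) x
  rw [velocity, inner_perp_left, inner_gradient_left, h.fderiv, convolution_def]
  rw [ContinuousLinearMap.integral_apply hex]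
  rfl

/-- The regularised counterpart of `inner_velocity`, after an integration by parts. -/
lemma integral_regKernel_mul_fderiv {ε : ℝ} (hε : 0 < ε) (hf : ContDiff ℝ 1 f)
    (hfc : HasCompactSupport f) (x w : Plane) :
    ∫ y, regKernel α ε y * fderiv ℝ f (x - y) w =
      ∫ y, f y * inner ℝ (regKernelGrad α ε (x - y)) w := by
  have hK : ContDiff ℝ 1 (fun y => regKernel α ε (x - y)) :=
    ((contDiff_regKernel hε).of_le (by simp)).comp (contDiff_const.sub contDiff_id)
  have hKd : ∀ y, fderiv ℝ (fun y => regKernel α ε (x - y)) y w =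
      -inner ℝ (regKernelGrad α ε (x - y)) w := by
    intro y
    have h := (hasFDerivAt_regKernel (α := α) hε (x - y)).comp y
      ((hasFDerivAt_id y).const_sub x)
    rw [HasFDerivAt.fderiv (f := fun y => regKernel α ε (x - y)) h]
    simp
  have hgc : Continuous fun y => inner ℝ (regKernelGrad α ε (x - y)) w :=
    ((continuous_regKernelGrad hε).comp (by fun_prop)).inner continuous_const
  have hfd : Continuous fun y => fderiv ℝ f y w :=
    (hf.continuous_fderiv one_ne_zero).clm_apply continuous_const
  have hfdc : HasCompactSupport fun y => fderiv ℝ f y w := by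
    refine (hfc.fderiv ℝ).comp_left (g := fun L : Plane →L[ℝ] ℝ => L w) ?_
    simp
  have := integral_mul_fderiv_eq_neg_fderiv_mul_of_integrable (μ := (volume : Measure Plane))
    (f := fun y => regKernel α ε (x - y)) (g := f) (v := w)
    (by
      simp_rw [hKd]
      exact (hgc.neg.mul hf.continuous).integrable_of_hasCompactSupport hfc.mul_left)
    ((hK.continuous.mul hfd).integrable_of_hasCompactSupport hfdc.mul_left)
    ((hK.continuous.mul hf.continuous).integrable_of_hasCompactSupport hfc.mul_left)
    (fun y _ => hK.differentiable one_ne_zero y) (fun y _ => hf.differentiable one_ne_zero y)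
  simp_rw [hKd] at this
  rw [← integral_sub_left_eq_self _ volume x]
  simp only [sub_sub_cancel]
  rw [this, ← integral_neg]
  congr 1
  ext y
  ring

/-- For a smooth scalar the regularised interaction converges to the nonlinear term of the weak
formulation. -/
lemma tendsto_regInteraction_smooth (hα₀ : 0 < α) (hα₁ : α < 1) (hf : ContDiff ℝ 1 f)
    (hfc : HasCompactSupport f) {Φ : Plane → ℝ} (hΦ : ContDiff ℝ 1 Φ)
    (hΦc : HasCompactSupport Φ) :
    Tendsto (fun ε => regInteraction α ε Φ f) (𝓝[>] 0)
      (𝓝 (∫ x, f x * inner ℝ (velocity α f x) (∇ Φ x))) := by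
  have hgc : Continuous (∇ Φ) := by
    unfold gradient
    exact (InnerProductSpace.toDual ℝ Plane).symm.continuous.comp
      (hΦ.continuous_fderiv one_ne_zero)
  have hgs : HasCompactSupport (∇ Φ) := by
    unfold gradient
    exact (hΦc.fderiv ℝ).comp_left (map_zero _)
  obtain ⟨B, hB⟩ := hgs.exists_bound_of_continuous hgc
  obtain ⟨D, hD⟩ := (hfc.fderiv ℝ).exists_bound_of_continuous (hf.continuous_fderiv one_ne_zero)
  have hfi := hf.continuous.integrable_of_hasCompactSupport (μ := volume) hfc
  -- the difference set outside of which `K(y) Df(x-y)` vanishes, for all `x` in the support of `f`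
  set S : Set Plane :=
    (fun p : Plane × Plane => p.1 - p.2) '' (tsupport f ×ˢ tsupport (fderiv ℝ f)) with hS
  have hSc : IsCompact S := (IsCompact.prod hfc (hfc.fderiv ℝ)).image (by fun_prop)
  have hKS : IntegrableOn (kernel α) S := (locallyIntegrable_kernel hα₁).integrableOn_isCompact hSc
  set G : Plane → ℝ → ℝ := fun x ε =>
    -∫ y, regKernel α ε y * fderiv ℝ f (x - y) (perp (∇ Φ x)) with hG
  have hbd : ∀ x ∈ tsupport f, ∀ ε, ∀ y, y ≠ 0 →
      ‖regKernel α ε y * fderiv ℝ f (x - y) (perp (∇ Φ x))‖ ≤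
      S.indicator (fun y => kernel α y * (D * B)) y := by
    intro x hx ε y hy
    by_cases hyS : y ∈ S
    · rw [indicator_of_mem hyS, norm_mul, Real.norm_of_nonneg (regKernel_nonneg y)]
      refine mul_le_mul (regKernel_le_kernel hα₀ hy) ?_ (norm_nonneg _) (kernel_nonneg y)
      refine (ContinuousLinearMap.le_opNorm _ _).trans ?_
      rw [norm_perp]
      exact mul_le_mul (hD _) (hB _) (norm_nonneg _) ((norm_nonneg _).trans (hD 0))
    · have : fderiv ℝ f (x - y) = 0 := by
        by_contra h
        exact hyS ⟨(x, x - y), ⟨hx, subset_tsupport _ h⟩, by simp⟩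
      simp [this, indicator_of_notMem hyS]
  have hbi : Integrable (S.indicator (fun y => kernel α y * (D * B))) :=
    (integrable_indicator_iff hSc.measurableSet).2 (hKS.mul_const _)
  have hae : ∀ᵐ y : Plane, y ≠ 0 := by simp [ae_iff, measure_singleton]
  have hmeas : ∀ ε x, 0 < ε → AEStronglyMeasurable
      (fun y => regKernel α ε y * fderiv ℝ f (x - y) (perp (∇ Φ x))) := fun ε x hε =>
    ((contDiff_regKernel hε).continuous.mul (((hf.continuous_fderiv one_ne_zero).comp
      (by fun_prop)).clm_apply continuous_const)).aestronglyMeasurable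
  have hlim : ∀ x ∈ tsupport f, Tendsto (G x) (𝓝[>] 0)
      (𝓝 (inner ℝ (velocity α f x) (∇ Φ x))) := by
    intro x hx
    rw [inner_velocity hα₁ hf hfc]
    refine (tendsto_integral_filter_of_dominated_convergence _ ?_ ?_ hbi ?_).neg
    · filter_upwards [self_mem_nhdsWithin] with ε hε using hmeas ε x hε
    · filter_upwards with ε
      filter_upwards [hae] with y hy using hbd x hx ε y hy
    · filter_upwards [hae] with y hy
      exact (tendsto_regKernel hy).mul_const _
  have hGb : ∀ x ∈ tsupport f, ∀ ε, ‖G x ε‖ ≤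
      ∫ y, S.indicator (fun y => kernel α y * (D * B)) y := by
    intro x hx ε
    rw [hG, norm_neg]
    exact norm_integral_le_of_norm_le hbi (hae.mono fun y hy => hbd x hx ε y hy)
  have heq : ∀ ε x, 0 < ε → f x * G x ε = -∫ y, f x * f y *
      inner ℝ (regKernelGrad α ε (x - y)) (perp (∇ Φ x)) := by
    intro ε x hε
    simp only [hG]
    rw [integral_regKernel_mul_fderiv hε hf hfc, mul_neg, ← integral_const_mul]
    simp only [mul_assoc]
  have hint : ∀ ε, 0 < ε → regInteraction α ε Φ f = ∫ x, f x * G x ε := by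
    intro ε hε
    rw [regInteraction, Measure.volume_eq_prod, integral_prod _
      (integrable_regInteraction hα₀ hε hgc hB hfi), ← integral_neg]
    simp_rw [heq ε _ hε]
  refine Tendsto.congr' (f₁ := fun ε => ∫ x, f x * G x ε) ?_ ?_
  · filter_upwards [self_mem_nhdsWithin] with ε hε using (hint ε hε).symm
  refine tendsto_integral_filter_of_dominated_convergence
    (fun x => |f x| * ∫ y, S.indicator (fun y => kernel α y * (D * B)) y) ?_ ?_ ?_ ?_
  · filter_upwards [self_mem_nhdsWithin] with ε hε
    simp_rw [heq ε _ hε]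
    exact (integrable_regInteraction hα₀ hε hgc hB hfi).integral_prod_left.neg.aestronglyMeasurable
  · filter_upwards with ε
    filter_upwards with x
    rw [norm_mul, Real.norm_eq_abs]
    by_cases hx : x ∈ tsupport f
    · exact mul_le_mul_of_nonneg_left (hGb x hx ε) (abs_nonneg _)
    · simp [image_eq_zero_of_notMem_tsupport hx]
  · exact hfi.abs.mul_const _
  · filter_upwards with x
    by_cases hx : x ∈ tsupport f
    · exact (hlim x hx).const_mul _
    · simp [image_eq_zero_of_notMem_tsupport hx]

end smooth

/-! ### Quantitative injectivity of the curve -/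

section curve

variable {z : ℝ → Plane} {A : Set Plane}

lemma IsBoundaryCurve.deriv_periodic (h : IsBoundaryCurve z A) :
    Function.Periodic (deriv z) 1 := fun s => by
  have : (fun x => z (x + 1)) = z := funext h.periodic
  rw [← deriv_comp_add_const, this]

lemma IsBoundaryCurve.contDiff_deriv (h : IsBoundaryCurve z A) : ContDiff ℝ 1 (deriv z) :=
  ((contDiff_succ_iff_deriv (n := 1)).1 (by simpa [one_add_one_eq_two] using h.contDiff)).2.2

lemma IsBoundaryCurve.hasDerivAt (h : IsBoundaryCurve z A) (s : ℝ) :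
    HasDerivAt z (deriv z s) s :=
  (h.contDiff.differentiable two_ne_zero s).hasDerivAt

lemma IsBoundaryCurve.hasDerivAt_deriv (h : IsBoundaryCurve z A) (s : ℝ) :
    HasDerivAt (deriv z) (deriv (deriv z) s) s :=
  (h.contDiff_deriv.differentiable one_ne_zero s).hasDerivAt

lemma IsBoundaryCurve.deriv_deriv_periodic (h : IsBoundaryCurve z A) :
    Function.Periodic (deriv (deriv z)) 1 := fun s => by
  have : (fun x => deriv z (x + 1)) = deriv z := funext h.deriv_periodic
  rw [← deriv_comp_add_const, this]

lemma IsBoundaryCurve.exists_int_of_eq (h : IsBoundaryCurve z A) {s r : ℝ} (e : z s = z r) :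
    ∃ n : ℤ, s - r = n := by
  have hf : ∀ x, z (Int.fract x) = z x := fun x => by
    have := h.periodic.sub_int_mul_eq ⌊x⌋ (x := x)
    rwa [mul_one] at this
  have := h.injOn ⟨Int.fract_nonneg s, Int.fract_lt_one s⟩ ⟨Int.fract_nonneg r, Int.fract_lt_one r⟩
    (by rw [hf, hf, e])
  exact Int.fract_eq_fract.1 this

lemma Function.Periodic.exists_mem_Icc_eq {β : Type*} {f : ℝ → β} (hf : Function.Periodic f 1)
    (s : ℝ) : ∃ n : ℤ, s - n ∈ Icc (0 : ℝ) 1 ∧ f (s - n) = f s :=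
  ⟨⌊s⌋, ⟨by linarith [Int.floor_le s], by linarith [Int.lt_floor_add_one s]⟩, by
    simpa using hf.sub_int_mul_eq ⌊s⌋ (x := s)⟩

/-- On a compact set of times, the chords of an evolving curve are comparable with its arcs, and
its tangents are Lipschitz, with constants independent of time. -/
lemma exists_chord_arc {K : Set ℝ} (hK : IsCompact K) {z : ℝ → ℝ → Plane} {A : ℝ → Set Plane}
    (h : ∀ t ∈ K, IsBoundaryCurve (z t) (A t))
    (h0 : ContinuousOn (fun p : ℝ × ℝ => z p.1 p.2) (K ×ˢ univ))
    (h1 : ContinuousOn (fun p : ℝ × ℝ => deriv (z p.1) p.2) (K ×ˢ univ))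
    (h2 : ContinuousOn (fun p : ℝ × ℝ => deriv (deriv (z p.1)) p.2) (K ×ˢ univ)) :
    ∃ c M : ℝ, 0 < c ∧ 0 ≤ M ∧ ∀ t ∈ K,
      (∀ s, ‖deriv (z t) s‖ ≤ M) ∧ (∀ s, ‖deriv (deriv (z t)) s‖ ≤ M) ∧
      (∀ s r, ‖deriv (z t) r - deriv (z t) s‖ ≤ M * |r - s|) ∧
      (∀ s r, ‖z t r - z t s - (r - s) • deriv (z t) s‖ ≤ M * |r - s| ^ 2) ∧
      ∀ s d, |d| ≤ 1 / 2 → c * |d| ≤ ‖z t (s + d) - z t s‖ := by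
  have hKI : IsCompact (K ×ˢ Icc (0 : ℝ) 1) := hK.prod isCompact_Icc
  have hsub : K ×ˢ Icc (0 : ℝ) 1 ⊆ K ×ˢ univ := prod_mono_right (subset_univ _)
  obtain ⟨M₁, hM₁⟩ := hKI.exists_bound_of_continuousOn (h1.mono hsub)
  obtain ⟨M₂, hM₂⟩ := hKI.exists_bound_of_continuousOn (h2.mono hsub)
  set M := max 0 (max M₁ M₂) with hM
  have hM0 : 0 ≤ M := le_max_left _ _
  obtain ⟨l, hl0, hl⟩ := hKI.exists_forall_le' (a := 0) (h1.mono hsub).norm (by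
    rintro ⟨t, s⟩ ⟨ht, -⟩
    obtain ⟨L, hL, hs⟩ := (h t ht).uniform_speed
    simpa [hs s] using hL)
  have b1 : ∀ t ∈ K, ∀ s, ‖deriv (z t) s‖ ≤ M := fun t ht s => by
    obtain ⟨n, hn, e⟩ := (h t ht).deriv_periodic.exists_mem_Icc_eq s
    rw [← e]
    exact (hM₁ (t, s - n) ⟨ht, hn⟩).trans ((le_max_left _ _).trans (le_max_right _ _))
  have b2 : ∀ t ∈ K, ∀ s, ‖deriv (deriv (z t)) s‖ ≤ M := fun t ht s => by
    obtain ⟨n, hn, e⟩ := (h t ht).deriv_deriv_periodic.exists_mem_Icc_eq s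
    rw [← e]
    exact (hM₂ (t, s - n) ⟨ht, hn⟩).trans ((le_max_right _ _).trans (le_max_right _ _))
  have bl : ∀ t ∈ K, ∀ s, l ≤ ‖deriv (z t) s‖ := fun t ht s => by
    obtain ⟨n, hn, e⟩ := (h t ht).deriv_periodic.exists_mem_Icc_eq s
    rw [← e]
    exact hl (t, s - n) ⟨ht, hn⟩
  have b3 : ∀ t ∈ K, ∀ s r, ‖deriv (z t) r - deriv (z t) s‖ ≤ M * |r - s| := fun t ht s r =>
    convex_univ.norm_image_sub_le_of_norm_hasDerivWithin_le
      (fun x _ => ((h t ht).hasDerivAt_deriv x).hasDerivWithinAt) (fun x _ => b2 t ht x)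
      (mem_univ s) (mem_univ r)
  have b4 : ∀ t ∈ K, ∀ s r, ‖z t r - z t s - (r - s) • deriv (z t) s‖ ≤ M * |r - s| ^ 2 := by
    intro t ht s r
    have := (convex_uIcc s r).norm_image_sub_le_of_norm_hasDerivWithin_le
      (f := fun x => z t x - (x - s) • deriv (z t) s) (C := M * |r - s|)
      (f' := fun x => deriv (z t) x - (1 : ℝ) • deriv (z t) s)
      (fun x _ => (((h t ht).hasDerivAt x).sub
        (((hasDerivAt_id x).sub_const s).smul_const _)).hasDerivWithinAt)
      (fun x hx => by
        rw [one_smul]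
        refine (b3 t ht s x).trans (mul_le_mul_of_nonneg_left ?_ hM0)
        exact abs_sub_left_of_mem_uIcc hx)
      left_mem_uIcc right_mem_uIcc
    simp only [sub_self, zero_smul, sub_zero, Real.norm_eq_abs] at this
    calc _ = ‖z t r - (r - s) • deriv (z t) s - z t s‖ := by congr 1; abel
      _ ≤ M * |r - s| * |r - s| := this
      _ = _ := by ring
  -- for `|d| ≤ d₀` the curve is close to its tangent; for larger `|d|` compactness applies
  set d₀ := l / (2 * (M + 1)) with hd₀
  have hd₀0 : 0 < d₀ := by positivity
  set D : Set ℝ := {d | d₀ ≤ |d| ∧ |d| ≤ 1 / 2} with hD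
  have hDc : IsCompact D := by
    refine (isCompact_Icc (a := (-(1 / 2) : ℝ)) (b := 1 / 2)).of_isClosed_subset ?_ ?_
    · exact (isClosed_le continuous_const continuous_abs).inter
        (isClosed_le continuous_abs continuous_const)
    · exact fun d hd => abs_le.1 hd.2
  obtain ⟨m, hm0, hm⟩ := (hKI.prod hDc).exists_forall_le' (a := 0)
    (f := fun q : (ℝ × ℝ) × ℝ => ‖z q.1.1 (q.1.2 + q.2) - z q.1.1 q.1.2‖)
    (by
      refine ContinuousOn.norm (ContinuousOn.sub ?_ ?_)
      · exact h0.comp (f := fun q : (ℝ × ℝ) × ℝ => (q.1.1, q.1.2 + q.2)) (by fun_prop)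
          fun q hq => ⟨hq.1.1, mem_univ _⟩
      · exact h0.comp (f := fun q : (ℝ × ℝ) × ℝ => q.1) (by fun_prop)
          fun q hq => ⟨hq.1.1, mem_univ _⟩)
    (by
      rintro ⟨⟨t, s⟩, d⟩ ⟨⟨ht, -⟩, hd1, hd2⟩
      refine norm_pos_iff.2 fun e => ?_
      obtain ⟨n, hn⟩ := (h t ht).exists_int_of_eq (sub_eq_zero.1 e)
      simp only [add_sub_cancel_left] at hn
      have hn0 : n = 0 := by
        rw [hn] at hd2
        rw [← Int.abs_lt_one_iff]
        have : |(n : ℝ)| < 1 := by linarith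
        exact_mod_cast this
      simp only [hn, hn0, Int.cast_zero, abs_zero] at hd1
      linarith)
  refine ⟨min (l / 2) m, M, by positivity, hM0, fun t ht => ⟨b1 t ht, b2 t ht, b3 t ht, b4 t ht,
    fun s d hd => ?_⟩⟩
  rcases le_total |d| d₀ with hd' | hd'
  · have h4 := b4 t ht s (s + d)
    rw [add_sub_cancel_left] at h4
    have h5 : ‖d • deriv (z t) s‖ - ‖z t (s + d) - z t s‖ ≤
        ‖z t (s + d) - z t s - d • deriv (z t) s‖ := by
      rw [← norm_neg (z t (s + d) - z t s - _), neg_sub]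
      exact norm_sub_norm_le _ _
    rw [norm_smul, Real.norm_eq_abs] at h5
    have h6 : M * |d| ≤ l / 2 := by
      calc M * |d| ≤ (M + 1) * d₀ := mul_le_mul (by linarith) hd' (abs_nonneg _) (by positivity)
        _ = l / 2 := by rw [hd₀]; field_simp
    have h7 := mul_le_mul_of_nonneg_left (bl t ht s) (abs_nonneg d)
    have h8 := mul_le_mul_of_nonneg_left h6 (abs_nonneg d)
    have h9 := mul_le_mul_of_nonneg_right (min_le_left (l / 2) m) (abs_nonneg d)
    nlinarith
  · obtain ⟨n, hn, -⟩ := (h t ht).periodic.exists_mem_Icc_eq s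
    have e1 : z t (s - n + d) = z t (s + d) := by
      have := (h t ht).periodic.sub_int_mul_eq n (x := s + d)
      rw [mul_one] at this
      rw [← this]; congr 1; ring
    have e2 : z t (s - n) = z t s := by
      have := (h t ht).periodic.sub_int_mul_eq n (x := s)
      rwa [mul_one] at this
    have := hm ((t, s - n), d) ⟨⟨ht, hn⟩, hd', hd⟩
    simp only [e1, e2] at this
    refine le_trans ?_ this
    have h9 := min_le_right (l / 2) m
    have : 0 < min (l / 2) m := by positivity
    nlinarith [abs_nonneg d]

lemma IsBoundaryCurve.exists_chord_arc (h : IsBoundaryCurve z A) :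
    ∃ c M : ℝ, 0 < c ∧ 0 ≤ M ∧
      (∀ s, ‖deriv z s‖ ≤ M) ∧ (∀ s, ‖deriv (deriv z) s‖ ≤ M) ∧
      (∀ s r, ‖deriv z r - deriv z s‖ ≤ M * |r - s|) ∧
      (∀ s r, ‖z r - z s - (r - s) • deriv z s‖ ≤ M * |r - s| ^ 2) ∧
      ∀ s d, |d| ≤ 1 / 2 → c * |d| ≤ ‖z (s + d) - z s‖ := by
  obtain ⟨c, M, hc, hM, H⟩ := _root_.exists_chord_arc (isCompact_singleton (x := (0 : ℝ)))
    (z := fun _ => z) (A := fun _ => A) (fun _ _ => h)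
    (h.contDiff.continuous.comp continuous_snd).continuousOn
    (h.contDiff_deriv.continuous.comp continuous_snd).continuousOn
    ((h.contDiff_deriv.continuous_deriv le_rfl).comp continuous_snd).continuousOn
  exact ⟨c, M, hc, hM, H 0 rfl⟩

/-! ### Tubular coordinates -/

/-- The tubular coordinates `(s, ρ) ↦ z(s) + ρ N(s)` of the curve, `N = (∂ₛz)^⊥`. -/
noncomputable def tubeMap (z : ℝ → Plane) (p : ℝ × ℝ) : Plane :=
  z p.1 + p.2 • perp (deriv z p.1)

/-- The derivative of `tubeMap` in `s`. -/
noncomputable def tubeTangent (z : ℝ → Plane) (p : ℝ × ℝ) : Plane :=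
  deriv z p.1 + p.2 • perp (deriv (deriv z) p.1)

lemma contDiff_tubeMap (h : IsBoundaryCurve z A) : ContDiff ℝ 1 (tubeMap z) := by
  unfold tubeMap
  exact ((h.contDiff.of_le one_le_two).comp contDiff_fst).add
    (contDiff_snd.smul (perpCLM.contDiff.comp (h.contDiff_deriv.comp contDiff_fst)))

lemma hasDerivAt_tubeMap_fst (h : IsBoundaryCurve z A) (s ρ : ℝ) :
    HasDerivAt (fun s => tubeMap z (s, ρ)) (tubeTangent z (s, ρ)) s :=
  (h.hasDerivAt s).add ((perpCLM.hasFDerivAt.comp_hasDerivAt s (h.hasDerivAt_deriv s)).const_smul ρ)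

lemma hasDerivAt_tubeMap_snd (s ρ : ℝ) :
    HasDerivAt (fun ρ => tubeMap z (s, ρ)) (perp (deriv z s)) ρ := by
  have := ((hasDerivAt_id ρ).smul_const (perp (deriv z s))).const_add (z s)
  rwa [one_smul] at this

lemma fderiv_tubeMap (h : IsBoundaryCurve z A) (p : ℝ × ℝ) (v : ℝ × ℝ) :
    fderiv ℝ (tubeMap z) p v = v.1 • tubeTangent z p + v.2 • perp (deriv z p.1) := by
  have hd := ((contDiff_tubeMap h).differentiable one_ne_zero p).hasFDerivAt
  have e1 : fderiv ℝ (tubeMap z) p (1, 0) = tubeTangent z p :=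
    (HasFDerivAt.comp_hasDerivAt (f := fun s => (s, p.2)) p.1 hd
      ((hasDerivAt_id p.1).prodMk (hasDerivAt_const p.1 p.2))).unique
      (hasDerivAt_tubeMap_fst h p.1 p.2)
  have e2 : fderiv ℝ (tubeMap z) p (0, 1) = perp (deriv z p.1) :=
    (HasFDerivAt.comp_hasDerivAt (f := fun ρ => (p.1, ρ)) p.2 hd
      ((hasDerivAt_const p.2 p.1).prodMk (hasDerivAt_id p.2))).unique
      (hasDerivAt_tubeMap_snd p.1 p.2)
  have : v = v.1 • ((1 : ℝ), (0 : ℝ)) + v.2 • ((0 : ℝ), (1 : ℝ)) := by ext <;> simp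
  conv_lhs => rw [this]
  rw [map_add, map_smul, map_smul, e1, e2]

/-- The Jacobian determinant of `tubeMap`. -/
noncomputable def tubeJacobian (z : ℝ → Plane) (p : ℝ × ℝ) : ℝ :=
  inner ℝ (perp (tubeTangent z p)) (perp (deriv z p.1))

/-- The tubular coordinates are regular and, up to the period, injective for `|ρ| ≤ ρ₀`. -/
structure IsTubeRadius (z : ℝ → Plane) (ρ₀ : ℝ) : Prop where
  pos : 0 < ρ₀
  jacobian_pos : ∀ s ρ, |ρ| ≤ ρ₀ → 0 < tubeJacobian z (s, ρ)
  injective : ∀ s r ρ σ, |ρ| ≤ ρ₀ → |σ| ≤ ρ₀ → tubeMap z (s, ρ) = tubeMap z (r, σ) →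
    (∃ n : ℤ, s - r = n) ∧ ρ = σ

lemma tubeMap_sub_int (h : IsBoundaryCurve z A) (s ρ : ℝ) (n : ℤ) :
    tubeMap z (s - n, ρ) = tubeMap z (s, ρ) := by
  have e1 := h.periodic.sub_int_mul_eq n (x := s)
  have e2 := h.deriv_periodic.sub_int_mul_eq n (x := s)
  rw [mul_one] at e1 e2
  simp only [tubeMap, e1, e2]

/-- Two points of the tube which coincide have parameters at distance `|d| ≤ 2 ρ₀ L / c` by the
chord-arc inequality. If `d ≠ 0`, the chord is almost tangent to the curve, whereas it equals a
combination of two almost parallel normals, which is impossible for small `ρ₀`. -/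
lemma exists_isTubeRadius (h : IsBoundaryCurve z A) : ∃ ρ₀, IsTubeRadius z ρ₀ := by
  obtain ⟨c, M, hc, hM, -, b2, b3, b4, b5⟩ := h.exists_chord_arc
  obtain ⟨L, hL, hs⟩ := h.uniform_speed
  set ρ₀ := L / (2 * (M + 1) * (2 * L / c + 1)) with hρ₀
  have hρ0 : 0 < ρ₀ := by positivity
  have key : (M + 1) * (ρ₀ * (2 * L / c + 1)) = L / 2 := by rw [hρ₀]; field_simp
  have hq : 0 < 2 * L / c := by positivity
  refine ⟨ρ₀, hρ0, fun s ρ hρ => ?_, fun s r ρ σ hρ hσ e => ?_⟩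
  · have e : tubeJacobian z (s, ρ) =
        L ^ 2 + ρ * inner ℝ (perp (deriv (deriv z) s)) (deriv z s) := by
      rw [tubeJacobian, inner_perp_perp, tubeTangent, inner_add_left, inner_smul_left, ← hs s,
        real_inner_self_eq_norm_sq]
      simp
    have hb : |ρ * inner ℝ (perp (deriv (deriv z) s)) (deriv z s)| ≤ ρ₀ * (M * L) := by
      rw [abs_mul]
      refine mul_le_mul hρ ?_ (abs_nonneg _) hρ0.le
      refine (abs_real_inner_le_norm _ _).trans ?_
      rw [norm_perp, hs]
      exact mul_le_mul_of_nonneg_right (b2 s) hL.le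
    have h1 : ρ₀ * M ≤ L / 2 := by nlinarith [mul_pos hρ0 hq]
    have := (abs_le.1 hb).1
    rw [e]
    nlinarith
  -- shift `r` by a period so that it is within `1 / 2` of `s`
  · set n : ℤ := round (r - s) with hn
    set d : ℝ := r - n - s with hd
    have hd2 : |d| ≤ 1 / 2 := by
      have := abs_sub_round (r - s)
      rwa [hd, show r - n - s = r - s - n by ring]
    rw [← tubeMap_sub_int h r σ n, show r - n = s + d by rw [hd]; ring] at e
    simp only [tubeMap] at e
    have e' : z (s + d) - z s = ρ • perp (deriv z s) - σ • perp (deriv z (s + d)) := by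
      rw [sub_eq_sub_iff_add_eq_add, add_comm _ (z s), e]
    have hchord : c * |d| ≤ 2 * ρ₀ * L := by
      refine (b5 s d hd2).trans ?_
      rw [e']
      refine (norm_sub_le _ _).trans ?_
      rw [norm_smul, norm_smul, norm_perp, norm_perp, hs, hs, Real.norm_eq_abs, Real.norm_eq_abs]
      nlinarith
    -- two expressions for the component of the chord along `∂ₛz`: by the normals, by Taylor
    have hd0 : d = 0 := by
      by_contra hne
      have hdp : 0 < |d| := abs_pos.2 hne
      have i1 : inner ℝ (z (s + d) - z s) (deriv z s) =
          -σ * inner ℝ (perp (deriv z (s + d) - deriv z s)) (deriv z s) := by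
        rw [e', perp_sub]
        simp only [inner_sub_left, inner_smul_left, real_inner_comm, inner_self_perp]
        simp
      have i2 : |inner ℝ (z (s + d) - z s) (deriv z s)| ≤ ρ₀ * (M * |d| * L) := by
        rw [i1, abs_mul, abs_neg]
        refine mul_le_mul hσ ?_ (abs_nonneg _) hρ0.le
        refine (abs_real_inner_le_norm _ _).trans ?_
        rw [norm_perp, hs]
        have := b3 s (s + d)
        rw [add_sub_cancel_left] at this
        exact mul_le_mul_of_nonneg_right this hL.le
      have i3 : inner ℝ (z (s + d) - z s) (deriv z s) =
          inner ℝ (z (s + d) - z s - d • deriv z s) (deriv z s) + d * L ^ 2 := by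
        rw [inner_sub_left (z (s + d) - z s), inner_smul_left, real_inner_self_eq_norm_sq, hs]
        simp
      have i4 : |inner ℝ (z (s + d) - z s - d • deriv z s) (deriv z s)| ≤ M * |d| ^ 2 * L := by
        refine (abs_real_inner_le_norm _ _).trans ?_
        rw [hs]
        have := b4 s (s + d)
        rw [add_sub_cancel_left] at this
        exact mul_le_mul_of_nonneg_right this hL.le
      have i5 : |d| * L ^ 2 ≤ ρ₀ * (M * |d| * L) + M * |d| ^ 2 * L := by
        have : |d * L ^ 2| ≤ ρ₀ * (M * |d| * L) + M * |d| ^ 2 * L := by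
          rw [show d * L ^ 2 = inner ℝ (z (s + d) - z s) (deriv z s) -
            inner ℝ (z (s + d) - z s - d • deriv z s) (deriv z s) by rw [i3]; ring]
          exact (abs_sub _ _).trans (add_le_add i2 i4)
        rwa [abs_mul, abs_of_pos (by positivity : (0 : ℝ) < L ^ 2)] at this
      have i6 : L ≤ ρ₀ * M + M * |d| := by
        have : (|d| * L) * L ≤ (|d| * L) * (ρ₀ * M + M * |d|) := by linarith
        exact le_of_mul_le_mul_left this (by positivity)
      have i7 : |d| ≤ ρ₀ * (2 * L / c) := by
        rw [show ρ₀ * (2 * L / c) = 2 * ρ₀ * L / c by ring, le_div_iff₀ hc]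
        linarith
      have i8 := mul_le_mul_of_nonneg_left i7 hM
      nlinarith [mul_pos hρ0 hq]
    refine ⟨⟨-n, by push_cast; linarith⟩, ?_⟩
    rw [hd0, add_zero] at e'
    rw [sub_self, eq_comm, ← sub_smul, smul_eq_zero] at e'
    rcases e' with e' | e'
    · linarith
    · have := hs s
      rw [← norm_perp, e', norm_zero] at this
      exact absurd this hL.ne

end curve

/-! ### The two sides of the curve -/

section sides

variable {z : ℝ → Plane} {A : Set Plane}

/-- A connected set which does not meet the frontier of `A` lies on one side of it. -/
lemma IsPreconnected.subset_of_disjoint_frontier {X : Type*} [TopologicalSpace X] {S A : Set X}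
    (hS : IsPreconnected S) (hd : Disjoint S (frontier A)) (hne : (S ∩ A).Nonempty) : S ⊆ A := by
  have hcl : ∀ x ∈ S, x ∈ closure A → x ∈ interior A := fun x hx hxc => by
    by_contra hi
    exact disjoint_left.1 hd hx ⟨hxc, hi⟩
  have := hS.subset_of_closure_inter_subset (u := interior A) isOpen_interior
    (by obtain ⟨x, hx, hxA⟩ := hne; exact ⟨x, hx, hcl x hx (subset_closure hxA)⟩)
    (fun x hx => hcl x hx.2 (closure_mono interior_subset hx.1))
  exact this.trans interior_subset

variable {ρ₀ : ℝ}

lemma disjoint_tube_frontier (h : IsBoundaryCurve z A) (hρ : IsTubeRadius z ρ₀) {I : Set ℝ}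
    (hI : ∀ ρ ∈ I, |ρ| ≤ ρ₀ ∧ ρ ≠ 0) :
    Disjoint (tubeMap z '' univ ×ˢ I) (frontier A) := by
  rw [h.frontier_eq, disjoint_left]
  rintro _ ⟨⟨s, ρ⟩, ⟨-, hρI⟩, rfl⟩ ⟨r, hr⟩
  have e : tubeMap z (s, ρ) = tubeMap z (r, 0) := by rw [← hr]; simp [tubeMap]
  exact (hI ρ hρI).2 (hρ.injective s r ρ 0 (hI ρ hρI).1 (by simpa using hρ.pos.le) e).2

lemma isPreconnected_tube (h : IsBoundaryCurve z A) {I : Set ℝ} (hI : IsPreconnected I) :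
    IsPreconnected (tubeMap z '' univ ×ˢ I) :=
  (isPreconnected_univ.prod hI).image _ (contDiff_tubeMap h).continuous.continuousOn

/-- The inner half of the tube lies in the region. -/
lemma tube_left_subset (h : IsBoundaryCurve z A) (hρ : IsTubeRadius z ρ₀) :
    tubeMap z '' univ ×ˢ Ioo 0 ρ₀ ⊆ A := by
  refine (isPreconnected_tube h isPreconnected_Ioo).subset_of_disjoint_frontier
    (disjoint_tube_frontier h hρ fun ρ hr => ⟨by rw [abs_of_pos hr.1]; exact hr.2.le, hr.1.ne'⟩) ?_
  obtain ⟨ε, hA, hε⟩ := ((h.counterclockwise 0).and (Ioo_mem_nhdsGT hρ.pos)).exists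
  exact ⟨_, ⟨(0, ε), ⟨mem_univ _, hε⟩, rfl⟩, hA⟩

lemma map_nhds_tubeMap (h : IsBoundaryCurve z A) (hρ : IsTubeRadius z ρ₀) (p : ℝ × ℝ)
    (hp : |p.2| ≤ ρ₀) : map (tubeMap z) (𝓝 p) = 𝓝 (tubeMap z p) := by
  refine HasStrictFDerivAt.map_nhds_eq_of_surj
    ((contDiff_tubeMap h).contDiffAt.hasStrictFDerivAt one_ne_zero) ?_
  rw [LinearMap.range_eq_top]
  intro w
  have hJ := (hρ.jacobian_pos p.1 p.2 hp).ne'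
  refine ⟨(inner ℝ (perp w) (perp (deriv z p.1)) / tubeJacobian z p,
    inner ℝ (perp (tubeTangent z p)) w / tubeJacobian z p), ?_⟩
  simp only [ContinuousLinearMap.coe_coe, fderiv_tubeMap h]
  have key : inner ℝ (perp w) (perp (deriv z p.1)) • tubeTangent z p +
      inner ℝ (perp (tubeTangent z p)) w • perp (deriv z p.1) = tubeJacobian z p • w := by
    ext i
    simp only [tubeJacobian, inner_plane, perp_apply_zero, perp_apply_one]
    fin_cases i <;> simp <;> ring
  rw [div_eq_inv_mul, div_eq_inv_mul, mul_smul, mul_smul, ← smul_add, key, smul_smul,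
    inv_mul_cancel₀ hJ, one_smul]

lemma isOpen_tube (h : IsBoundaryCurve z A) (hρ : IsTubeRadius z ρ₀) :
    IsOpen (tubeMap z '' univ ×ˢ Ioo (-ρ₀) ρ₀) := by
  rw [isOpen_iff_mem_nhds]
  rintro _ ⟨p, hp, rfl⟩
  rw [← map_nhds_tubeMap h hρ p (abs_le.2 ⟨hp.2.1.le, hp.2.2.le⟩)]
  exact image_mem_map ((isOpen_univ.prod isOpen_Ioo).mem_nhds hp)

lemma range_subset_tube (hρ : IsTubeRadius z ρ₀) :
    range z ⊆ tubeMap z '' univ ×ˢ Ioo (-ρ₀) ρ₀ := by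
  rintro _ ⟨s, rfl⟩
  exact ⟨(s, 0), ⟨mem_univ _, by simpa using hρ.pos⟩, by simp [tubeMap]⟩

/-- The outer half of the tube is disjoint from the region: otherwise the region together with its
boundary curve would be open and closed, hence the whole plane. -/
lemma disjoint_tube_right (h : IsBoundaryCurve z A) (hρ : IsTubeRadius z ρ₀) :
    Disjoint (tubeMap z '' univ ×ˢ Ioo (-ρ₀) 0) A := by
  rw [disjoint_iff_inter_eq_empty, ← not_nonempty_iff_eq_empty]
  intro hne
  have hR : tubeMap z '' univ ×ˢ Ioo (-ρ₀) 0 ⊆ A :=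
    (isPreconnected_tube h isPreconnected_Ioo).subset_of_disjoint_frontier
      (disjoint_tube_frontier h hρ fun ρ hr =>
        ⟨by rw [abs_of_neg hr.2]; linarith [hr.1], hr.2.ne⟩) hne
  have hL := tube_left_subset h hρ
  have hfr : range z ⊆ closure A := h.frontier_eq ▸ frontier_subset_closure
  have hT : tubeMap z '' univ ×ˢ Ioo (-ρ₀) ρ₀ ⊆ closure A := by
    rintro _ ⟨⟨s, ρ⟩, ⟨-, h1, h2⟩, rfl⟩
    rcases lt_trichotomy ρ 0 with h0 | h0 | h0
    · exact subset_closure (hR ⟨(s, ρ), ⟨mem_univ _, h1, h0⟩, rfl⟩)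
    · exact hfr ⟨s, by simp [tubeMap, h0]⟩
    · exact subset_closure (hL ⟨(s, ρ), ⟨mem_univ _, h0, h2⟩, rfl⟩)
  have hcl : closure A = A ∪ range z := by
    rw [← h.frontier_eq, ← h.isOpen.interior_eq, closure_eq_interior_union_frontier]
    simp [h.isOpen.interior_eq]
  have hop : IsOpen (closure A) := by
    have : closure A = A ∪ tubeMap z '' univ ×ˢ Ioo (-ρ₀) ρ₀ := by
      refine Subset.antisymm ?_ (union_subset subset_closure hT)
      rw [hcl]
      exact union_subset_union_right _ (range_subset_tube hρ)
    rw [this]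
    exact h.isOpen.union (isOpen_tube h hρ)
  have huniv : closure A = univ :=
    IsClopen.eq_univ ⟨isClosed_closure, hop⟩ ((hne.mono inter_subset_right).closure)
  exact NormedSpace.unbounded_univ ℝ Plane (huniv ▸ h.isBounded.closure)

/-- One period of the inner half of the tube. -/
def innerTube (z : ℝ → Plane) (ρ₀ : ℝ) : Set Plane := tubeMap z '' Ioc 0 1 ×ˢ Ioo 0 ρ₀

lemma innerTube_subset (h : IsBoundaryCurve z A) (hρ : IsTubeRadius z ρ₀) :
    innerTube z ρ₀ ⊆ A :=
  (image_mono (prod_mono_left (subset_univ _))).trans (tube_left_subset h hρ)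

lemma mem_innerTube_of_mem (h : IsBoundaryCurve z A) (hρ : IsTubeRadius z ρ₀) {x : Plane}
    (hx : x ∈ A) (hxT : x ∈ tubeMap z '' univ ×ˢ Ioo (-ρ₀) ρ₀) : x ∈ innerTube z ρ₀ := by
  obtain ⟨⟨s, ρ⟩, ⟨-, h1, h2⟩, rfl⟩ := hxT
  rcases lt_trichotomy ρ 0 with h0 | h0 | h0
  · exact absurd hx (disjoint_left.1 (disjoint_tube_right h hρ) ⟨(s, ρ), ⟨mem_univ _, h1, h0⟩, rfl⟩)
  · have : tubeMap z (s, ρ) ∈ frontier A := by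
      rw [h.frontier_eq]; exact ⟨s, by simp [tubeMap, h0]⟩
    rw [h.isOpen.frontier_eq] at this
    exact absurd hx this.2
  · refine ⟨(s - (⌈s⌉ - 1 : ℤ), ρ), ⟨⟨?_, ?_⟩, h0, h2⟩, tubeMap_sub_int h s ρ _⟩
    · push_cast; linarith [Int.ceil_lt_add_one s]
    · push_cast; linarith [Int.le_ceil s]

lemma injOn_tubeMap (hρ : IsTubeRadius z ρ₀) : InjOn (tubeMap z) (Ioc 0 1 ×ˢ Ioo 0 ρ₀) := by
  rintro ⟨s, ρ⟩ ⟨hs, hr⟩ ⟨r, σ⟩ ⟨hr', hσ⟩ e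
  obtain ⟨⟨n, hn⟩, e2⟩ := hρ.injective s r ρ σ (abs_le.2 ⟨by linarith [hr.1, hr.2], hr.2.le⟩)
    (abs_le.2 ⟨by linarith [hσ.1, hσ.2], hσ.2.le⟩) e
  have hn0 : n = 0 := by
    rw [← Int.abs_lt_one_iff]
    have : |(n : ℝ)| < 1 := by
      rw [← hn, abs_lt]
      constructor <;> linarith [hs.1, hs.2, hr'.1, hr'.2]
    exact_mod_cast this
  rw [hn0, Int.cast_zero, sub_eq_zero] at hn
  exact Prod.ext hn e2

end sides

/-! ### Green's formula -/

/-- The coordinates of the plane, as a measurable equivalence. -/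
noncomputable def planeCoord : Plane ≃ᵐ ℝ × ℝ :=
  (MeasurableEquiv.toLp 2 (Fin 2 → ℝ)).symm.trans MeasurableEquiv.finTwoArrow

lemma measurePreserving_planeCoord : MeasurePreserving planeCoord :=
  (volume_preserving_finTwoArrow ℝ).comp
    (EuclideanSpace.volume_preserving_symm_measurableEquiv_toLp (Fin 2))

/-- Change of variables for a map from `ℝ × ℝ` to the plane. -/
lemma setIntegral_image_plane {X : ℝ × ℝ → Plane} {X' : ℝ × ℝ → ℝ × ℝ →L[ℝ] Plane}
    {S : Set (ℝ × ℝ)} (hS : MeasurableSet S) (hX : ∀ p ∈ S, HasFDerivAt X (X' p) p)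
    (hinj : InjOn X S) (g : Plane → ℝ) :
    ∫ x in X '' S, g x = ∫ p in S, |inner ℝ (perp (X' p (1, 0))) (X' p (0, 1))| * g (X p) := by
  set L : Plane →L[ℝ] ℝ × ℝ :=
    (EuclideanSpace.proj (0 : Fin 2)).prod (EuclideanSpace.proj (1 : Fin 2)) with hL
  have hLe : (planeCoord : Plane → ℝ × ℝ) = L := rfl
  have hLs : ∀ x, planeCoord.symm (L x) = x := fun x => planeCoord.symm_apply_apply x
  have hinj' : InjOn (L ∘ X) S := planeCoord.injective.injOn.comp hinj (mapsTo_univ _ _)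
  have h1 := measurePreserving_planeCoord.setIntegral_preimage_emb
    planeCoord.measurableEmbedding (fun q => g (planeCoord.symm q)) (planeCoord '' (X '' S))
  rw [preimage_image_eq _ planeCoord.injective] at h1
  simp only [MeasurableEquiv.symm_apply_apply] at h1
  rw [h1, ← image_comp, hLe, integral_image_eq_integral_abs_det_fderiv_smul volume hS
    (f' := fun p => L.comp (X' p))
    (fun p hp => ((L.hasFDerivAt (x := X p)).comp p (hX p hp)).hasFDerivWithinAt) hinj']
  refine setIntegral_congr_fun hS fun p _ => ?_
  simp only [Function.comp_apply, hLs, smul_eq_mul]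
  congr 2
  have : L.comp (X' p) = (Matrix.toLin (Module.Basis.finTwoProd ℝ) (Module.Basis.finTwoProd ℝ)
      !![X' p (1, 0) 0, X' p (0, 1) 0; X' p (1, 0) 1, X' p (0, 1) 1]).toContinuousLinearMap := by
    rw [Matrix.toLin_finTwoProd_toContinuousLinearMap]
    refine ContinuousLinearMap.ext fun v => ?_
    have hv : v = v.1 • ((1 : ℝ), (0 : ℝ)) + v.2 • ((0 : ℝ), (1 : ℝ)) := by ext <;> simp
    conv_lhs => rw [hv, map_add, map_smul, map_smul]
    ext <;> simp [hL] <;> ring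
  rw [this, LinearMap.det_toContinuousLinearMap, LinearMap.det_toLin, Matrix.det_fin_two_of,
    inner_plane]
  simp
  ring

section green

variable {z : ℝ → Plane} {A : Set Plane} {ρ₀ : ℝ} {G : Plane → ℝ}

/-- Green's formula for a function supported in the tube. In tubular coordinates
`DG(X) e · det DX = ∂ₛ (g e ∧ N) + ∂_ρ (g ∂ₛX ∧ e)` with `g = G ∘ X`, and only the second term has a
boundary contribution. -/
lemma green_of_support_tube (h : IsBoundaryCurve z A) (hρ : IsTubeRadius z ρ₀)
    (hG : ContDiff ℝ 1 G)
    (h0 : ∀ x ∉ tubeMap z '' univ ×ˢ Ioo (-ρ₀) ρ₀, G x = 0)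
    (h0' : ∀ x ∉ tubeMap z '' univ ×ˢ Ioo (-ρ₀) ρ₀, fderiv ℝ G x = 0) (e : Plane) :
    ∫ x in A, fderiv ℝ G x e = -∫ s in (0 : ℝ)..1, G (z s) * inner ℝ (perp (deriv z s)) e := by
  have hXd := contDiff_tubeMap h
  have hXc := hXd.continuous
  have hz1 := h.contDiff_deriv.continuous
  have hz2 := h.contDiff_deriv.continuous_deriv le_rfl
  have hGd : Continuous (fderiv ℝ G) := hG.continuous_fderiv one_ne_zero
  have hGX : Continuous fun p : ℝ × ℝ => G (tubeMap z p) := hG.continuous.comp hXc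
  have hDX : Continuous fun p : ℝ × ℝ => fderiv ℝ G (tubeMap z p) := hGd.comp hXc
  have hNc : Continuous fun p : ℝ × ℝ => perp (deriv z p.1) :=
    continuous_perp.comp (hz1.comp continuous_fst)
  have hN'c : Continuous fun p : ℝ × ℝ => perp (deriv (deriv z) p.1) :=
    continuous_perp.comp (hz2.comp continuous_fst)
  have hTc : Continuous (tubeTangent z) := by
    unfold tubeTangent
    exact (hz1.comp continuous_fst).add (continuous_snd.smul hN'c)
  have hpTc : Continuous fun p => perp (tubeTangent z p) := continuous_perp.comp hTc
  -- the two terms `∂ₛ (g e ∧ N)` and `∂_ρ (g ∂ₛX ∧ e)`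
  set P : ℝ → ℝ → ℝ := fun s ρ =>
    fderiv ℝ G (tubeMap z (s, ρ)) (tubeTangent z (s, ρ)) * inner ℝ (perp e) (perp (deriv z s)) +
      G (tubeMap z (s, ρ)) * inner ℝ (perp e) (perp (deriv (deriv z) s)) with hP
  set Q : ℝ → ℝ → ℝ := fun s ρ =>
    fderiv ℝ G (tubeMap z (s, ρ)) (perp (deriv z s)) * inner ℝ (perp (tubeTangent z (s, ρ))) e +
      G (tubeMap z (s, ρ)) * inner ℝ (perp (perp (deriv (deriv z) s))) e with hQ
  have hPc : Continuous (Function.uncurry P) :=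
    ((hDX.clm_apply hTc).mul (continuous_const.inner hNc)).add
      (hGX.mul (continuous_const.inner hN'c))
  have hQc : Continuous (Function.uncurry Q) :=
    ((hDX.clm_apply hNc).mul (hpTc.inner continuous_const)).add
      (hGX.mul ((continuous_perp.comp hN'c).inner continuous_const))
  have hPd : ∀ s ρ, HasDerivAt
      (fun s => G (tubeMap z (s, ρ)) * inner ℝ (perp e) (perp (deriv z s))) (P s ρ) s := by
    intro s ρ
    have d1 := ((hG.differentiable one_ne_zero (tubeMap z (s, ρ))).hasFDerivAt).comp_hasDerivAt s
      (hasDerivAt_tubeMap_fst h s ρ)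
    have d2 := ((innerSL ℝ (perp e)).comp perpCLM).hasFDerivAt.comp_hasDerivAt s
      (h.hasDerivAt_deriv s)
    exact d1.mul d2
  have hQd : ∀ s ρ, HasDerivAt
      (fun ρ => G (tubeMap z (s, ρ)) * inner ℝ (perp (tubeTangent z (s, ρ))) e) (Q s ρ) ρ := by
    intro s ρ
    have d1 := ((hG.differentiable one_ne_zero (tubeMap z (s, ρ))).hasFDerivAt).comp_hasDerivAt ρ
      (hasDerivAt_tubeMap_snd s ρ)
    have d2 : HasDerivAt (fun ρ => tubeTangent z (s, ρ)) (perp (deriv (deriv z) s)) ρ := by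
      have := ((hasDerivAt_id ρ).smul_const (perp (deriv (deriv z) s))).const_add (deriv z s)
      rwa [one_smul] at this
    have d3 := ((innerSL ℝ e).comp perpCLM).hasFDerivAt.comp_hasDerivAt ρ d2
    have d4 := d1.mul d3
    simp only [Function.comp_def, ContinuousLinearMap.comp_apply, perpCLM_apply,
      innerSL_apply_apply, Pi.mul_def] at d4
    simpa only [hQ, real_inner_comm] using d4
  have hsum : ∀ s ρ, tubeJacobian z (s, ρ) * fderiv ℝ G (tubeMap z (s, ρ)) e = P s ρ + Q s ρ := by
    intro s ρ
    have e1 : tubeJacobian z (s, ρ) • e = inner ℝ (perp e) (perp (deriv z s)) • tubeTangent z (s, ρ)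
        + inner ℝ (perp (tubeTangent z (s, ρ))) e • perp (deriv z s) := by
      ext i
      simp only [tubeJacobian, inner_plane, perp_apply_zero, perp_apply_one]
      fin_cases i <;> simp <;> ring
    have e2 := congrArg (fderiv ℝ G (tubeMap z (s, ρ))) e1
    simp only [map_add, map_smul, smul_eq_mul] at e2
    rw [e2]
    simp only [hP, hQ, inner_plane, perp_apply_zero, perp_apply_one]
    ring
  have hfst : ∫ x in A, fderiv ℝ G x e = ∫ x in innerTube z ρ₀, fderiv ℝ G x e := by
    refine setIntegral_eq_of_subset_of_forall_sdiff_eq_zero h.isOpen.measurableSet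
      (innerTube_subset h hρ) fun x hx => ?_
    rw [h0' x fun hxT => hx.2 (mem_innerTube_of_mem h hρ hx.1 hxT)]
    rfl
  have hS : MeasurableSet (Ioc (0 : ℝ) 1 ×ˢ Ioo 0 ρ₀) := measurableSet_Ioc.prod measurableSet_Ioo
  rw [hfst, innerTube, setIntegral_image_plane hS
    (fun p _ => (hXd.differentiable one_ne_zero p).hasFDerivAt) (injOn_tubeMap hρ)]
  have e3 : ∫ p in Ioc (0 : ℝ) 1 ×ˢ Ioo 0 ρ₀,
      |inner ℝ (perp (fderiv ℝ (tubeMap z) p (1, 0))) (fderiv ℝ (tubeMap z) p (0, 1))| *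
        fderiv ℝ G (tubeMap z p) e =
      ∫ p in Ioc (0 : ℝ) 1 ×ˢ Ioo 0 ρ₀, (P p.1 p.2 + Q p.1 p.2) := by
    refine setIntegral_congr_fun hS ?_
    rintro ⟨s, ρ⟩ ⟨-, hr⟩
    simp only [fderiv_tubeMap h, one_smul, zero_smul, add_zero, zero_add]
    rw [← hsum, ← tubeJacobian, abs_of_pos (hρ.jacobian_pos s ρ (abs_le.2
      ⟨by linarith [hr.1, hr.2], hr.2.le⟩))]
  have hbox : Ioc (0 : ℝ) 1 ×ˢ Ioo 0 ρ₀ ⊆ Icc (0 : ℝ) 1 ×ˢ Icc 0 ρ₀ :=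
    prod_mono Ioc_subset_Icc_self Ioo_subset_Icc_self
  have hcomp : IsCompact (Icc (0 : ℝ) 1 ×ˢ Icc 0 ρ₀) := isCompact_Icc.prod isCompact_Icc
  have iP : IntegrableOn (fun p : ℝ × ℝ => P p.1 p.2) (Ioc (0 : ℝ) 1 ×ˢ Ioo 0 ρ₀) :=
    (hPc.continuousOn.integrableOn_compact hcomp).mono_set hbox
  have iQ : IntegrableOn (fun p : ℝ × ℝ => Q p.1 p.2) (Ioc (0 : ℝ) 1 ×ˢ Ioo 0 ρ₀) :=
    (hQc.continuousOn.integrableOn_compact hcomp).mono_set hbox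
  have vP : ∫ p in Ioc (0 : ℝ) 1 ×ˢ Ioo 0 ρ₀, P p.1 p.2 = 0 := by
    rw [IntegrableOn, Measure.volume_eq_prod, ← Measure.prod_restrict] at iP
    rw [Measure.volume_eq_prod, ← Measure.prod_restrict, integral_prod_symm _ iP]
    refine integral_eq_zero_of_ae (.of_forall fun ρ => ?_)
    simp only [Pi.zero_apply]
    rw [← intervalIntegral.integral_of_le zero_le_one,
      intervalIntegral.integral_eq_sub_of_hasDerivAt (fun s _ => hPd s ρ)
        ((hPc.comp (Continuous.prodMk_left ρ)).intervalIntegrable _ _)]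
    have p1 := h.periodic 0
    have p2 := h.deriv_periodic 0
    rw [zero_add] at p1 p2
    simp only [tubeMap, p1, p2, sub_self]
  have vQ : ∫ p in Ioc (0 : ℝ) 1 ×ˢ Ioo 0 ρ₀, Q p.1 p.2 =
      -∫ s in (0 : ℝ)..1, G (z s) * inner ℝ (perp (deriv z s)) e := by
    rw [IntegrableOn, Measure.volume_eq_prod, ← Measure.prod_restrict] at iQ
    rw [Measure.volume_eq_prod, ← Measure.prod_restrict, integral_prod _ iQ,
      intervalIntegral.integral_of_le zero_le_one, ← integral_neg]
    congr 1
    ext s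
    rw [← integral_Ioc_eq_integral_Ioo, ← intervalIntegral.integral_of_le hρ.pos.le,
      intervalIntegral.integral_eq_sub_of_hasDerivAt (fun ρ _ => hQd s ρ)
        ((hQc.comp (Continuous.prodMk_right s)).intervalIntegrable _ _)]
    have hend : G (tubeMap z (s, ρ₀)) = 0 := by
      refine h0 _ ?_
      rintro ⟨⟨r, σ⟩, ⟨-, hσ⟩, eq⟩
      have := (hρ.injective r s σ ρ₀ (abs_le.2 ⟨hσ.1.le, hσ.2.le⟩)
        (abs_of_pos hρ.pos).le eq).2
      exact hσ.2.ne this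
    rw [hend]
    simp [tubeMap, tubeTangent]
  rw [e3, integral_add iP iQ, vP, vQ, zero_add]

/-- A function which vanishes near the boundary curve contributes nothing to Green's formula. -/
lemma setIntegral_fderiv_eq_zero (h : IsBoundaryCurve z A) (hG : ContDiff ℝ 1 G)
    (h0 : ∀ x ∈ range z, ∀ᶠ y in 𝓝 x, G y = 0) (e : Plane) :
    ∫ x in A, fderiv ℝ G x e = 0 := by
  have hd : ∀ x, HasFDerivAt (A.indicator G) (A.indicator (fderiv ℝ G) x) x := by
    intro x
    by_cases hx : x ∈ A
    · rw [indicator_of_mem hx]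
      refine ((hG.differentiable one_ne_zero x).hasFDerivAt).congr_of_eventuallyEq ?_
      filter_upwards [h.isOpen.mem_nhds hx] with y hy using indicator_of_mem hy G
    · rw [indicator_of_notMem hx]
      refine (hasFDerivAt_const (0 : ℝ) x).congr_of_eventuallyEq ?_
      by_cases hxc : x ∈ closure A
      · have : x ∈ range z := by
          rw [← h.frontier_eq, h.isOpen.frontier_eq]; exact ⟨hxc, hx⟩
        filter_upwards [h0 x this] with y hy
        simp [hy]
      · filter_upwards [isClosed_closure.isOpen_compl.mem_nhds hxc] with y hy
        exact indicator_of_notMem (fun hyA => hy (subset_closure hyA)) G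
  have hcA : IsCompact (closure A) := h.isBounded.isCompact_closure
  have i1 : IntegrableOn (fun x => fderiv ℝ G x e) A :=
    (((hG.continuous_fderiv one_ne_zero).clm_apply
      continuous_const).continuousOn.integrableOn_compact hcA).mono_set subset_closure
  have i2 : IntegrableOn G A := (hG.continuous.continuousOn.integrableOn_compact
      hcA).mono_set subset_closure
  have hfe : ∀ x, fderiv ℝ (A.indicator G) x e = A.indicator (fun x => fderiv ℝ G x e) x := by
    intro x
    rw [(hd x).fderiv]
    by_cases hx : x ∈ A <;> simp [hx]
  have := integral_mul_fderiv_eq_neg_fderiv_mul_of_integrable (μ := (volume : Measure Plane))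
    (f := fun _ => (1 : ℝ)) (g := A.indicator G) (v := e) (by simp)
    (by
      simp_rw [one_mul, hfe]
      exact (integrable_indicator_iff h.isOpen.measurableSet).2 i1)
    (by
      simp_rw [one_mul]
      exact (integrable_indicator_iff h.isOpen.measurableSet).2 i2)
    (fun x _ => differentiableAt_const _) (fun x _ => (hd x).differentiableAt)
  simp only [one_mul, hfe, fderiv_fun_const, Pi.zero_apply, zero_apply, zero_mul,
    integral_zero, neg_zero] at this
  rwa [integral_indicator h.isOpen.measurableSet] at this

/-- **Green's formula** `∫_A ∂ₑG = -∮ G N·e`, where `N = (∂ₛz)^⊥` points inwards. -/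
lemma green (h : IsBoundaryCurve z A) (hG : ContDiff ℝ 1 G) (e : Plane) :
    ∫ x in A, fderiv ℝ G x e = -∫ s in (0 : ℝ)..1, G (z s) * inner ℝ (perp (deriv z s)) e := by
  obtain ⟨ρ₀, hρ⟩ := exists_isTubeRadius h
  set T := tubeMap z '' univ ×ˢ Ioo (-ρ₀) ρ₀ with hT
  have hTo : IsOpen T := isOpen_tube h hρ
  have hcl : IsClosed (range z) := h.frontier_eq ▸ isClosed_frontier
  obtain ⟨χ, hχ1, hχ0, hχI⟩ := exists_contMDiffMap_one_nhds_of_subset_interior (n := 1)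
    (modelWithCornersSelf ℝ Plane) hcl (t := T) (by
      rw [hTo.interior_eq]; exact range_subset_tube hρ)
  have hχ : ContDiff ℝ 1 χ := contMDiff_iff_contDiff.1 χ.contMDiff
  have hχn : ∀ x ∈ range z, ∀ᶠ y in 𝓝 x, χ y = 1 := fun x hx =>
    (eventually_nhdsSet_iff_forall.1 hχ1) x hx
  have hG1 : ContDiff ℝ 1 fun x => χ x * G x := hχ.mul hG
  have hG2 : ContDiff ℝ 1 fun x => (1 - χ x) * G x := (contDiff_const.sub hχ).mul hG
  have k1 := green_of_support_tube h hρ hG1 (fun x hx => by simp [hχ0 x hx]) (fun x hx => by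
    -- the cut-off is nonnegative, so its zeros are critical points
    have hmin : IsLocalMin χ x := .of_forall fun y => by rw [hχ0 x hx]; exact (hχI y).1
    have hz : HasFDerivAt χ (0 : Plane →L[ℝ] ℝ) x := by
      have := (hχ.differentiable one_ne_zero x).hasFDerivAt
      rwa [hmin.fderiv_eq_zero] at this
    have : fderiv ℝ (fun x => χ x * G x) x = _ :=
      (hz.mul (hG.differentiable one_ne_zero x).hasFDerivAt).fderiv
    rw [this]
    simp [hχ0 x hx]) e
  have k2 := setIntegral_fderiv_eq_zero h hG2
    (fun x hx => (hχn x hx).mono fun y hy => by simp [hy]) e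
  have hcA : IsCompact (closure A) := h.isBounded.isCompact_closure
  have hint : ∀ {F : Plane → ℝ}, ContDiff ℝ 1 F → IntegrableOn (fun x => fderiv ℝ F x e) A :=
    fun hF => (((hF.continuous_fderiv one_ne_zero).clm_apply
      continuous_const).continuousOn.integrableOn_compact hcA).mono_set subset_closure
  have e1 : ∀ x, fderiv ℝ G x e =
      fderiv ℝ (fun x => χ x * G x) x e + fderiv ℝ (fun x => (1 - χ x) * G x) x e := by
    intro x
    have : G = fun x => χ x * G x + (1 - χ x) * G x := by ext x; ring
    conv_lhs => rw [this]
    rw [fderiv_fun_add (hG1.differentiable one_ne_zero x) (hG2.differentiable one_ne_zero x)]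
    rfl
  simp_rw [e1]
  rw [integral_add (hint hG1) (hint hG2), k1, k2, add_zero]
  congr 1
  refine intervalIntegral.integral_congr fun s _ => ?_
  simp [(hχn (z s) ⟨s, rfl⟩).self_of_nhds]

end green

/-! ### The interaction of a patch as a double integral over its boundary -/

section patch

variable {α ε : ℝ} {z : ℝ → Plane} {A : Set Plane} {Φ : Plane → ℝ}

lemma hasFDerivAt_regKernel_sub_right (hε : 0 < ε) (x y : Plane) :
    HasFDerivAt (fun y => regKernel α ε (x - y)) (-innerSL ℝ (regKernelGrad α ε (x - y))) y := by
  have := (hasFDerivAt_regKernel (α := α) hε (x - y)).comp y ((hasFDerivAt_id y).const_sub x)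
  refine this.congr_fderiv ?_
  ext w
  simp

lemma continuous_gradient (hΦ : ContDiff ℝ 1 Φ) : Continuous (∇ Φ) :=
  (InnerProductSpace.toDual ℝ Plane).symm.continuous.comp (hΦ.continuous_fderiv one_ne_zero)

/-- Green's formula in both variables. After the first application the term containing `∇K` is a
total derivative along the curve. -/
lemma regInteraction_indicator (hα : 0 < α) (hε : 0 < ε) (h : IsBoundaryCurve z A)
    (hΦ : ContDiff ℝ 1 Φ) {B : ℝ} (hB : ∀ x, ‖∇ Φ x‖ ≤ B) :
    regInteraction α ε Φ (A.indicator 1) =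
      ∫ s in (0 : ℝ)..1, ∫ r in (0 : ℝ)..1,
        Φ (z s) * regKernel α ε (z s - z r) * inner ℝ (deriv z r) (perp (deriv z s)) := by
  have hzc := h.contDiff.continuous
  have hz1 := h.contDiff_deriv.continuous
  have hKc : Continuous (regKernel α ε) := (contDiff_regKernel hε).continuous
  have hgc := continuous_regKernelGrad (α := α) hε
  have hΦg := continuous_gradient hΦ
  have hcA : IsCompact (closure A) := h.isBounded.isCompact_closure
  -- the two terms of the derivative of `Φ(x) K_ε(x - z(r))` along `∂ₛz(r)`
  set a : ℝ → Plane → ℝ := fun r x => regKernel α ε (x - z r) * inner ℝ (∇ Φ x) (deriv z r) with ha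
  set b : ℝ → Plane → ℝ := fun r x => Φ x * inner ℝ (regKernelGrad α ε (x - z r)) (deriv z r)
    with hb
  have hac : Continuous (Function.uncurry a) :=
    (hKc.comp (continuous_snd.sub (hzc.comp continuous_fst))).mul
      ((hΦg.comp continuous_snd).inner (hz1.comp continuous_fst))
  have hbc : Continuous (Function.uncurry b) :=
    (hΦ.continuous.comp continuous_snd).mul
      ((hgc.comp (continuous_snd.sub (hzc.comp continuous_fst))).inner (hz1.comp continuous_fst))
  have hswap : ∫ s in (0 : ℝ)..1, ∫ r in (0 : ℝ)..1,
        Φ (z s) * regKernel α ε (z s - z r) * inner ℝ (deriv z r) (perp (deriv z s)) =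
      ∫ r in (0 : ℝ)..1, ∫ s in (0 : ℝ)..1,
        Φ (z s) * regKernel α ε (z s - z r) * inner ℝ (deriv z r) (perp (deriv z s)) := by
    refine intervalIntegral_intervalIntegral_swap ?_
    refine (Continuous.continuousOn ?_).integrableOn_compact (isCompact_uIcc.prod isCompact_uIcc)
      |>.mono_set (prod_mono uIoc_subset_uIcc uIoc_subset_uIcc)
    exact (((hΦ.continuous.comp hzc).comp continuous_fst).mul
      (hKc.comp ((hzc.comp continuous_fst).sub (hzc.comp continuous_snd)))).mul
      ((hz1.comp continuous_snd).inner (continuous_perp.comp (hz1.comp continuous_fst)))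
  have hinner : ∀ r, ∫ s in (0 : ℝ)..1,
        Φ (z s) * regKernel α ε (z s - z r) * inner ℝ (deriv z r) (perp (deriv z s)) =
      -∫ x in A, (a r x + b r x) := by
    intro r
    have hG : ContDiff ℝ 1 fun x => Φ x * regKernel α ε (x - z r) :=
      hΦ.mul (((contDiff_regKernel hε).of_le (by simp)).comp (contDiff_id.sub contDiff_const))
    have hGd : ∀ x, fderiv ℝ (fun x => Φ x * regKernel α ε (x - z r)) x (deriv z r) =
        a r x + b r x := by
      intro x
      have d1 := (hΦ.differentiable one_ne_zero x).hasFDerivAt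
      have d2 : HasFDerivAt (fun x => regKernel α ε (x - z r))
          (innerSL ℝ (regKernelGrad α ε (x - z r))) x := by
        have := (hasFDerivAt_regKernel (α := α) hε (x - z r)).comp x
          ((hasFDerivAt_id x).sub_const (z r))
        exact this.congr_fderiv (ContinuousLinearMap.comp_id _)
      have d3 : fderiv ℝ (fun x => Φ x * regKernel α ε (x - z r)) x = _ := (d1.mul d2).fderiv
      rw [d3]
      simp only [ha, hb, add_apply, smul_apply, smul_eq_mul, innerSL_apply_apply,
        inner_gradient_left]
      ring
    have := green h hG (deriv z r)
    simp_rw [hGd] at this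
    rw [this, neg_neg]
    simp only [real_inner_comm]
  have hA1 : ∀ x, ∫ r in (0 : ℝ)..1, b r x = 0 := by
    intro x
    have hd : ∀ r, HasDerivAt (fun r => Φ x * -regKernel α ε (x - z r)) (b r x) r := by
      intro r
      have := ((hasFDerivAt_regKernel_sub_right (α := α) hε x (z r)).comp_hasDerivAt r
        (h.hasDerivAt r)).neg.const_mul (Φ x)
      simpa [hb] using this
    rw [intervalIntegral.integral_eq_sub_of_hasDerivAt (fun r _ => hd r)
      ((hbc.comp (Continuous.prodMk_left x)).intervalIntegrable _ _)]
    have p1 := h.periodic 0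
    rw [zero_add] at p1
    rw [p1, sub_self]
  have hA2 : ∀ x, ∫ r in (0 : ℝ)..1, a r x =
      ∫ y in A, inner ℝ (regKernelGrad α ε (x - y)) (perp (∇ Φ x)) := by
    intro x
    have hG : ContDiff ℝ 1 fun y => regKernel α ε (x - y) :=
      ((contDiff_regKernel hε).of_le (by simp)).comp (contDiff_const.sub contDiff_id)
    have := green h hG (perp (∇ Φ x))
    simp_rw [(hasFDerivAt_regKernel_sub_right (α := α) hε x _).fderiv] at this
    simp only [neg_apply, innerSL_apply_apply, inner_perp_perp] at this
    rw [integral_neg, neg_inj] at this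
    rw [this]
    simp only [ha, real_inner_comm]
  have iab : ∀ {f : ℝ → Plane → ℝ}, Continuous (Function.uncurry f) → Integrable
      (Function.uncurry f) ((volume.restrict (Ioc (0 : ℝ) 1)).prod (volume.restrict A)) := by
    intro f hf
    rw [Measure.prod_restrict, ← Measure.volume_eq_prod]
    exact (hf.continuousOn.integrableOn_compact (isCompact_Icc.prod hcA)).mono_set
      (prod_mono Ioc_subset_Icc_self subset_closure)
  have hmain : ∫ r in (0 : ℝ)..1, ∫ x in A, (a r x + b r x) =
      ∫ x in A, ∫ y in A, inner ℝ (regKernelGrad α ε (x - y)) (perp (∇ Φ x)) := by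
    rw [intervalIntegral_integral_swap (f := fun r x => a r x + b r x) (by
      rw [uIoc_of_le zero_le_one]; exact iab (hac.add hbc))]
    congr 1
    ext x
    have ia : IntervalIntegrable (fun r => a r x) volume 0 1 :=
      (hac.comp (Continuous.prodMk_left x)).intervalIntegrable _ _
    have ib : IntervalIntegrable (fun r => b r x) volume 0 1 :=
      (hbc.comp (Continuous.prodMk_left x)).intervalIntegrable _ _
    rw [intervalIntegral.integral_add ia ib, hA1, hA2, add_zero]
  have hind : Integrable (A.indicator (1 : Plane → ℝ)) := by
    rw [integrable_indicator_iff h.isOpen.measurableSet]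
    exact (continuous_const.continuousOn.integrableOn_compact hcA).mono_set subset_closure
  rw [hswap]
  simp_rw [hinner]
  rw [intervalIntegral.integral_neg, hmain, regInteraction, Measure.volume_eq_prod,
    integral_prod _ (integrable_regInteraction hα hε hΦg hB hind), ← integral_indicator
      h.isOpen.measurableSet]
  congr 2
  ext x
  by_cases hx : x ∈ A
  · simp only [indicator_of_mem hx, Pi.one_apply, one_mul]
    rw [← integral_indicator h.isOpen.measurableSet]
    congr 1
    ext y
    by_cases hy : y ∈ A <;> simp [hy]
  · simp [hx]

/-! ### The sharp-front integral -/

lemma integral_period_eq_shift {E : Type*} [NormedAddCommGroup E] [NormedSpace ℝ E] {f : ℝ → E}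
    (hf : Function.Periodic f 1) (s : ℝ) :
    ∫ r in (0 : ℝ)..1, f r = ∫ d in (-(1 / 2) : ℝ)..(1 / 2), f (s + d) := by
  rw [intervalIntegral.integral_comp_add_left]
  have := hf.intervalIntegral_add_eq 0 (s + -(1 / 2))
  rw [zero_add] at this
  rw [this]
  congr 1
  ring

lemma frontIntegrand_periodic (h : IsBoundaryCurve z A) (s : ℝ) :
    Function.Periodic (frontIntegrand α z s) 1 := fun r => by
  simp only [frontIntegrand, h.periodic r, h.deriv_periodic r]

/-- The chord-arc inequality and the Lipschitz bound on the tangent control the integrand. -/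
lemma norm_kernel_smul_le (hα : 0 < α) {c M d : ℝ} (hc : 0 < c) (hM : 0 ≤ M) {v w : Plane}
    (hv : c * |d| ≤ ‖v‖) (hw : ‖w‖ ≤ M * |d|) :
    kernel α v * ‖w‖ ≤ c ^ (-1 - α) * M * |d| ^ (-α) := by
  rcases eq_or_ne d 0 with rfl | hd
  · have : ‖w‖ = 0 := le_antisymm (by simpa using hw) (norm_nonneg w)
    rw [this, mul_zero]
    positivity
  have hd' : 0 < |d| := abs_pos.2 hd
  have h1 : kernel α v ≤ c ^ (-1 - α) * |d| ^ (-1 - α) := by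
    rw [kernel, ← Real.mul_rpow hc.le hd'.le]
    exact Real.rpow_le_rpow_of_nonpos (by positivity) hv (by linarith)
  have h2 : |d| ^ (-1 - α) * |d| = |d| ^ (-α) := by
    nth_rewrite 2 [← Real.rpow_one |d|]
    rw [← Real.rpow_add hd']
    congr 1; ring
  calc _ ≤ c ^ (-1 - α) * |d| ^ (-1 - α) * (M * |d|) :=
        mul_le_mul h1 hw (norm_nonneg _) (by positivity)
    _ = c ^ (-1 - α) * M * (|d| ^ (-1 - α) * |d|) := by ring
    _ = _ := by rw [h2]

lemma norm_frontIntegrand_le (hα : 0 < α) {c M s d : ℝ} (hc : 0 < c) (hM : 0 ≤ M)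
    (hv : c * |d| ≤ ‖z (s + d) - z s‖) (hw : ‖deriv z (s + d) - deriv z s‖ ≤ M * |d|) :
    ‖frontIntegrand α z s (s + d)‖ ≤ c ^ (-1 - α) * M * |d| ^ (-α) := by
  rw [frontIntegrand, norm_smul, Real.norm_of_nonneg (kernel_nonneg _)]
  exact norm_kernel_smul_le hα hc hM (by rwa [norm_sub_rev]) hw

lemma intervalIntegrable_abs_rpow (hα₁ : α < 1) (C a b : ℝ) :
    IntervalIntegrable (fun d : ℝ => C * |d| ^ (-α)) volume a b := by
  have : LocallyIntegrable fun d : ℝ => C * |d| ^ (-α) := by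
    refine locallyIntegrable_of_norm_le_rpow (C := |C|) (α := α) (by simp) (by simpa using hα₁)
      (.of_forall fun x => ?_) (Measurable.aestronglyMeasurable (by fun_prop))
    rw [norm_mul, Real.norm_eq_abs, Real.norm_of_nonneg (by positivity), Real.norm_eq_abs]
  exact (this.integrableOn_isCompact isCompact_uIcc).intervalIntegrable

lemma measurable_frontIntegrand (h : IsBoundaryCurve z A) (s : ℝ) :
    Measurable (frontIntegrand α z s) :=
  (measurable_kernel.comp (continuous_const.sub h.contDiff.continuous).measurable).smul
    (h.contDiff_deriv.continuous.sub continuous_const).measurable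

lemma integrableOn_frontIntegrand (hα₀ : 0 < α) (hα₁ : α < 1) (h : IsBoundaryCurve z A) (s : ℝ) :
    IntegrableOn (frontIntegrand α z s) (Ioc 0 1) := by
  obtain ⟨c, M, hc, hM, -, -, b3, -, b5⟩ := h.exists_chord_arc
  have h1 : IntervalIntegrable (fun d => frontIntegrand α z s (s + d)) volume
      (-(1 / 2)) (1 / 2) := by
    refine (intervalIntegrable_abs_rpow hα₁ (c ^ (-1 - α) * M) _ _).mono_fun'
      ((measurable_frontIntegrand h s).comp (measurable_const_add s)).aestronglyMeasurable ?_
    refine (ae_restrict_iff' measurableSet_uIoc).2 (.of_forall fun d hd => ?_)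
    rw [uIoc_of_le (by norm_num)] at hd
    have b := b3 s (s + d)
    rw [add_sub_cancel_left] at b
    exact norm_frontIntegrand_le hα₀ hc hM (b5 s d (abs_le.2 ⟨hd.1.le, hd.2⟩)) b
  have h2 := h1.comp_sub_right s
  simp only [add_sub_cancel] at h2
  rw [← intervalIntegrable_iff_integrableOn_Ioc_of_le zero_le_one]
  exact (frontIntegrand_periodic h s).intervalIntegrable (t := -(1 / 2) + s) one_ne_zero
    (by convert! h2 using 1; ring) 0 1

/-- The double boundary integral with the regularised kernel converges to the sharp-front
integral tested against `Φ`; the tangential term `∂ₛz` may be subtracted because `∂ₛz · N = 0`. -/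
lemma tendsto_regInteraction_indicator (hα₀ : 0 < α) (hα₁ : α < 1) (h : IsBoundaryCurve z A)
    (hΦ : ContDiff ℝ 1 Φ) {B : ℝ} (hB : ∀ x, ‖∇ Φ x‖ ≤ B) :
    Tendsto (fun ε => regInteraction α ε Φ (A.indicator 1)) (𝓝[>] 0)
      (𝓝 (∫ s in (0 : ℝ)..1, Φ (z s) * inner ℝ (frontIntegral α z s) (perp (deriv z s)))) := by
  obtain ⟨c, M, hc, hM, b1, -, b3, -, b5⟩ := h.exists_chord_arc
  have hzc := h.contDiff.continuous
  have hz1 := h.contDiff_deriv.continuous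
  obtain ⟨D, hD⟩ := (isCompact_Icc (a := (0 : ℝ)) (b := 1)).exists_bound_of_continuousOn
    (hΦ.continuous.comp hzc).continuousOn
  have hb3 : ∀ s d, ‖deriv z (s + d) - deriv z s‖ ≤ M * |d| := fun s d => by
    have b := b3 s (s + d)
    rwa [add_sub_cancel_left] at b
  set g : ℝ → ℝ → ℝ → ℝ := fun ε s d => Φ (z s) * (regKernel α ε (z s - z (s + d)) *
    inner ℝ (deriv z (s + d) - deriv z s) (perp (deriv z s))) with hg
  have hgb : ∀ ε, ∀ s ∈ Icc (0 : ℝ) 1, ∀ d ∈ uIoc (-(1 / 2) : ℝ) (1 / 2),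
      ‖g ε s d‖ ≤ D * (c ^ (-1 - α) * M * M) * |d| ^ (-α) := by
    intro ε s hs d hd
    rw [uIoc_of_le (by norm_num)] at hd
    have hv := b5 s d (abs_le.2 ⟨hd.1.le, hd.2⟩)
    rw [hg, norm_mul, mul_assoc]
    refine mul_le_mul (hD s hs) ?_ (norm_nonneg _) ((norm_nonneg _).trans (hD s hs))
    rw [norm_mul, Real.norm_of_nonneg (regKernel_nonneg _)]
    rcases eq_or_ne d 0 with rfl | hd0
    · simp only [add_zero, sub_self, inner_zero_left, norm_zero, mul_zero]
      positivity
    have hne : z s - z (s + d) ≠ 0 := by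
      rw [← norm_pos_iff, norm_sub_rev]
      exact lt_of_lt_of_le (mul_pos hc (abs_pos.2 hd0)) hv
    have hip : ‖(inner ℝ (deriv z (s + d) - deriv z s) (perp (deriv z s)) : ℝ)‖ ≤
        ‖deriv z (s + d) - deriv z s‖ * M := by
      refine (norm_inner_le_norm _ _).trans ?_
      rw [norm_perp]
      exact mul_le_mul_of_nonneg_left (b1 s) (norm_nonneg _)
    calc _ ≤ kernel α (z s - z (s + d)) * (‖deriv z (s + d) - deriv z s‖ * M) :=
          mul_le_mul (regKernel_le_kernel hα₀ hne) hip (norm_nonneg _) (kernel_nonneg _)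
      _ = (kernel α (z s - z (s + d)) * ‖deriv z (s + d) - deriv z s‖) * M := by ring
      _ ≤ (c ^ (-1 - α) * M * |d| ^ (-α)) * M := mul_le_mul_of_nonneg_right
          (norm_kernel_smul_le hα₀ hc hM (by rwa [norm_sub_rev]) (hb3 s d)) hM
      _ = _ := by ring
  have hgc : ∀ ε, 0 < ε → Continuous (Function.uncurry (g ε)) := by
    intro ε hε
    have hsd : Continuous fun p : ℝ × ℝ => p.1 + p.2 := by fun_prop
    exact ((hΦ.continuous.comp hzc).comp continuous_fst).mul
      (((contDiff_regKernel hε).continuous.comp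
        ((hzc.comp continuous_fst).sub (hzc.comp hsd))).mul
      (((hz1.comp hsd).sub (hz1.comp continuous_fst)).inner
        (continuous_perp.comp (hz1.comp continuous_fst))))
  have hI := intervalIntegrable_abs_rpow hα₁ (D * (c ^ (-1 - α) * M * M)) (-(1 / 2)) (1 / 2)
  have hrep : ∀ ε, 0 < ε → regInteraction α ε Φ (A.indicator 1) =
      ∫ s in (0 : ℝ)..1, ∫ d in (-(1 / 2) : ℝ)..(1 / 2), g ε s d := by
    intro ε hε
    rw [regInteraction_indicator hα₀ hε h hΦ hB]
    refine intervalIntegral.integral_congr fun s _ => ?_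
    rw [integral_period_eq_shift (fun r => by simp only [h.periodic r, h.deriv_periodic r]) s]
    refine intervalIntegral.integral_congr fun d _ => ?_
    simp only [hg, inner_sub_left, inner_self_perp, sub_zero, mul_assoc]
  have hlim : ∀ s ∈ Icc (0 : ℝ) 1, Tendsto (fun ε => ∫ d in (-(1 / 2) : ℝ)..(1 / 2), g ε s d)
      (𝓝[>] 0) (𝓝 (Φ (z s) * inner ℝ (frontIntegral α z s) (perp (deriv z s)))) := by
    intro s hs
    have e : Φ (z s) * inner ℝ (frontIntegral α z s) (perp (deriv z s)) =
        ∫ d in (-(1 / 2) : ℝ)..(1 / 2), Φ (z s) * (kernel α (z s - z (s + d)) *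
          inner ℝ (deriv z (s + d) - deriv z s) (perp (deriv z s))) := by
      have hi := integrableOn_frontIntegrand hα₀ hα₁ h s
      rw [frontIntegral, real_inner_comm, ← integral_inner hi, ← integral_const_mul,
        ← intervalIntegral.integral_of_le zero_le_one, integral_period_eq_shift (fun r => by
          simp only [frontIntegrand_periodic h s r]) s]
      refine intervalIntegral.integral_congr fun d _ => ?_
      simp only [frontIntegrand, inner_smul_right, real_inner_comm]
    rw [e]
    refine intervalIntegral.tendsto_integral_filter_of_dominated_convergence _ ?_ ?_ hI ?_
    · filter_upwards [self_mem_nhdsWithin] with ε hε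
      exact ((hgc ε hε).comp (Continuous.prodMk_right s)).aestronglyMeasurable
    · exact .of_forall fun ε => .of_forall fun d hd => hgb ε s hs d hd
    · refine .of_forall fun d hd => ?_
      rcases eq_or_ne d 0 with rfl | hd0
      · simp [hg]
      rw [uIoc_of_le (by norm_num)] at hd
      have hne : z s - z (s + d) ≠ 0 := by
        rw [← norm_pos_iff, norm_sub_rev]
        exact lt_of_lt_of_le (mul_pos hc (abs_pos.2 hd0)) (b5 s d (abs_le.2 ⟨hd.1.le, hd.2⟩))
      exact ((tendsto_regKernel hne).mul_const _).const_mul _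
  refine Tendsto.congr' (f₁ := fun ε => ∫ s in (0 : ℝ)..1, ∫ d in (-(1 / 2) : ℝ)..(1 / 2), g ε s d)
    ?_ ?_
  · filter_upwards [self_mem_nhdsWithin] with ε hε using (hrep ε hε).symm
  refine intervalIntegral.tendsto_integral_filter_of_dominated_convergence
    (fun _ => ∫ d in (-(1 / 2) : ℝ)..(1 / 2), D * (c ^ (-1 - α) * M * M) * |d| ^ (-α)) ?_ ?_
    (by simp) ?_
  · filter_upwards [self_mem_nhdsWithin] with ε hε
    exact (intervalIntegral.continuous_parametric_intervalIntegral_of_continuous'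
      (hgc ε hε) _ _).aestronglyMeasurable
  · refine .of_forall fun ε => .of_forall fun s hs => ?_
    rw [uIoc_of_le zero_le_one] at hs
    refine intervalIntegral.norm_integral_le_of_norm_le (by norm_num) (.of_forall fun d hd => ?_) hI
    exact hgb ε s ⟨hs.1.le, hs.2⟩ d (by rwa [uIoc_of_le (by norm_num)])
  · refine .of_forall fun s hs => ?_
    rw [uIoc_of_le zero_le_one] at hs
    exact hlim s ⟨hs.1.le, hs.2⟩

end patch

/-! ### Integrals depending on a parameter -/

section parametric

lemma hasFDerivAt_intervalIntegral_of_continuous {E : Type*} [NormedAddCommGroup E]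
    [NormedSpace ℝ E] [ProperSpace E] {k : E → ℝ → ℝ} {k' : E → ℝ → E →L[ℝ] ℝ}
    (hk : Continuous (Function.uncurry k)) (hk' : Continuous (Function.uncurry k'))
    (hd : ∀ p r, HasFDerivAt (fun p => k p r) (k' p r) p) (a b : ℝ) (p₀ : E) :
    HasFDerivAt (fun p => ∫ r in a..b, k p r) (∫ r in a..b, k' p₀ r) p₀ := by
  obtain ⟨C, hC⟩ := ((isCompact_closedBall p₀ 1).prod (isCompact_uIcc (a := a) (b := b))
    ).exists_bound_of_continuousOn hk'.continuousOn
  refine (intervalIntegral.hasFDerivAt_integral_of_dominated_of_fderiv_le (μ := volume)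
    (bound := fun _ => C) (F := k) (F' := k') (Metric.ball_mem_nhds p₀ one_pos) ?_ ?_ ?_ ?_ ?_ ?_)
  · exact .of_forall fun p => (hk.comp (Continuous.prodMk_right p)).aestronglyMeasurable
  · exact (hk.comp (Continuous.prodMk_right p₀)).intervalIntegrable _ _
  · exact (hk'.comp (Continuous.prodMk_right p₀)).aestronglyMeasurable
  · exact .of_forall fun r hr p hp =>
      hC (p, r) ⟨Metric.ball_subset_closedBall hp, uIoc_subset_uIcc hr⟩
  · simp
  · exact .of_forall fun r _ p _ => hd p r

lemma hasDerivAt_intervalIntegral_of_continuous {k k' : ℝ → ℝ → ℝ}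
    (hk : Continuous (Function.uncurry k)) (hk' : Continuous (Function.uncurry k'))
    (hd : ∀ p r, HasDerivAt (fun p => k p r) (k' p r) p) (a b p₀ : ℝ) :
    HasDerivAt (fun p => ∫ r in a..b, k p r) (∫ r in a..b, k' p₀ r) p₀ := by
  obtain ⟨C, hC⟩ := ((isCompact_closedBall p₀ 1).prod (isCompact_uIcc (a := a) (b := b))
    ).exists_bound_of_continuousOn hk'.continuousOn
  refine (intervalIntegral.hasDerivAt_integral_of_dominated_loc_of_deriv_le (μ := volume)
    (bound := fun _ => C) (F := k) (F' := k') (Metric.ball_mem_nhds p₀ one_pos) ?_ ?_ ?_ ?_ ?_ ?_).2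
  · exact .of_forall fun p => (hk.comp (Continuous.prodMk_right p)).aestronglyMeasurable
  · exact (hk.comp (Continuous.prodMk_right p₀)).intervalIntegrable _ _
  · exact (hk'.comp (Continuous.prodMk_right p₀)).aestronglyMeasurable
  · exact .of_forall fun r hr p hp =>
      hC (p, r) ⟨Metric.ball_subset_closedBall hp, uIoc_subset_uIcc hr⟩
  · simp
  · exact .of_forall fun r _ p _ => hd p r

/-- Integration of a function of `(t, s)` first in `s` and then in `t`, differentiated in a
parameter. -/
lemma hasDerivAt_integral_integral_of_continuous {k k' : ℝ → ℝ × ℝ → ℝ}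
    (hk : Continuous (Function.uncurry k)) (hk' : Continuous (Function.uncurry k'))
    (hd : ∀ p q, HasDerivAt (fun p => k p q) (k' p q) p) (a b c d p₀ : ℝ) :
    HasDerivAt (fun p => ∫ t in a..b, ∫ s in c..d, k p (t, s))
      (∫ t in a..b, ∫ s in c..d, k' p₀ (t, s)) p₀ := by
  have cont : ∀ {f : ℝ → ℝ × ℝ → ℝ}, Continuous (Function.uncurry f) →
      Continuous (Function.uncurry fun p t => ∫ s in c..d, f p (t, s)) := fun {f} hf => by
    refine intervalIntegral.continuous_parametric_intervalIntegral_of_continuous'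
      (f := fun (q : ℝ × ℝ) s => f q.1 (q.2, s)) ?_ c d
    exact hf.comp (f := fun q : (ℝ × ℝ) × ℝ => (q.1.1, (q.1.2, q.2))) (by fun_prop)
  refine hasDerivAt_intervalIntegral_of_continuous (cont hk) (cont hk') (fun p t => ?_) a b p₀
  exact hasDerivAt_intervalIntegral_of_continuous (k := fun p s => k p (t, s))
    (k' := fun p s => k' p (t, s))
    (hk.comp (f := fun q : ℝ × ℝ => (q.1, (t, q.2))) (by fun_prop))
    (hk'.comp (f := fun q : ℝ × ℝ => (q.1, (t, q.2))) (by fun_prop)) (fun p s => hd p (t, s)) c d p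

/-- The Jacobian `f_t g_s - f_s g_t` of two `C¹` functions integrates to zero. Since mixed second
derivatives need not exist, one integrates by parts in `∫∫ f(t + h, s) g_s(t, s)` and then
differentiates in `h`. -/
lemma integral_jacobian_eq_zero {f g : ℝ × ℝ → ℝ} (hf : ContDiff ℝ 1 f) (hg : ContDiff ℝ 1 g)
    (hfp : ∀ t s, f (t, s + 1) = f (t, s)) (hgp : ∀ t s, g (t, s + 1) = g (t, s)) {a b T : ℝ}
    (ha : 0 < a) (hb : b < T) (hf0 : ∀ t ∉ Icc a b, ∀ s, f (t, s) = 0) :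
    ∫ t in (0 : ℝ)..T, ∫ s in (0 : ℝ)..1, fderiv ℝ f (t, s) (1, 0) * fderiv ℝ g (t, s) (0, 1) =
      ∫ t in (0 : ℝ)..T, ∫ s in (0 : ℝ)..1,
        fderiv ℝ f (t, s) (0, 1) * fderiv ℝ g (t, s) (1, 0) := by
  have hfc := hf.continuous
  have hgc := hg.continuous
  have hf' : ∀ v, Continuous fun p => fderiv ℝ f p v := fun v =>
    (hf.continuous_fderiv one_ne_zero).clm_apply continuous_const
  have hg' : ∀ v, Continuous fun p => fderiv ℝ g p v := fun v =>
    (hg.continuous_fderiv one_ne_zero).clm_apply continuous_const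
  have dt : ∀ {k : ℝ × ℝ → ℝ}, ContDiff ℝ 1 k → ∀ t s,
      HasDerivAt (fun t => k (t, s)) (fderiv ℝ k (t, s) (1, 0)) t := fun {k} hk t s =>
    HasFDerivAt.comp_hasDerivAt (f := fun t => (t, s)) t
      (hk.differentiable one_ne_zero (t, s)).hasFDerivAt
      ((hasDerivAt_id t).prodMk (hasDerivAt_const t s))
  have ds : ∀ {k : ℝ × ℝ → ℝ}, ContDiff ℝ 1 k → ∀ t s,
      HasDerivAt (fun s => k (t, s)) (fderiv ℝ k (t, s) (0, 1)) s := fun {k} hk t s =>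
    HasFDerivAt.comp_hasDerivAt (f := fun s => (t, s)) s
      (hk.differentiable one_ne_zero (t, s)).hasFDerivAt
      ((hasDerivAt_const s t).prodMk (hasDerivAt_id s))
  have hf0' : ∀ t ∉ Icc a b, ∀ s, fderiv ℝ f (t, s) (0, 1) = 0 := fun t ht s => by
    have := ds hf t s
    simp only [hf0 t ht] at this
    exact this.unique (hasDerivAt_const s 0)
  have d1 : HasDerivAt (fun h => ∫ t in (0 : ℝ)..T, ∫ s in (0 : ℝ)..1,
      f (t + h, s) * fderiv ℝ g (t, s) (0, 1))
      (∫ t in (0 : ℝ)..T, ∫ s in (0 : ℝ)..1,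
        fderiv ℝ f (t + 0, s) (1, 0) * fderiv ℝ g (t, s) (0, 1)) 0 := by
    refine hasDerivAt_integral_integral_of_continuous
      (k := fun h q => f (q.1 + h, q.2) * fderiv ℝ g q (0, 1))
      (k' := fun h q => fderiv ℝ f (q.1 + h, q.2) (1, 0) * fderiv ℝ g q (0, 1))
      ?_ ?_ (fun h q => ?_) _ _ _ _ _
    · exact (hfc.comp (f := fun p : ℝ × ℝ × ℝ => (p.2.1 + p.1, p.2.2)) (by fun_prop)).mul
        ((hg' _).comp continuous_snd)
    · exact ((hf' _).comp (f := fun p : ℝ × ℝ × ℝ => (p.2.1 + p.1, p.2.2)) (by fun_prop)).mul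
        ((hg' _).comp continuous_snd)
    · refine HasDerivAt.mul_const ?_ _
      exact HasDerivAt.comp_const_add q.1 h (dt hf (q.1 + h) q.2)
  have d2 : HasDerivAt (fun h => ∫ t in (0 : ℝ)..T, ∫ s in (0 : ℝ)..1,
      fderiv ℝ f (t, s) (0, 1) * g (t - h, s))
      (∫ t in (0 : ℝ)..T, ∫ s in (0 : ℝ)..1,
        fderiv ℝ f (t, s) (0, 1) * -fderiv ℝ g (t - 0, s) (1, 0)) 0 := by
    refine hasDerivAt_integral_integral_of_continuous
      (k := fun h q => fderiv ℝ f q (0, 1) * g (q.1 - h, q.2))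
      (k' := fun h q => fderiv ℝ f q (0, 1) * -fderiv ℝ g (q.1 - h, q.2) (1, 0))
      ?_ ?_ (fun h q => ?_) _ _ _ _ _
    · exact ((hf' _).comp continuous_snd).mul
        (hgc.comp (f := fun p : ℝ × ℝ × ℝ => (p.2.1 - p.1, p.2.2)) (by fun_prop))
    · exact ((hf' _).comp continuous_snd).mul
        ((hg' _).comp (f := fun p : ℝ × ℝ × ℝ => (p.2.1 - p.1, p.2.2)) (by fun_prop)).neg
    · refine HasDerivAt.const_mul _ ?_
      exact HasDerivAt.comp_const_sub q.1 h (dt hg (q.1 - h) q.2)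
  have heq : ∀ᶠ h in 𝓝 (0 : ℝ), ∫ t in (0 : ℝ)..T, ∫ s in (0 : ℝ)..1,
      f (t + h, s) * fderiv ℝ g (t, s) (0, 1) =
      -∫ t in (0 : ℝ)..T, ∫ s in (0 : ℝ)..1, fderiv ℝ f (t, s) (0, 1) * g (t - h, s) := by
    have hm : Ioo (b - T) a ∈ 𝓝 (0 : ℝ) := Ioo_mem_nhds (by linarith) ha
    filter_upwards [hm] with h hh
    have parts : ∀ t, ∫ s in (0 : ℝ)..1, f (t + h, s) * fderiv ℝ g (t, s) (0, 1) =
        -∫ s in (0 : ℝ)..1, fderiv ℝ f (t + h, s) (0, 1) * g (t + h - h, s) := by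
      intro t
      rw [intervalIntegral.integral_mul_deriv_eq_deriv_mul (fun s _ => ds hf (t + h) s)
        (fun s _ => ds hg t s)
        (((hf' _).comp (Continuous.prodMk_right (t + h))).intervalIntegrable _ _)
        (((hg' _).comp (Continuous.prodMk_right t)).intervalIntegrable _ _)]
      have p1 := hfp (t + h) 0
      have p2 := hgp t 0
      rw [zero_add] at p1 p2
      rw [p1, p2, sub_self, zero_sub, add_sub_cancel_right]
    simp_rw [parts]
    rw [intervalIntegral.integral_neg, neg_inj]
    have supp : ∀ t, t ∉ Icc a b →
        ∫ s in (0 : ℝ)..1, fderiv ℝ f (t, s) (0, 1) * g (t - h, s) = 0 := fun t ht => by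
      simp [hf0' t ht]
    rw [intervalIntegral.integral_eq_integral_of_support_subset,
      intervalIntegral.integral_eq_integral_of_support_subset]
    · exact integral_add_right_eq_self
        (fun t => ∫ s in (0 : ℝ)..1, fderiv ℝ f (t, s) (0, 1) * g (t - h, s)) h
    · intro t ht
      have : t ∈ Icc a b := by
        by_contra hn
        exact ht (supp t hn)
      exact ⟨by linarith [this.1], by linarith [this.2]⟩
    · intro t ht
      have : t + h ∈ Icc a b := by
        by_contra hn
        exact ht (supp (t + h) hn)
      exact ⟨by linarith [this.1, hh.2], by linarith [this.2, hh.1]⟩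
  have := (d1.congr_of_eventuallyEq (heq.mono fun h e => e.symm)).unique d2.neg
  simpa using this

end parametric

/-! ### The primitive in the first variable -/

section primitive

/-- The map `(t, x) ↦ (t, r x₁, x₂)`. -/
noncomputable def horizScale (r : ℝ) : ℝ × Plane →L[ℝ] ℝ × Plane :=
  (ContinuousLinearMap.fst ℝ ℝ Plane).prod
      (((EuclideanSpace.proj (1 : Fin 2)).comp (ContinuousLinearMap.snd ℝ ℝ Plane)).smulRight
        (EuclideanSpace.single 1 1)) +
    r • (0 : ℝ × Plane →L[ℝ] ℝ).prod
      (((EuclideanSpace.proj (0 : Fin 2)).comp (ContinuousLinearMap.snd ℝ ℝ Plane)).smulRight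
        (EuclideanSpace.single 0 1))

lemma horizScale_apply (r : ℝ) (p : ℝ × Plane) :
    horizScale r p = (p.1, !₂[r * p.2 0, p.2 1]) := by
  refine Prod.ext (by simp [horizScale]) ?_
  ext i
  fin_cases i <;> simp [horizScale]

lemma continuous_horizScale : Continuous horizScale := by
  unfold horizScale; fun_prop

/-- The primitive `∫₀^{x₁} ψ(t, y, x₂) dy`, written as an integral over a fixed interval. -/
noncomputable def horizPrimitive (ψ : ℝ × Plane → ℝ) (p : ℝ × Plane) : ℝ :=
  ∫ r in (0 : ℝ)..1, p.2 0 * ψ (horizScale r p)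

variable {ψ : ℝ × Plane → ℝ}

/-- The integrand of the derivative of `horizPrimitive ψ`. -/
noncomputable def horizPrimitiveDeriv (ψ : ℝ × Plane → ℝ) (p : ℝ × Plane) (r : ℝ) :
    ℝ × Plane →L[ℝ] ℝ :=
  p.2 0 • (fderiv ℝ ψ (horizScale r p)).comp (horizScale r) +
    ψ (horizScale r p) • (EuclideanSpace.proj (0 : Fin 2)).comp (ContinuousLinearMap.snd ℝ ℝ Plane)

lemma continuous_horizScale_apply :
    Continuous fun q : (ℝ × Plane) × ℝ => horizScale q.2 q.1 :=
  (continuous_horizScale.comp continuous_snd).clm_apply continuous_fst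

lemma continuous_horizPrimitiveDeriv (hψ : ContDiff ℝ 1 ψ) :
    Continuous (Function.uncurry (horizPrimitiveDeriv ψ)) := by
  have h0 : Continuous fun q : (ℝ × Plane) × ℝ => q.1.2 0 := by fun_prop
  exact (h0.smul (((hψ.continuous_fderiv one_ne_zero).comp continuous_horizScale_apply).clm_comp
    (continuous_horizScale.comp continuous_snd))).add
    ((hψ.continuous.comp continuous_horizScale_apply).smul continuous_const)

lemma hasFDerivAt_horizPrimitive (hψ : ContDiff ℝ 1 ψ) (p : ℝ × Plane) :
    HasFDerivAt (horizPrimitive ψ) (∫ r in (0 : ℝ)..1, horizPrimitiveDeriv ψ p r) p := by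
  unfold horizPrimitive
  refine hasFDerivAt_intervalIntegral_of_continuous
    (k := fun p r => p.2 0 * ψ (horizScale r p)) ?_ (continuous_horizPrimitiveDeriv hψ)
    (fun p r => ?_) _ _ p
  · have h0 : Continuous fun q : (ℝ × Plane) × ℝ => q.1.2 0 := by fun_prop
    exact h0.mul (hψ.continuous.comp continuous_horizScale_apply)
  · have d1 := ((EuclideanSpace.proj (0 : Fin 2) : Plane →L[ℝ] ℝ).comp
      (ContinuousLinearMap.snd ℝ ℝ Plane)).hasFDerivAt (x := p)
    have d2 := (hψ.differentiable one_ne_zero (horizScale r p)).hasFDerivAt.comp p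
      (horizScale r).hasFDerivAt
    exact d1.mul d2

lemma contDiff_horizPrimitive (hψ : ContDiff ℝ 1 ψ) : ContDiff ℝ 1 (horizPrimitive ψ) := by
  rw [contDiff_one_iff_fderiv]
  refine ⟨fun p => (hasFDerivAt_horizPrimitive hψ p).differentiableAt, ?_⟩
  rw [funext fun p => (hasFDerivAt_horizPrimitive hψ p).fderiv]
  exact intervalIntegral.continuous_parametric_intervalIntegral_of_continuous'
    (continuous_horizPrimitiveDeriv hψ) 0 1

lemma fderiv_horizPrimitive (hψ : ContDiff ℝ 1 ψ) (p v : ℝ × Plane) :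
    fderiv ℝ (horizPrimitive ψ) p v = ∫ r in (0 : ℝ)..1,
      (p.2 0 * fderiv ℝ ψ (horizScale r p) (horizScale r v) + ψ (horizScale r p) * v.2 0) := by
  have hi : IntervalIntegrable (horizPrimitiveDeriv ψ p) volume 0 1 :=
    ((continuous_horizPrimitiveDeriv hψ).comp (Continuous.prodMk_right p)).intervalIntegrable _ _
  rw [(hasFDerivAt_horizPrimitive hψ p).fderiv, ContinuousLinearMap.intervalIntegral_apply hi]
  rfl

lemma fderiv_horizPrimitive_time (hψ : ContDiff ℝ 1 ψ) (p : ℝ × Plane) :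
    fderiv ℝ (horizPrimitive ψ) p (1, 0) = horizPrimitive (fun q => fderiv ℝ ψ q (1, 0)) p := by
  rw [fderiv_horizPrimitive hψ]
  have : ∀ r, horizScale r (1, 0) = (1, 0) := fun r => by
    rw [horizScale_apply]
    refine Prod.ext rfl ?_
    ext i; fin_cases i <;> simp
  simp [horizPrimitive, this]

lemma fderiv_horizPrimitive_horiz (hψ : ContDiff ℝ 1 ψ) (p : ℝ × Plane) :
    fderiv ℝ (horizPrimitive ψ) p (0, EuclideanSpace.single 0 1) = ψ p := by
  rw [fderiv_horizPrimitive hψ]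
  set w : ℝ × Plane := (0, p.2 0 • EuclideanSpace.single 0 1) with hw
  have hS : ∀ r : ℝ, p.2 0 • horizScale r (0, EuclideanSpace.single 0 1) = r • w := fun r => by
    rw [horizScale_apply]
    refine Prod.ext (by simp [hw]) ?_
    ext i; fin_cases i <;> simp [hw, mul_comm]
  have hSd : ∀ r, HasDerivAt (fun r => horizScale r p) w r := fun r => by
    have e : ∀ r, horizScale r p = r • w + ((p.1, !₂[0, p.2 1]) : ℝ × Plane) := fun r => by
      rw [horizScale_apply]
      refine Prod.ext (by simp [hw]) ?_
      ext i; fin_cases i <;> simp [hw]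
    simp_rw [e]
    have := ((hasDerivAt_id r).smul_const w).add_const ((p.1, !₂[0, p.2 1]) : ℝ × Plane)
    rwa [one_smul] at this
  have hd : ∀ r, HasDerivAt (fun r => r * ψ (horizScale r p))
      (p.2 0 * fderiv ℝ ψ (horizScale r p) (horizScale r (0, EuclideanSpace.single 0 1)) +
        ψ (horizScale r p)) r := fun r => by
    have := (hasDerivAt_id r).mul ((hψ.differentiable one_ne_zero
      (horizScale r p)).hasFDerivAt.comp_hasDerivAt r (hSd r))
    refine this.congr_deriv ?_
    rw [← smul_eq_mul (p.2 0), ← map_smul, hS, map_smul]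
    simp [add_comm]
  have hc : Continuous fun r => p.2 0 * fderiv ℝ ψ (horizScale r p)
      (horizScale r (0, EuclideanSpace.single 0 1)) + ψ (horizScale r p) := by
    have h1 : Continuous fun r => horizScale r p := continuous_horizScale.clm_apply continuous_const
    exact (continuous_const.mul (((hψ.continuous_fderiv one_ne_zero).comp h1).clm_apply
      (continuous_horizScale.clm_apply continuous_const))).add (hψ.continuous.comp h1)
  have := intervalIntegral.integral_eq_sub_of_hasDerivAt (fun r _ => hd r)
    (hc.intervalIntegrable 0 1)
  simp only [PiLp.single_apply, if_true, mul_one]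
  rw [this]
  have e1 : horizScale 1 p = p := by
    rw [horizScale_apply]
    refine Prod.ext rfl ?_
    ext i; fin_cases i <;> simp
  simp [e1]

/-- The integral over the region of a function of position, as a boundary integral. -/
lemma setIntegral_eq_boundary_integral {z : ℝ → Plane} {A : Set Plane} (h : IsBoundaryCurve z A)
    (hψ : ContDiff ℝ 1 ψ) (t : ℝ) :
    ∫ x in A, ψ (t, x) = ∫ s in (0 : ℝ)..1, horizPrimitive ψ (t, z s) * deriv z s 1 := by
  have hF := contDiff_horizPrimitive hψ
  have hG : ContDiff ℝ 1 fun x => horizPrimitive ψ (t, x) := hF.comp (contDiff_prodMk_right t)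
  have hd : ∀ x, fderiv ℝ (fun x => horizPrimitive ψ (t, x)) x (EuclideanSpace.single 0 1) =
      ψ (t, x) := fun x => by
    have := (hF.differentiable one_ne_zero (t, x)).hasFDerivAt.comp x
      (hasFDerivAt_prodMk_right (𝕜 := ℝ) t x)
    rw [HasFDerivAt.fderiv (f := fun x => horizPrimitive ψ (t, x)) this,
      ContinuousLinearMap.comp_apply, ContinuousLinearMap.inr_apply,
      fderiv_horizPrimitive_horiz hψ]
  have := green h hG (EuclideanSpace.single 0 1)
  simp_rw [hd] at this
  rw [this, ← intervalIntegral.integral_neg]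
  refine intervalIntegral.integral_congr fun s _ => ?_
  simp [inner_plane]

/-- The transport identity for a globally defined evolving curve `w`. -/
lemma integral_transport {φ : ℝ × Plane → ℝ} (hφ : ContDiff ℝ 1 φ) {w : ℝ × ℝ → Plane}
    (hw : ContDiff ℝ 1 w) (hwp : ∀ t s, w (t, s + 1) = w (t, s)) {a b T : ℝ} (ha : 0 < a)
    (hb : b < T) (hφ0 : ∀ t ∉ Icc a b, ∀ x, φ (t, x) = 0) :
    ∫ t in (0 : ℝ)..T, ∫ s in (0 : ℝ)..1,
        horizPrimitive (fun q => fderiv ℝ φ q (1, 0)) (t, w (t, s)) *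
          fderiv ℝ w (t, s) (0, 1) 1 =
      ∫ t in (0 : ℝ)..T, ∫ s in (0 : ℝ)..1, φ (t, w (t, s)) *
        inner ℝ (fderiv ℝ w (t, s) (1, 0)) (perp (fderiv ℝ w (t, s) (0, 1))) := by
  have hF := contDiff_horizPrimitive hφ
  have hlift : ContDiff ℝ 1 fun p : ℝ × ℝ => (p.1, w p) := contDiff_fst.prodMk hw
  -- the difference of the two sides is the integral of the Jacobian of `f` and `g`
  set f : ℝ × ℝ → ℝ := fun p => horizPrimitive φ (p.1, w p) with hf
  set g : ℝ × ℝ → ℝ := fun p => w p 1 with hg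
  have hfC : ContDiff ℝ 1 f := hF.comp hlift
  have hgC : ContDiff ℝ 1 g := (EuclideanSpace.proj (1 : Fin 2) : Plane →L[ℝ] ℝ).contDiff.comp hw
  have hfd : ∀ p v, fderiv ℝ f p v = fderiv ℝ (horizPrimitive φ) (p.1, w p) (v.1, fderiv ℝ w p v) :=
    fun p v => by
    have := (hF.differentiable one_ne_zero (p.1, w p)).hasFDerivAt.comp p
      (hasFDerivAt_fst.prodMk (hw.differentiable one_ne_zero p).hasFDerivAt)
    rw [HasFDerivAt.fderiv (f := f) this]
    rfl
  have hgd : ∀ p v, fderiv ℝ g p v = fderiv ℝ w p v 1 := fun p v => by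
    have := (EuclideanSpace.proj (1 : Fin 2) : Plane →L[ℝ] ℝ).hasFDerivAt.comp p
      (hw.differentiable one_ne_zero p).hasFDerivAt
    rw [HasFDerivAt.fderiv (f := g) this]
    rfl
  -- the derivative of the primitive, split along the time, horizontal and vertical directions
  have hsplit : ∀ (q : ℝ × Plane) (c : ℝ) (v : Plane), fderiv ℝ (horizPrimitive φ) q (c, v) =
      c * horizPrimitive (fun q => fderiv ℝ φ q (1, 0)) q + v 0 * φ q +
        v 1 * fderiv ℝ (horizPrimitive φ) q (0, EuclideanSpace.single 1 1) := fun q c v => by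
    have : ((c, v) : ℝ × Plane) = c • ((1 : ℝ), (0 : Plane)) +
        v 0 • ((0 : ℝ), (EuclideanSpace.single 0 1 : Plane)) +
        v 1 • ((0 : ℝ), (EuclideanSpace.single 1 1 : Plane)) := by
      refine Prod.ext (by simp) ?_
      ext i; fin_cases i <;> simp
    rw [this, map_add, map_add, map_smul, map_smul, map_smul, fderiv_horizPrimitive_time hφ,
      fderiv_horizPrimitive_horiz hφ]
    rfl
  have key := integral_jacobian_eq_zero hfC hgC (fun t s => by simp only [hf, hwp])
    (fun t s => by simp only [hg, hwp]) ha hb (fun t ht s => by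
      simp [hf, horizPrimitive, horizScale_apply, hφ0 t ht])
  have cw : ∀ v, Continuous fun p => fderiv ℝ w p v := fun v =>
    (hw.continuous_fderiv one_ne_zero).clm_apply continuous_const
  have cf : ∀ v, Continuous fun p => fderiv ℝ f p v := fun v =>
    (hfC.continuous_fderiv one_ne_zero).clm_apply continuous_const
  have cg : ∀ v, Continuous fun p => fderiv ℝ g p v := fun v =>
    (hgC.continuous_fderiv one_ne_zero).clm_apply continuous_const
  have cφ : Continuous fun p : ℝ × ℝ => φ (p.1, w p) := hφ.continuous.comp hlift.continuous
  have c1 : Continuous fun p => fderiv ℝ f p (1, 0) * fderiv ℝ g p (0, 1) :=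
    (cf (1, 0)).mul (cg (0, 1))
  have c2 : Continuous fun p => fderiv ℝ f p (0, 1) * fderiv ℝ g p (1, 0) :=
    (cf (0, 1)).mul (cg (1, 0))
  have c3 : Continuous fun p : ℝ × ℝ =>
      φ (p.1, w p) * inner ℝ (fderiv ℝ w p (1, 0)) (perp (fderiv ℝ w p (0, 1))) :=
    cφ.mul ((cw (1, 0)).inner (continuous_perp.comp (cw (0, 1))))
  have inner_cont : ∀ {k : ℝ × ℝ → ℝ}, Continuous k →
      Continuous fun t => ∫ s in (0 : ℝ)..1, k (t, s) := fun {k} hk =>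
    intervalIntegral.continuous_parametric_intervalIntegral_of_continuous'
      (f := fun t s => k (t, s)) hk 0 1
  have e : ∀ t, ∫ s in (0 : ℝ)..1, horizPrimitive (fun q => fderiv ℝ φ q (1, 0)) (t, w (t, s)) *
          fderiv ℝ w (t, s) (0, 1) 1 =
      ((∫ s in (0 : ℝ)..1, fderiv ℝ f (t, s) (1, 0) * fderiv ℝ g (t, s) (0, 1)) -
        ∫ s in (0 : ℝ)..1, fderiv ℝ f (t, s) (0, 1) * fderiv ℝ g (t, s) (1, 0)) +
        ∫ s in (0 : ℝ)..1, φ (t, w (t, s)) *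
          inner ℝ (fderiv ℝ w (t, s) (1, 0)) (perp (fderiv ℝ w (t, s) (0, 1))) := by
    intro t
    have ii : ∀ {k : ℝ × ℝ → ℝ}, Continuous k →
        IntervalIntegrable (fun s => k (t, s)) volume 0 1 := fun hk =>
      (hk.comp (Continuous.prodMk_right t)).intervalIntegrable _ _
    rw [← intervalIntegral.integral_sub (ii c1) (ii c2),
      ← intervalIntegral.integral_add ((ii c1).sub (ii c2)) (ii c3)]
    refine intervalIntegral.integral_congr fun s _ => ?_
    simp only [hfd, hgd]
    rw [hsplit _ 1 (fderiv ℝ w (t, s) (1, 0)), hsplit _ 0 (fderiv ℝ w (t, s) (0, 1))]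
    simp only [inner_plane, perp_apply_zero, perp_apply_one]
    ring
  rw [intervalIntegral.integral_congr fun t _ => e t]
  have i1 := (inner_cont c1).intervalIntegrable (μ := volume) 0 T
  have i2 := (inner_cont c2).intervalIntegrable (μ := volume) 0 T
  have i3 := (inner_cont c3).intervalIntegrable (μ := volume) 0 T
  rw [intervalIntegral.integral_add (i1.sub i2) i3, intervalIntegral.integral_sub i1 i2, key,
    sub_self, zero_add]

end primitive

/-! ### Evolving curves on the open time interval -/

section evolving

variable {α T : ℝ} {φ : ℝ × Plane → ℝ} {z : ℝ → ℝ → Plane} {A : ℝ → Set Plane}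

/-- A test function is supported in a compact time window. -/
lemma IsTestFunction.exists_window (hφ : IsTestFunction T φ) :
    ∃ a b, 0 < a ∧ b < T ∧ ∀ t ∉ Icc a b, ∀ x, (t, x) ∉ tsupport φ := by
  have hc : IsCompact (Prod.fst '' tsupport φ) := IsCompact.image hφ.compact continuous_fst
  have hsub : ∀ t ∈ Prod.fst '' tsupport φ, t ∈ Ioo 0 T := by
    rintro _ ⟨p, hp, rfl⟩
    exact (hφ.support hp).1
  obtain ⟨a, ha, ha'⟩ := hc.exists_forall_le' (a := 0) (f := fun t => t) continuousOn_id
    fun t ht => (hsub t ht).1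
  obtain ⟨b, hb, hb'⟩ := hc.exists_forall_le' (a := 0) (f := fun t => T - t) (by fun_prop)
    fun t ht => sub_pos.2 (hsub t ht).2
  refine ⟨a, T - b, ha, by linarith, fun t ht x hx => ht ⟨?_, ?_⟩⟩
  · exact ha' t ⟨(t, x), hx, rfl⟩
  · linarith [hb' t ⟨(t, x), hx, rfl⟩]

lemma isOpen_slab : IsOpen (Ioo 0 T ×ˢ (univ : Set ℝ)) := isOpen_Ioo.prod isOpen_univ

lemma hasFDerivAt_curve (hz : ContDiffOn ℝ 1 (fun p : ℝ × ℝ => z p.1 p.2) (Ioo 0 T ×ˢ univ))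
    {t : ℝ} (ht : t ∈ Ioo 0 T) (s : ℝ) :
    HasFDerivAt (fun p : ℝ × ℝ => z p.1 p.2) (fderiv ℝ (fun p : ℝ × ℝ => z p.1 p.2) (t, s))
      (t, s) :=
  ((hz.contDiffAt (isOpen_slab.mem_nhds ⟨ht, mem_univ s⟩)).differentiableAt
    one_ne_zero).hasFDerivAt

lemma deriv_curve_space (hz : ContDiffOn ℝ 1 (fun p : ℝ × ℝ => z p.1 p.2) (Ioo 0 T ×ˢ univ))
    {t : ℝ} (ht : t ∈ Ioo 0 T) (s : ℝ) :
    deriv (z t) s = fderiv ℝ (fun p : ℝ × ℝ => z p.1 p.2) (t, s) (0, 1) :=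
  (HasFDerivAt.comp_hasDerivAt (f := fun s => (t, s)) s (hasFDerivAt_curve hz ht s)
    ((hasDerivAt_const s t).prodMk (hasDerivAt_id s))).deriv

lemma deriv_curve_time (hz : ContDiffOn ℝ 1 (fun p : ℝ × ℝ => z p.1 p.2) (Ioo 0 T ×ˢ univ))
    {t : ℝ} (ht : t ∈ Ioo 0 T) (s : ℝ) :
    deriv (fun τ => z τ s) t = fderiv ℝ (fun p : ℝ × ℝ => z p.1 p.2) (t, s) (1, 0) :=
  (HasFDerivAt.comp_hasDerivAt (f := fun t => (t, s)) t (hasFDerivAt_curve hz ht s)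
    ((hasDerivAt_id t).prodMk (hasDerivAt_const t s))).deriv

lemma continuousOn_deriv_space
    (hz : ContDiffOn ℝ 1 (fun p : ℝ × ℝ => z p.1 p.2) (Ioo 0 T ×ˢ univ)) :
    ContinuousOn (fun p : ℝ × ℝ => deriv (z p.1) p.2) (Ioo 0 T ×ˢ univ) :=
  ((hz.continuousOn_fderiv_of_isOpen isOpen_slab le_rfl).clm_apply
    continuousOn_const).congr fun p hp => deriv_curve_space hz hp.1 p.2

lemma continuousOn_deriv_time
    (hz : ContDiffOn ℝ 1 (fun p : ℝ × ℝ => z p.1 p.2) (Ioo 0 T ×ˢ univ)) :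
    ContinuousOn (fun p : ℝ × ℝ => deriv (fun τ => z τ p.2) p.1) (Ioo 0 T ×ˢ univ) :=
  ((hz.continuousOn_fderiv_of_isOpen isOpen_slab le_rfl).clm_apply
    continuousOn_const).congr fun p hp => deriv_curve_time hz hp.1 p.2

/-- An evolving curve agrees on a compact time window with one which is defined for all times. -/
lemma exists_global_curve
    (hz : ContDiffOn ℝ 1 (fun p : ℝ × ℝ => z p.1 p.2) (Ioo 0 T ×ˢ univ))
    (hp : ∀ t ∈ Ioo 0 T, Function.Periodic (z t) 1) {a b : ℝ} (ha : 0 < a) (hb : b < T) :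
    ∃ w : ℝ × ℝ → Plane, ContDiff ℝ 1 w ∧ (∀ t s, w (t, s + 1) = w (t, s)) ∧
      ∀ t ∈ Icc a b, ∀ᶠ τ in 𝓝 t, ∀ s, w (τ, s) = z τ s := by
  obtain ⟨χ, hχ1, hχ0, -⟩ := exists_contMDiffMap_one_nhds_of_subset_interior (n := 1)
    (modelWithCornersSelf ℝ ℝ) (isClosed_Icc (a := a) (b := b))
    (t := Icc (a / 2) ((b + T) / 2)) (by
      rw [interior_Icc]
      exact fun t ht => ⟨by linarith [ht.1], by linarith [ht.2]⟩)
  have hχ : ContDiff ℝ 1 χ := contMDiff_iff_contDiff.1 χ.contMDiff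
  have hmem : ∀ t, t ∉ Ioo 0 T → t ∉ Icc (a / 2) ((b + T) / 2) := fun t ht h =>
    ht ⟨by linarith [h.1], by linarith [h.2]⟩
  refine ⟨fun p => χ p.1 • z p.1 p.2, ?_, fun t s => ?_, fun t ht => ?_⟩
  · rw [contDiff_iff_contDiffAt]
    rintro ⟨t, s⟩
    by_cases ht : t ∈ Ioo 0 T
    · exact (hχ.contDiffAt.comp (t, s) contDiffAt_fst).smul
        (hz.contDiffAt (isOpen_slab.mem_nhds ⟨ht, mem_univ s⟩))
    · refine (contDiffAt_const (c := (0 : Plane))).congr_of_eventuallyEq ?_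
      have : ∀ᶠ p : ℝ × ℝ in 𝓝 (t, s), p.1 ∉ Icc (a / 2) ((b + T) / 2) := by
        have hn : (Icc (a / 2) ((b + T) / 2))ᶜ ∈ 𝓝 ((t, s) : ℝ × ℝ).1 :=
          isClosed_Icc.isOpen_compl.mem_nhds (hmem t ht)
        exact continuousAt_fst hn
      filter_upwards [this] with p hp
      rw [hχ0 p.1 hp, zero_smul]
  · by_cases ht : t ∈ Ioo 0 T
    · simp only [hp t ht s]
    · simp only [hχ0 t (hmem t ht), zero_smul]
  · filter_upwards [eventually_nhdsSet_iff_forall.1 hχ1 t ht] with τ hτ s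
    rw [hτ, one_smul]

/-- A function which is continuous over the open time interval and vanishes outside a compact time
window is integrable over one period. -/
lemma integrableOn_of_window {k : ℝ × ℝ → ℝ} (hk : ContinuousOn k (Ioo 0 T ×ˢ univ)) {a b : ℝ}
    (ha : 0 < a) (hb : b < T) (h0 : ∀ t ∉ Icc a b, ∀ s, k (t, s) = 0) :
    IntegrableOn k (Ioo 0 T ×ˢ Ioc 0 1) := by
  have hsub : Icc a b ⊆ Ioo 0 T := fun t ht => ⟨ha.trans_le ht.1, ht.2.trans_lt hb⟩
  have h1 : IntegrableOn k (Icc a b ×ˢ Icc 0 1) :=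
    (hk.mono (prod_mono hsub (subset_univ _))).integrableOn_compact
      (isCompact_Icc.prod isCompact_Icc)
  refine (h1.mono_set (prod_mono_right Ioc_subset_Icc_self)).of_forall_sdiff_eq_zero
    (measurableSet_Ioo.prod measurableSet_Ioc) ?_
  rintro ⟨t, s⟩ ⟨⟨-, hs⟩, hn⟩
  exact h0 t (fun ht => hn ⟨ht, hs⟩) s

/-- The rate of change of `∫_{A(t)} φ` is carried by the normal velocity of the curve:
`∫∫_{A(t)} ∂ₜφ = ∫∮ φ ∂ₜz·N`. -/
lemma integral_region_time_deriv (hφ : IsTestFunction T φ)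
    (hz : ContDiffOn ℝ 1 (fun p : ℝ × ℝ => z p.1 p.2) (Ioo 0 T ×ˢ univ))
    (hA : ∀ t ∈ Ioo 0 T, IsBoundaryCurve (z t) (A t)) (hT : 0 < T) :
    IntegrableOn (fun t => ∫ x in A t, fderiv ℝ φ (t, x) (1, 0)) (Ioo 0 T) ∧
    ∫ t in Ioo 0 T, ∫ x in A t, fderiv ℝ φ (t, x) (1, 0) =
      ∫ t in Ioo 0 T, ∫ s in (0 : ℝ)..1, φ (t, z t s) *
        inner ℝ (deriv (fun τ => z τ s) t) (perp (deriv (z t) s)) := by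
  obtain ⟨a, b, ha, hb, hab⟩ := hφ.exists_window
  obtain ⟨w, hw, hwp, hwz⟩ := exists_global_curve hz (fun t ht => (hA t ht).periodic) ha hb
  have hφ1 : ContDiff ℝ 1 φ := hφ.smooth.of_le (by simp)
  have hψ : ContDiff ℝ 1 fun q => fderiv ℝ φ q (1, 0) :=
    ((contDiff_infty_iff_fderiv.1 hφ.smooth).2.of_le (by simp)).clm_apply contDiff_const
  have hφ0 : ∀ t ∉ Icc a b, ∀ x, φ (t, x) = 0 := fun t ht x =>
    image_eq_zero_of_notMem_tsupport (hab t ht x)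
  have hψ0 : ∀ t ∉ Icc a b, ∀ x, fderiv ℝ φ (t, x) (1, 0) = 0 := fun t ht x => by
    have : fderiv ℝ φ (t, x) = 0 := by
      by_contra h
      exact hab t ht x (support_fderiv_subset ℝ h)
    rw [this]; rfl
  have hws : ∀ t ∈ Icc a b, ∀ s, fderiv ℝ w (t, s) (0, 1) = deriv (z t) s := by
    intro t ht s
    have : HasDerivAt (fun s => w (t, s)) (fderiv ℝ w (t, s) (0, 1)) s :=
      HasFDerivAt.comp_hasDerivAt (f := fun s => (t, s)) s
        (hw.differentiable one_ne_zero (t, s)).hasFDerivAt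
        ((hasDerivAt_const s t).prodMk (hasDerivAt_id s))
    rw [← this.deriv]
    congr 1
    exact funext (hwz t ht).self_of_nhds
  have hwt : ∀ t ∈ Icc a b, ∀ s, fderiv ℝ w (t, s) (1, 0) = deriv (fun τ => z τ s) t := by
    intro t ht s
    have : HasDerivAt (fun t => w (t, s)) (fderiv ℝ w (t, s) (1, 0)) t :=
      HasFDerivAt.comp_hasDerivAt (f := fun t => (t, s)) t
        (hw.differentiable one_ne_zero (t, s)).hasFDerivAt
        ((hasDerivAt_id t).prodMk (hasDerivAt_const t s))
    rw [← this.deriv]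
    exact Filter.EventuallyEq.deriv_eq ((hwz t ht).mono fun τ h => h s)
  have e1 : ∀ t ∈ Ioo 0 T, ∫ x in A t, fderiv ℝ φ (t, x) (1, 0) =
      ∫ s in (0 : ℝ)..1, horizPrimitive (fun q => fderiv ℝ φ q (1, 0)) (t, w (t, s)) *
          fderiv ℝ w (t, s) (0, 1) 1 := by
    intro t ht
    by_cases htI : t ∈ Icc a b
    · rw [setIntegral_eq_boundary_integral (ψ := fun q => fderiv ℝ φ q (1, 0)) (hA t ht) hψ t]
      refine intervalIntegral.integral_congr fun s _ => ?_
      simp only [hws t htI, (hwz t htI).self_of_nhds s]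
    · simp [horizPrimitive, horizScale_apply, hψ0 t htI]
  have e2 : ∀ t ∈ Ioo 0 T, ∫ s in (0 : ℝ)..1, φ (t, z t s) *
        inner ℝ (deriv (fun τ => z τ s) t) (perp (deriv (z t) s)) =
      ∫ s in (0 : ℝ)..1, φ (t, w (t, s)) *
        inner ℝ (fderiv ℝ w (t, s) (1, 0)) (perp (fderiv ℝ w (t, s) (0, 1))) := by
    intro t ht
    by_cases htI : t ∈ Icc a b
    · simp only [hws t htI, hwt t htI, (hwz t htI).self_of_nhds]
    · simp [hφ0 t htI]
  have cont : Continuous fun t => ∫ s in (0 : ℝ)..1,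
      horizPrimitive (fun q => fderiv ℝ φ q (1, 0)) (t, w (t, s)) * fderiv ℝ w (t, s) (0, 1) 1 := by
    refine intervalIntegral.continuous_parametric_intervalIntegral_of_continuous'
      (f := fun t s => horizPrimitive (fun q => fderiv ℝ φ q (1, 0)) (t, w (t, s)) *
        fderiv ℝ w (t, s) (0, 1) 1) ?_ 0 1
    have h1 : Continuous fun p : ℝ × ℝ => fderiv ℝ w p (0, 1) 1 :=
      (EuclideanSpace.proj (1 : Fin 2) : Plane →L[ℝ] ℝ).continuous.comp
        ((hw.continuous_fderiv one_ne_zero).clm_apply continuous_const)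
    exact ((contDiff_horizPrimitive hψ).continuous.comp
      (continuous_fst.prodMk hw.continuous)).mul h1
  constructor
  · refine ((cont.continuousOn.integrableOn_compact (isCompact_Icc (a := 0) (b := T))).mono_set
      Ioo_subset_Icc_self).congr_fun (fun t ht => (e1 t ht).symm) measurableSet_Ioo
  · rw [setIntegral_congr_fun measurableSet_Ioo e1, setIntegral_congr_fun measurableSet_Ioo e2,
      ← integral_Ioc_eq_integral_Ioo, ← integral_Ioc_eq_integral_Ioo,
      ← intervalIntegral.integral_of_le hT.le, ← intervalIntegral.integral_of_le hT.le]
    exact integral_transport hφ1 hw hwp ha hb hφ0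

/-- The sharp-front integral depends continuously on time and on the parameter. -/
lemma continuousOn_frontIntegral (hα₀ : 0 < α) (hα₁ : α < 1)
    (hz : ContDiffOn ℝ 1 (fun p : ℝ × ℝ => z p.1 p.2) (Ioo 0 T ×ˢ univ))
    (hz2 : ContinuousOn (fun p : ℝ × ℝ => deriv (deriv (z p.1)) p.2) (Ioo 0 T ×ˢ univ))
    (hA : ∀ t ∈ Ioo 0 T, IsBoundaryCurve (z t) (A t)) :
    ContinuousOn (fun p : ℝ × ℝ => frontIntegral α (z p.1) p.2) (Ioo 0 T ×ˢ univ) := by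
  rintro ⟨t₀, s₀⟩ ⟨ht₀, -⟩
  have hz0 := hz.continuousOn
  have hz1 := continuousOn_deriv_space hz
  set K := Icc (t₀ / 2) ((t₀ + T) / 2) with hK
  have hKsub : K ⊆ Ioo 0 T := fun t ht => ⟨by linarith [ht.1, ht₀.1], by linarith [ht.2, ht₀.2]⟩
  have hKn : K ∈ 𝓝 t₀ := Icc_mem_nhds (by linarith [ht₀.1]) (by linarith [ht₀.2])
  have hKu : K ×ˢ univ ⊆ Ioo 0 T ×ˢ (univ : Set ℝ) := prod_mono_left hKsub
  obtain ⟨c, M, hc, hM, H⟩ := exists_chord_arc (isCompact_Icc : IsCompact K)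
    (fun t ht => hA t (hKsub ht)) (hz0.mono hKu) (hz1.mono hKu) (hz2.mono hKu)
  have hnear : ∀ᶠ p : ℝ × ℝ in 𝓝 (t₀, s₀), p.1 ∈ K := continuousAt_fst.eventually hKn
  have hrep : ∀ p : ℝ × ℝ, p.1 ∈ Ioo 0 T → frontIntegral α (z p.1) p.2 =
      ∫ d in (-(1 / 2) : ℝ)..(1 / 2), frontIntegrand α (z p.1) p.2 (p.2 + d) := fun p hp => by
    rw [frontIntegral, ← intervalIntegral.integral_of_le zero_le_one,
      integral_period_eq_shift (frontIntegrand_periodic (hA p.1 hp) p.2) p.2]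
  refine ContinuousAt.continuousWithinAt ?_
  refine ContinuousAt.congr (f := fun p : ℝ × ℝ => ∫ d in (-(1 / 2) : ℝ)..(1 / 2),
    frontIntegrand α (z p.1) p.2 (p.2 + d)) ?_
    (hnear.mono fun p hp => (hrep p (hKsub hp)).symm)
  refine intervalIntegral.continuousAt_of_dominated_interval
    (bound := fun d => c ^ (-1 - α) * M * |d| ^ (-α)) ?_ ?_
    (intervalIntegrable_abs_rpow hα₁ _ _ _) ?_
  · filter_upwards [hnear] with p hp
    exact ((measurable_frontIntegrand (hA p.1 (hKsub hp)) p.2).comp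
      (measurable_const_add p.2)).aestronglyMeasurable
  · filter_upwards [hnear] with p hp
    refine .of_forall fun d hd => ?_
    rw [uIoc_of_le (by norm_num)] at hd
    obtain ⟨-, -, b3, -, b5⟩ := H p.1 hp
    have b := b3 p.2 (p.2 + d)
    rw [add_sub_cancel_left] at b
    exact norm_frontIntegrand_le hα₀ hc hM (b5 p.2 d (abs_le.2 ⟨hd.1.le, hd.2⟩)) b
  · have hae : ∀ᵐ d : ℝ, d ≠ 0 := by simp [ae_iff, measure_singleton]
    filter_upwards [hae] with d hd0 hd
    rw [uIoc_of_le (by norm_num)] at hd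
    have hv := (H t₀ (mem_of_mem_nhds hKn)).2.2.2.2 s₀ d (abs_le.2 ⟨hd.1.le, hd.2⟩)
    have hne : ‖z t₀ s₀ - z t₀ (s₀ + d)‖ ≠ 0 := by
      rw [norm_sub_rev]
      exact (lt_of_lt_of_le (mul_pos hc (abs_pos.2 hd0)) hv).ne'
    have hat : ∀ {E : Type} [TopologicalSpace E] {f : ℝ × ℝ → E},
        ContinuousOn f (Ioo 0 T ×ˢ univ) → ∀ s, ContinuousAt f (t₀, s) := fun hf s =>
      hf.continuousAt (isOpen_slab.mem_nhds ⟨ht₀, mem_univ s⟩)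
    have hsh : ContinuousAt (fun p : ℝ × ℝ => (p.1, p.2 + d)) (t₀, s₀) := by fun_prop
    have k1 : ContinuousAt (fun p : ℝ × ℝ => z p.1 p.2) (t₀, s₀) := hat hz0 s₀
    have k2 : ContinuousAt (fun p : ℝ × ℝ => z p.1 (p.2 + d)) (t₀, s₀) :=
      ContinuousAt.comp (f := fun p : ℝ × ℝ => (p.1, p.2 + d)) (x := (t₀, s₀))
        (g := fun p : ℝ × ℝ => z p.1 p.2) (hat hz0 (s₀ + d)) hsh
    have k3 : ContinuousAt (fun p : ℝ × ℝ => deriv (z p.1) p.2) (t₀, s₀) := hat hz1 s₀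
    have k4 : ContinuousAt (fun p : ℝ × ℝ => deriv (z p.1) (p.2 + d)) (t₀, s₀) :=
      ContinuousAt.comp (f := fun p : ℝ × ℝ => (p.1, p.2 + d)) (x := (t₀, s₀))
        (g := fun p : ℝ × ℝ => deriv (z p.1) p.2) (hat hz1 (s₀ + d)) hsh
    exact ((k1.sub k2).norm.rpow_const (Or.inl hne)).smul (k4.sub k3)

end evolving

/-! ### Test functions at a fixed time -/

section slices

variable {T : ℝ} {φ : ℝ × Plane → ℝ}

lemma IsTestFunction.slice_contDiff (hφ : IsTestFunction T φ) (t : ℝ) :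
    ContDiff ℝ 1 fun x => φ (t, x) :=
  (hφ.smooth.of_le (by simp)).comp (contDiff_prodMk_right t)

lemma IsTestFunction.slice_compact (hφ : IsTestFunction T φ) (t : ℝ) :
    HasCompactSupport fun x => φ (t, x) :=
  HasCompactSupport.intro (IsCompact.image hφ.compact continuous_snd) fun x hx =>
    image_eq_zero_of_notMem_tsupport fun h => hx ⟨(t, x), h, rfl⟩

lemma IsTestFunction.contDiff_fderiv (hφ : IsTestFunction T φ) : ContDiff ℝ 1 (fderiv ℝ φ) :=
  (contDiff_infty_iff_fderiv.1 hφ.smooth).2.of_le (by simp)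

lemma IsTestFunction.gradient_slice (hφ : IsTestFunction T φ) (t : ℝ) (x : Plane) :
    ∇ (fun y => φ (t, y)) x = (InnerProductSpace.toDual ℝ Plane).symm
      ((fderiv ℝ φ (t, x)).comp (ContinuousLinearMap.inr ℝ ℝ Plane)) := by
  have := (hφ.smooth.differentiable (by simp) (t, x)).hasFDerivAt.comp x
    (hasFDerivAt_prodMk_right (𝕜 := ℝ) t x)
  rw [gradient, HasFDerivAt.fderiv (f := fun y => φ (t, y)) this]

lemma IsTestFunction.deriv_slice (hφ : IsTestFunction T φ) (t : ℝ) (x : Plane) :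
    deriv (fun τ => φ (τ, x)) t = fderiv ℝ φ (t, x) (1, 0) :=
  (HasFDerivAt.comp_hasDerivAt (f := fun t => (t, x)) t
    (hφ.smooth.differentiable (by simp) (t, x)).hasFDerivAt
    ((hasDerivAt_id t).prodMk (hasDerivAt_const t x))).deriv

/-- Bounds for the derivatives of a test function which are uniform in time. -/
lemma IsTestFunction.exists_bounds (hφ : IsTestFunction T φ) :
    ∃ B c D : ℝ, 0 ≤ D ∧ (∀ t x, ‖∇ (fun y => φ (t, y)) x‖ ≤ B) ∧
      (∀ t x y, ‖∇ (fun y => φ (t, y)) x - ∇ (fun y => φ (t, y)) y‖ ≤ c * min ‖x - y‖ 1) ∧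
      ∀ t x, |fderiv ℝ φ (t, x) (1, 0)| ≤ D := by
  have hc := hφ.compact.fderiv ℝ
  have hd := hφ.contDiff_fderiv
  obtain ⟨B, hB⟩ := hc.exists_bound_of_continuous hd.continuous
  obtain ⟨L, hL⟩ := hd.lipschitzWith_of_hasCompactSupport hc one_ne_zero
  have hB0 : 0 ≤ B := (norm_nonneg _).trans (hB 0)
  have hcomp : ∀ F : ℝ × Plane →L[ℝ] ℝ,
      ‖F.comp (ContinuousLinearMap.inr ℝ ℝ Plane)‖ ≤ ‖F‖ := fun F =>
    (ContinuousLinearMap.opNorm_comp_le _ _).trans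
      (mul_le_of_le_one_right (norm_nonneg _) (ContinuousLinearMap.norm_inr_le_one ℝ ℝ Plane))
  refine ⟨B, max L (B + B), B, hB0, fun t x => ?_, fun t x y => ?_, fun t x => ?_⟩
  · rw [hφ.gradient_slice, LinearIsometryEquiv.norm_map]
    exact (hcomp _).trans (hB _)
  · rw [hφ.gradient_slice, hφ.gradient_slice, ← map_sub, LinearIsometryEquiv.norm_map,
      ← ContinuousLinearMap.sub_comp]
    refine (hcomp _).trans ?_
    have hk : (0 : ℝ) ≤ max (L : ℝ) (B + B) := le_max_of_le_left L.coe_nonneg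
    rw [mul_min_of_nonneg _ _ hk, mul_one]
    refine le_min ?_ ?_
    · have h1 := hL.norm_sub_le (t, x) (t, y)
      have h2 : ‖((t, x) : ℝ × Plane) - (t, y)‖ = ‖x - y‖ := by simp [Prod.norm_def]
      rw [h2] at h1
      exact h1.trans (mul_le_mul_of_nonneg_right (le_max_left _ _) (norm_nonneg _))
    · exact ((norm_sub_le _ _).trans (add_le_add (hB _) (hB _))).trans (le_max_right _ _)
  · rw [← Real.norm_eq_abs]
    refine (ContinuousLinearMap.le_opNorm _ _).trans ?_
    have : ‖((1 : ℝ), (0 : Plane))‖ = 1 := by simp [Prod.norm_def]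
    rw [this, mul_one]
    exact hB _

end slices

/-! ### Comparison of the scalar with the indicator of the region -/

section compare

variable {α : ℝ} {f : Plane → ℝ} {z : ℝ → Plane} {A : Set Plane} {r M : ℝ}

lemma isBounded_midRegion (h : IsBoundaryCurve z A) (r : ℝ) :
    Bornology.IsBounded (midRegion A r) := by
  have hb : Bornology.IsBounded (frontier A) :=
    h.isBounded.closure.subset frontier_subset_closure
  have hne : (frontier A).Nonempty := h.frontier_eq ▸ range_nonempty z
  refine (hb.thickening (δ := r + 1)).subset fun x hx => ?_
  have : Metric.infDist x (frontier A) < r + 1 := lt_of_le_of_lt hx (lt_add_one r)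
  exact Metric.mem_thickening_iff.2 ((Metric.infDist_lt_iff hne).1 this)

lemma isClosed_midRegion (A : Set Plane) (r : ℝ) : IsClosed (midRegion A r) :=
  isClosed_le (Metric.continuous_infDist_pt _) continuous_const

lemma eq_indicator_of_notMem_midRegion (hin : ∀ x ∈ innerRegion A r, f x = 1)
    (hout : ∀ x ∈ outerRegion A r, f x = 0) {x : Plane} (hx : x ∉ midRegion A r) :
    f x = A.indicator 1 x := by
  by_cases hA : x ∈ A
  · rw [indicator_of_mem hA]
    exact hin x ⟨hA, not_le.1 hx⟩
  · rw [indicator_of_notMem hA]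
    exact hout x fun h => h.elim (fun h => hA h.1) hx

lemma hasCompactSupport_of_regions (h : IsBoundaryCurve z A)
    (hin : ∀ x ∈ innerRegion A r, f x = 1) (hout : ∀ x ∈ outerRegion A r, f x = 0) :
    HasCompactSupport f := by
  refine HasCompactSupport.intro
    ((h.isBounded.union (isBounded_midRegion h r)).isCompact_closure) fun x hx => ?_
  have hx' : x ∉ A ∪ midRegion A r := fun h => hx (subset_closure h)
  rw [eq_indicator_of_notMem_midRegion hin hout fun h => hx' (Or.inr h),
    indicator_of_notMem fun h => hx' (Or.inl h)]

lemma integrable_indicator_region (h : IsBoundaryCurve z A) :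
    Integrable (A.indicator (1 : Plane → ℝ)) := by
  rw [integrable_indicator_iff h.isOpen.measurableSet]
  exact (continuous_const.continuousOn.integrableOn_compact
    h.isBounded.isCompact_closure).mono_set subset_closure

lemma abs_indicator_one_le (A : Set Plane) (x : Plane) : |A.indicator (1 : Plane → ℝ) x| ≤ 1 := by
  by_cases hx : x ∈ A <;> simp [hx]

/-- The scalar differs from the indicator only in the transition region. -/
lemma integral_abs_sub_indicator_le (h : IsBoundaryCurve z A) (hf : Continuous f)
    (hM : ∀ x, |f x| ≤ M) (hin : ∀ x ∈ innerRegion A r, f x = 1)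
    (hout : ∀ x ∈ outerRegion A r, f x = 0) {V : ℝ} (hV : 0 ≤ V)
    (hvol : volume (midRegion A r) ≤ ENNReal.ofReal V) :
    ∫ x, |f x - A.indicator 1 x| ≤ (M + 1) * V := by
  have hfi : Integrable f :=
    hf.integrable_of_hasCompactSupport (hasCompactSupport_of_regions h hin hout)
  have hms : MeasurableSet (midRegion A r) := (isClosed_midRegion A r).measurableSet
  have hfin : volume (midRegion A r) ≠ ⊤ := (hvol.trans_lt ENNReal.ofReal_lt_top).ne
  have hM0 : 0 ≤ M := (abs_nonneg _).trans (hM 0)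
  calc ∫ x, |f x - A.indicator 1 x| ≤ ∫ x, (midRegion A r).indicator (fun _ => M + 1) x := by
        refine integral_mono (hfi.sub (integrable_indicator_region h)).abs
          ((integrable_indicator_iff hms).2 (integrableOn_const hfin)) fun x => ?_
        by_cases hx : x ∈ midRegion A r
        · simp only [indicator_of_mem hx]
          exact (abs_sub _ _).trans (add_le_add (hM x) (abs_indicator_one_le A x))
        · simp only [indicator_of_notMem hx, eq_indicator_of_notMem_midRegion hin hout hx,
            sub_self, abs_zero, le_refl]
    _ = volume.real (midRegion A r) * (M + 1) := by
        rw [integral_indicator hms, setIntegral_const, smul_eq_mul]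
    _ ≤ V * (M + 1) := mul_le_mul_of_nonneg_right (ENNReal.toReal_le_of_le_ofReal hV hvol)
        (by linarith)
    _ = (M + 1) * V := mul_comm _ _

/-- At a fixed time, the two terms of the weak formulation for the scalar are compared with those
for the indicator of the region. -/
lemma abs_weak_terms_sub_le (hα₀ : 0 < α) (hα₁ : α < 1) (h : IsBoundaryCurve z A)
    (hf : ContDiff ℝ 1 f) (hfc : HasCompactSupport f) (hM : ∀ x, |f x| ≤ M) {Φ ψ : Plane → ℝ}
    (hΦ : ContDiff ℝ 1 Φ) (hΦc : HasCompactSupport Φ) (hψ : Continuous ψ) {B c D : ℝ}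
    (hB : ∀ x, ‖∇ Φ x‖ ≤ B) (hc : ∀ x y, ‖∇ Φ x - ∇ Φ y‖ ≤ c * min ‖x - y‖ 1)
    (hD : ∀ x, |ψ x| ≤ D) :
    |(∫ x in A, ψ x) + (∫ s in (0 : ℝ)..1, Φ (z s) *
        inner ℝ (frontIntegral α z s) (perp (deriv z s))) -
      ((∫ x, f x * ψ x) + ∫ x, f x * inner ℝ (velocity α f x) (∇ Φ x))| ≤
      (D + (1 + α) * c * (M + 1) * ∫ v, majorant α v) * ∫ x, |f x - A.indicator 1 x| := by
  have hM0 : 0 ≤ M := (abs_nonneg _).trans (hM 0)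
  have hfi : Integrable f := hf.continuous.integrable_of_hasCompactSupport hfc
  have hAi := integrable_indicator_region h
  have h1 : |(∫ x, f x * ψ x) - ∫ x in A, ψ x| ≤ D * ∫ x, |f x - A.indicator 1 x| := by
    have hi1 : Integrable fun x => f x * ψ x :=
      hfi.mul_bdd hψ.aestronglyMeasurable (.of_forall hD)
    have hi2 : Integrable fun x => A.indicator 1 x * ψ x :=
      hAi.mul_bdd hψ.aestronglyMeasurable (.of_forall hD)
    have e : ∫ x in A, ψ x = ∫ x, A.indicator 1 x * ψ x := by
      rw [← integral_indicator h.isOpen.measurableSet]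
      congr 1
      ext x
      by_cases hx : x ∈ A <;> simp [hx]
    rw [e, ← integral_sub hi1 hi2, ← integral_const_mul]
    refine abs_integral_le_integral_abs.trans
      (integral_mono (hi1.sub hi2).abs ((hfi.sub hAi).abs.const_mul D) fun x => ?_)
    simp only [← sub_mul, abs_mul]
    rw [mul_comm]
    exact mul_le_mul_of_nonneg_right (hD x) (abs_nonneg _)
  have h2 : |(∫ x, f x * inner ℝ (velocity α f x) (∇ Φ x)) - ∫ s in (0 : ℝ)..1, Φ (z s) *
        inner ℝ (frontIntegral α z s) (perp (deriv z s))| ≤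
      (1 + α) * c * (M + 1) * (∫ v, majorant α v) * ∫ x, |f x - A.indicator 1 x| := by
    refine le_of_tendsto ((tendsto_regInteraction_smooth hα₀ hα₁ hf hfc hΦ hΦc).sub
      (tendsto_regInteraction_indicator hα₀ hα₁ h hΦ hB)).abs ?_
    filter_upwards [self_mem_nhdsWithin] with ε hε
    exact abs_regInteraction_sub_le hα₀ hα₁ hε (continuous_gradient hΦ) hB hc hfi hAi
      (fun x => (hM x).trans (by linarith)) fun x => (abs_indicator_one_le A x).trans (by linarith)
  rw [add_mul]
  rw [abs_le] at h1 h2 ⊢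
  constructor <;> linarith [h1.1, h1.2, h2.1, h2.2]

end compare

/-! ### The error estimate -/

section estimate

variable {α T : ℝ} {φ : ℝ × Plane → ℝ} {z : ℝ → ℝ → Plane} {A : ℝ → Set Plane}

/-- The part of the residual which comes from the motion of the curve and the part which comes
from the sharp-front integral are both continuous. -/
lemma continuousOn_residual_terms (hα₀ : 0 < α) (hα₁ : α < 1) (hφ : IsTestFunction T φ)
    (hz : ContDiffOn ℝ 1 (fun p : ℝ × ℝ => z p.1 p.2) (Ioo 0 T ×ˢ univ))
    (hz2 : ContinuousOn (fun p : ℝ × ℝ => deriv (deriv (z p.1)) p.2) (Ioo 0 T ×ˢ univ))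
    (hA : ∀ t ∈ Ioo 0 T, IsBoundaryCurve (z t) (A t)) :
    ContinuousOn (fun p : ℝ × ℝ => φ (p.1, z p.1 p.2) *
      inner ℝ (deriv (fun τ => z τ p.2) p.1) (perp (deriv (z p.1) p.2))) (Ioo 0 T ×ˢ univ) ∧
    ContinuousOn (fun p : ℝ × ℝ => φ (p.1, z p.1 p.2) *
      inner ℝ (frontIntegral α (z p.1) p.2) (perp (deriv (z p.1) p.2))) (Ioo 0 T ×ˢ univ) := by
  have h1 : ContinuousOn (fun p : ℝ × ℝ => φ (p.1, z p.1 p.2)) (Ioo 0 T ×ˢ univ) :=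
    hφ.smooth.continuous.comp_continuousOn (continuousOn_fst.prodMk hz.continuousOn)
  have h2 : ContinuousOn (fun p : ℝ × ℝ => perp (deriv (z p.1) p.2)) (Ioo 0 T ×ˢ univ) :=
    continuous_perp.comp_continuousOn (continuousOn_deriv_space hz)
  exact ⟨h1.mul ((continuousOn_deriv_time hz).inner h2),
    h1.mul ((continuousOn_frontIntegral hα₀ hα₁ hz hz2 hA).inner h2)⟩

lemma integrableOn_residual_terms (hα₀ : 0 < α) (hα₁ : α < 1) (hφ : IsTestFunction T φ)
    (hz : ContDiffOn ℝ 1 (fun p : ℝ × ℝ => z p.1 p.2) (Ioo 0 T ×ˢ univ))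
    (hz2 : ContinuousOn (fun p : ℝ × ℝ => deriv (deriv (z p.1)) p.2) (Ioo 0 T ×ˢ univ))
    (hA : ∀ t ∈ Ioo 0 T, IsBoundaryCurve (z t) (A t)) :
    IntegrableOn (fun p : ℝ × ℝ => φ (p.1, z p.1 p.2) *
      inner ℝ (deriv (fun τ => z τ p.2) p.1) (perp (deriv (z p.1) p.2)))
      (Ioo 0 T ×ˢ Ioc 0 1) ∧
    IntegrableOn (fun p : ℝ × ℝ => φ (p.1, z p.1 p.2) *
      inner ℝ (frontIntegral α (z p.1) p.2) (perp (deriv (z p.1) p.2))) (Ioo 0 T ×ˢ Ioc 0 1) := by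
  obtain ⟨a, b, ha, hb, hab⟩ := hφ.exists_window
  have hφ0 : ∀ t ∉ Icc a b, ∀ x, φ (t, x) = 0 := fun t ht x =>
    image_eq_zero_of_notMem_tsupport (hab t ht x)
  obtain ⟨h1, h2⟩ := continuousOn_residual_terms hα₀ hα₁ hφ hz hz2 hA
  exact ⟨integrableOn_of_window h1 ha hb fun t ht s => by simp [hφ0 t ht],
    integrableOn_of_window h2 ha hb fun t ht s => by simp [hφ0 t ht]⟩

lemma residual_eq_add (z : ℝ → ℝ → Plane) (p : ℝ × ℝ) :
    φ (p.1, z p.1 p.2) * frontResidual α z p.1 p.2 =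
      φ (p.1, z p.1 p.2) * inner ℝ (deriv (fun τ => z τ p.2) p.1) (perp (deriv (z p.1) p.2)) +
      φ (p.1, z p.1 p.2) * inner ℝ (frontIntegral α (z p.1) p.2) (perp (deriv (z p.1) p.2)) := by
  rw [frontResidual, inner_add_left, mul_add]

/-- The weak formulation, iterated: for almost every time both terms are integrable in space. -/
lemma IsWeakSolution.iterated {θ : ℝ → Plane → ℝ} (hθ : IsWeakSolution α T θ)
    (hφ : IsTestFunction T φ) :
    Integrable (fun t => (∫ x, θ t x * fderiv ℝ φ (t, x) (1, 0)) +
        ∫ x, θ t x * inner ℝ (velocity α (θ t) x) (∇ (fun y => φ (t, y)) x))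
      (volume.restrict (Ioo 0 T)) ∧
    ∫ t in Ioo 0 T, ((∫ x, θ t x * fderiv ℝ φ (t, x) (1, 0)) +
        ∫ x, θ t x * inner ℝ (velocity α (θ t) x) (∇ (fun y => φ (t, y)) x)) = 0 := by
  obtain ⟨B, -, -, -, hB, -, -⟩ := hφ.exists_bounds
  have : IsFiniteMeasureOnCompacts (slabMeasure T) := by unfold slabMeasure; infer_instance
  have hgrad : Continuous fun p : ℝ × Plane => ∇ (fun y => φ (p.1, y)) p.2 := by
    simp_rw [hφ.gradient_slice]
    exact (InnerProductSpace.toDual ℝ Plane).symm.continuous.comp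
      (hφ.contDiff_fderiv.continuous.clm_comp continuous_const)
  have hdt : Continuous fun p : ℝ × Plane => fderiv ℝ φ p (1, 0) :=
    hφ.contDiff_fderiv.continuous.clm_apply continuous_const
  have hdtc : HasCompactSupport fun p : ℝ × Plane => fderiv ℝ φ p (1, 0) :=
    (hφ.compact.fderiv ℝ).comp_left (g := fun L : ℝ × Plane →L[ℝ] ℝ => L (1, 0)) rfl
  have i1 : Integrable (fun p : ℝ × Plane => θ p.1 p.2 * fderiv ℝ φ p (1, 0)) (slabMeasure T) :=
    hθ.memLp.integrable_mul (hdt.memLp_of_hasCompactSupport (p := 2) hdtc)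
  have i2 : Integrable (fun p : ℝ × Plane => θ p.1 p.2 *
      inner ℝ (velocity α (θ p.1) p.2) (∇ (fun y => φ (p.1, y)) p.2)) (slabMeasure T) := by
    have := (hθ.memLp.norm.integrable_mul hθ.velocity_memLp.norm).mul_const B
    refine this.mono' (hθ.memLp.1.mul (hθ.velocity_memLp.1.inner hgrad.aestronglyMeasurable))
      (.of_forall fun p => ?_)
    rw [norm_mul, Pi.mul_apply, mul_assoc]
    refine mul_le_mul_of_nonneg_left ?_ (norm_nonneg _)
    exact (norm_inner_le_norm _ _).trans (mul_le_mul_of_nonneg_left (hB _ _) (norm_nonneg _))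
  have hw := hθ.weak_eq φ hφ
  simp_rw [hφ.deriv_slice] at hw
  unfold slabMeasure at i1 i2 hw
  have i12 : Integrable (fun p : ℝ × Plane => θ p.1 p.2 * fderiv ℝ φ p (1, 0) +
      θ p.1 p.2 * inner ℝ (velocity α (θ p.1) p.2) (∇ (fun y => φ (p.1, y)) p.2))
      ((volume.restrict (Ioo 0 T)).prod volume) := i1.add i2
  rw [integral_prod _ i12] at hw
  have hae : (fun t => ∫ x, (θ t x * fderiv ℝ φ (t, x) (1, 0) +
      θ t x * inner ℝ (velocity α (θ t) x) (∇ (fun y => φ (t, y)) x))) =ᵐ[volume.restrict (Ioo 0 T)]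
      fun t => (∫ x, θ t x * fderiv ℝ φ (t, x) (1, 0)) +
        ∫ x, θ t x * inner ℝ (velocity α (θ t) x) (∇ (fun y => φ (t, y)) x) := by
    filter_upwards [i1.prod_right_ae, i2.prod_right_ae] with t h1 h2 using integral_add h1 h2
  exact ⟨i12.integral_prod_left.congr hae, by rw [← integral_congr_ae hae]; exact hw⟩

/-- The residual of the sharp-front equation, tested against `φ`, is bounded by a multiple of the
area of the transition region. -/
lemma abs_integral_residual_le (hα₀ : 0 < α) (hα₁ : α < 1) (hT : 0 < T) {θ : ℝ → Plane → ℝ}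
    (hθ : IsWeakSolution α T θ) (hθC : ∀ t ∈ Ioo 0 T, ContDiff ℝ 1 (θ t)) {M : ℝ}
    (hM : ∀ t ∈ Ioo 0 T, ∀ x, |θ t x| ≤ M) {C δ : ℝ} (hδ : 0 < δ)
    (hz : IsCompatibleCurveAt C δ T θ z) (hφ : IsTestFunction T φ) {B c D : ℝ} (hD0 : 0 ≤ D)
    (hB : ∀ t x, ‖∇ (fun y => φ (t, y)) x‖ ≤ B)
    (hc : ∀ t x y, ‖∇ (fun y => φ (t, y)) x - ∇ (fun y => φ (t, y)) y‖ ≤ c * min ‖x - y‖ 1)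
    (hD : ∀ t x, |fderiv ℝ φ (t, x) (1, 0)| ≤ D) :
    |∫ p in Ioo 0 T ×ˢ Ioc 0 1, φ (p.1, z p.1 p.2) * frontResidual α z p.1 p.2| ≤
      (D + (1 + α) * c * (M + 1) * ∫ v, majorant α v) * ((M + 1) * (C * δ)) * T := by
  obtain ⟨Cz, hCz, hCzC, A, hreg⟩ := hz.exists_region
  have hA : ∀ t ∈ Ioo 0 T, IsBoundaryCurve (z t) (A t) := fun t ht => (hreg t ht).1
  have hM0 : 0 ≤ M :=
    (abs_nonneg _).trans (hM (T / 2) ⟨by linarith, by linarith⟩ 0)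
  have hc0 : 0 ≤ c := by
    have := (norm_nonneg _).trans (hc 0 0 (EuclideanSpace.single 0 1))
    simpa using this
  have hm0 : 0 ≤ ∫ v, majorant α v := integral_nonneg (majorant_nonneg α)
  set κ := D + (1 + α) * c * (M + 1) * ∫ v, majorant α v with hκ
  have hκ0 : 0 ≤ κ := by positivity
  obtain ⟨iS, iQ⟩ := integrableOn_residual_terms hα₀ hα₁ hφ hz.contDiffOn
    hz.continuousOn_deriv_two hA
  obtain ⟨iE, hE⟩ := hθ.iterated hφ
  obtain ⟨iR, hR⟩ := integral_region_time_deriv hφ hz.contDiffOn hA hT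
  have hψ : Continuous fun p : ℝ × Plane => fderiv ℝ φ p (1, 0) :=
    hφ.contDiff_fderiv.continuous.clm_apply continuous_const
  have hint : ∫ p in Ioo 0 T ×ˢ Ioc 0 1, φ (p.1, z p.1 p.2) * frontResidual α z p.1 p.2 =
      ∫ t in Ioo 0 T, ((∫ x in A t, fderiv ℝ φ (t, x) (1, 0)) + ∫ s in (0 : ℝ)..1,
        φ (t, z t s) * inner ℝ (frontIntegral α (z t) s) (perp (deriv (z t) s))) ∧
      IntegrableOn (fun t => ∫ s in (0 : ℝ)..1,
        φ (t, z t s) * inner ℝ (frontIntegral α (z t) s) (perp (deriv (z t) s))) (Ioo 0 T) := by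
    simp_rw [residual_eq_add]
    rw [integral_add iS iQ]
    rw [IntegrableOn, Measure.volume_eq_prod, ← Measure.prod_restrict] at iS iQ
    simp_rw [intervalIntegral.integral_of_le (zero_le_one' ℝ)] at hR ⊢
    refine ⟨?_, iQ.integral_prod_left⟩
    rw [Measure.volume_eq_prod, ← Measure.prod_restrict, integral_prod _ iS, integral_prod _ iQ,
      integral_add iR iQ.integral_prod_left, hR]
  obtain ⟨hint, iQ'⟩ := hint
  have hsub : ∫ p in Ioo 0 T ×ˢ Ioc 0 1, φ (p.1, z p.1 p.2) * frontResidual α z p.1 p.2 =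
      ∫ t in Ioo 0 T, (((∫ x in A t, fderiv ℝ φ (t, x) (1, 0)) + ∫ s in (0 : ℝ)..1,
        φ (t, z t s) * inner ℝ (frontIntegral α (z t) s) (perp (deriv (z t) s))) -
      ((∫ x, θ t x * fderiv ℝ φ (t, x) (1, 0)) +
        ∫ x, θ t x * inner ℝ (velocity α (θ t) x) (∇ (fun y => φ (t, y)) x))) := by
    have iRQ : Integrable (fun t => (∫ x in A t, fderiv ℝ φ (t, x) (1, 0)) + ∫ s in (0 : ℝ)..1,
        φ (t, z t s) * inner ℝ (frontIntegral α (z t) s) (perp (deriv (z t) s)))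
        (volume.restrict (Ioo 0 T)) := iR.add iQ'
    rw [integral_sub iRQ iE, hE, sub_zero, hint]
  rw [hsub, ← Real.norm_eq_abs]
  have hbound := norm_setIntegral_le_of_norm_le_const (μ := volume) (s := Ioo 0 T)
    (C := κ * ((M + 1) * (C * δ))) (f := fun t =>
      ((∫ x in A t, fderiv ℝ φ (t, x) (1, 0)) + ∫ s in (0 : ℝ)..1,
        φ (t, z t s) * inner ℝ (frontIntegral α (z t) s) (perp (deriv (z t) s))) -
      ((∫ x, θ t x * fderiv ℝ φ (t, x) (1, 0)) +
        ∫ x, θ t x * inner ℝ (velocity α (θ t) x) (∇ (fun y => φ (t, y)) x)))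
    (by simp) (fun t ht => by
      obtain ⟨h, hin, hout, hvol⟩ := hreg t ht
      refine (abs_weak_terms_sub_le hα₀ hα₁ h (hθC t ht) (hasCompactSupport_of_regions h hin hout)
        (hM t ht) (hφ.slice_contDiff t) (hφ.slice_compact t)
        (hψ.comp (Continuous.prodMk_right t)) (hB t) (hc t) (hD t)).trans ?_
      exact mul_le_mul_of_nonneg_left (integral_abs_sub_indicator_le h (hθC t ht).continuous
        (hM t ht) hin hout (by have := hCz.trans hCzC; positivity) hvol) hκ0)
  simpa [Real.volume_real_Ioo_of_le hT.le] using hbound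

end estimate

theorem mainTheorem6 (α T : ℝ) (hα₀ : 0 < α) (hα₁ : α < 1) (hT : 0 < T)
    (θ : ℝ → ℝ → Plane → ℝ) (z : ℝ → ℝ → ℝ → Plane)
    (hθ : IsAlmostSharpFront α T θ) (hz : IsCompatibleCurve T θ z) :
    (∀ᶠ δ in 𝓝[>] (0 : ℝ), ∀ t ∈ Ioo 0 T, ∀ s : ℝ,
      IntegrableOn (frontIntegrand α (z δ t) s) (Ioc 0 1)) ∧
    ∀ φ : ℝ × Plane → ℝ, IsTestFunction T φ →
      (∀ᶠ δ in 𝓝[>] (0 : ℝ),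
        IntegrableOn (fun p : ℝ × ℝ => φ (p.1, z δ p.1 p.2) * frontResidual α (z δ) p.1 p.2)
          (Ioo 0 T ×ˢ Ioc 0 1)) ∧
      ∀ α' : ℝ, α < α' →
        (fun δ : ℝ => ∫ p in Ioo 0 T ×ˢ Ioc 0 1,
          φ (p.1, z δ p.1 p.2) * frontResidual α (z δ) p.1 p.2)
        =O[𝓝[>] 0] (fun δ : ℝ => δ ^ (1 - α')) := by
  obtain ⟨C, hC⟩ := hz
  obtain ⟨M, hM⟩ := hθ.bounded
  refine ⟨?_, fun φ hφ => ⟨?_, fun α' hα' => ?_⟩⟩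
  · filter_upwards [hC] with δ hδ t ht s
    obtain ⟨_, _, _, A, hA⟩ := hδ.exists_region
    exact integrableOn_frontIntegrand hα₀ hα₁ (hA t ht).1 s
  · filter_upwards [hC] with δ hδ
    obtain ⟨_, _, _, A, hA⟩ := hδ.exists_region
    obtain ⟨h1, h2⟩ := integrableOn_residual_terms hα₀ hα₁ hφ hδ.contDiffOn
      hδ.continuousOn_deriv_two (fun t ht => (hA t ht).1)
    simp_rw [residual_eq_add]
    exact h1.add h2
  · obtain ⟨B, c, D, hD0, hB, hc, hD⟩ := hφ.exists_bounds
    refine IsBigO.of_bound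
      |(D + (1 + α) * c * (M + 1) * ∫ v, majorant α v) * ((M + 1) * C) * T| ?_
    filter_upwards [hC, hM, hθ.solution, hθ.contDiff, Ioo_mem_nhdsGT one_pos]
      with δ h1 h2 h3 h4 h5
    have key := abs_integral_residual_le hα₀ hα₁ hT h3 (fun t ht => (h4 t ht).of_le one_le_two) h2
      h5.1 h1 hφ hD0 hB hc hD
    -- `δ ≤ δ ^ (1 - α')` since `α' > 0`
    have hpow : δ ≤ δ ^ (1 - α') := by
      conv_lhs => rw [← Real.rpow_one δ]
      exact Real.rpow_le_rpow_of_exponent_ge h5.1 h5.2.le (by linarith)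
    rw [Real.norm_eq_abs, Real.norm_of_nonneg (Real.rpow_nonneg h5.1.le _)]
    calc _ ≤ _ := key
      _ = ((D + (1 + α) * c * (M + 1) * ∫ v, majorant α v) * ((M + 1) * C) * T) * δ := by ring
      _ ≤ |(D + (1 + α) * c * (M + 1) * ∫ v, majorant α v) * ((M + 1) * C) * T| * δ :=
        mul_le_mul_of_nonneg_right (le_abs_self _) h5.1.le
      _ ≤ _ := mul_le_mul_of_nonneg_left hpow (abs_nonneg _)
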